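/- Let $\alpha\in\mathbf R$, $\beta<0$, and let $Z$ be either $\mathbf R$ or $\mathbf T=\mathbf R/2\pi\mathbf Z$. Let $T>0$ and let $u$ be a smooth solution on $[0,T]\times Z$ of the kinetic derivative nonlinear Schrödinger equation \[ \partial_t u-i\partial_x^2u=\alpha\,\partial_x\big[|u|^2u\big]+\beta\,\partial_x\big[\mathcal H(|u|^2)u\big],\qquad u(0,x)=\phi(x), \] where $\mathcal H=\mathcal F^{-1}(-i\,\mathrm{sgn}(\xi))\mathcal F$ is the Hilbert transform; no smallness of $\phi$ is assumed. Here "smooth" means that $u$ is $C^\infty$ on $[0,T]\times Z$ and $u\in C([0,T];H^k(Z))$ for every $k\in\mathbf N$ (the second condition being automatic when $Z=\mathbf T$). Write $D_x^{1/2}=\mathcal F^{-1}|\xi|^{1/2}\mathcal F$. There is a constant $C>0$ depending only on $\alpha,\beta$ (it is allowed to be unbounded as $\beta\to0$) such that for all $t\in[0,T]$, in the case $Z=\mathbf R$, \[ \int_0^t\big\|D_x^{1/2}\partial_x(|u(t')|^2)\big\|_{L^2}^2\,dt'\le C\big(1+\|\phi\|_{L^2}^4\big)\|\phi_x\|_{L^2}^2\,e^{C(1+\|\phi\|_{L^2}^6)\|\phi\|_{L^2}^2},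 \] \[ \|u_x(t)\|_{L^2}^2\le C\big(1+\|\phi\|_{L^2}^8\big)\|\phi_x\|_{L^2}^2\,e^{C(1+\|\phi\|_{L^2}^6)\|\phi\|_{L^2}^2}, \] \[ \|u(t)\|_{L^2}^2\ge\|\phi\|_{L^2}^2\exp\Big[-C\,t^{1/2}\big(1+\|\phi\|_{L^2}^2\big)\|\phi_x\|_{L^2}\,e^{C(1+\|\phi\|_{L^2}^6)\|\phi\|_{L^2}^2}\Big]. \] In the case $Z=\mathbf T$ the same three estimates hold with $\|\phi_x\|_{L^2}$ replaced by $\|\phi\|_{H^1}$ (where $\|\phi\|_{H^1}^2=\|\phi\|_{L^2}^2+\|\phi_x\|_{L^2}^2$). -/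

import Mathlib

open scoped FourierTransform ContDiff

namespace KDNLS

noncomputable section

/-- The two spatial domains: the real line and the torus `ℝ / 2πℤ`.  A function on the torus is a
`2π`-periodic function on the real line. -/
inductive Domain where
  | line
  | torus

/-- `f` is a function on the domain: no condition on the line, `2π`-periodicity on the torus. -/
def Domain.IsFun : Domain → (ℝ → ℂ) → Prop
  | .line, _ => True
  | .torus, f => Function.Periodic f (2 * Real.pi)

/-- Lebesgue measure of the domain (on the torus: of the fundamental domain `(0, 2π]`, total mass
`2π`). -/
def Domain.measure : Domain → MeasureTheory.Measure ℝ
  | .line => MeasureTheory.volume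
  | .torus => MeasureTheory.volume.restrict (Set.Ioc 0 (2 * Real.pi))

/-- The Fourier multiplier `𝓕⁻¹ m 𝓕` with symbol `m`, where `m ξ` is the value at the angular
frequency `ξ` (the frequency of `x ↦ exp (i ξ x)`).  On the line the Fourier transform of Mathlib
uses the characters `exp (2 π i x ξ)`, whose angular frequency is `2 π ξ`; on the torus `f` is
expanded in its Fourier series. -/
def Domain.multiplier : Domain → (ℝ → ℂ) → (ℝ → ℂ) → ℝ → ℂ
  | .line, m, f => 𝓕⁻ (fun ξ : ℝ => m (2 * Real.pi * ξ) * 𝓕 f ξ)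
  | .torus, m, f => fun x =>
      ∑' n : ℤ, m n * fourierCoeffOn Real.two_pi_pos f n * Complex.exp (Complex.I * n * x)

/-- The Hilbert transform `𝓗 = 𝓕⁻¹ (-i sgn ξ) 𝓕`. -/
def Domain.hilbert (Z : Domain) (f : ℝ → ℂ) : ℝ → ℂ :=
  Z.multiplier (fun ξ => -Complex.I * (Real.sign ξ : ℂ)) f

/-- The fractional derivative `D^{1/2} = 𝓕⁻¹ |ξ|^{1/2} 𝓕`. -/
def Domain.halfD (Z : Domain) (f : ℝ → ℂ) : ℝ → ℂ :=
  Z.multiplier (fun ξ => (Real.sqrt |ξ| : ℂ)) f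

/-- The `L²` norm on the domain. -/
def Domain.l2Norm (Z : Domain) (f : ℝ → ℂ) : ℝ :=
  (MeasureTheory.eLpNorm f 2 Z.measure).toReal

/-- The `H¹` norm on the domain (for differentiable functions). -/
def Domain.h1Norm (Z : Domain) (f : ℝ → ℂ) : ℝ :=
  Real.sqrt (Z.l2Norm f ^ 2 + Z.l2Norm (deriv f) ^ 2)

/-- The density `|f|²`, as a complex-valued function. -/
def density (f : ℝ → ℂ) (x : ℝ) : ℂ := ((‖f x‖ ^ 2 : ℝ) : ℂ)

/-- `u` is a smooth solution on `[0, T] × Z` of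
`∂ₜu - i ∂ₓ²u = α ∂ₓ[|u|²u] + β ∂ₓ[𝓗(|u|²)u]` with `u(0) = φ`.
Smooth means that `u` is `C^∞` on `[0, T] × Z` and belongs to `C([0, T]; H^k(Z))` for all `k`
(on the torus, the first condition implies the second one). -/
structure IsSmoothSolution (Z : Domain) (α β T : ℝ) (φ : ℝ → ℂ) (u : ℝ → ℝ → ℂ) : Prop where
  isFun : ∀ t ∈ Set.Icc 0 T, Z.IsFun (u t)
  smooth : ContDiffOn ℝ ∞ (fun p : ℝ × ℝ => u p.1 p.2) (Set.Icc 0 T ×ˢ Set.univ)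
  memLp : ∀ k : ℕ, ∀ t ∈ Set.Icc 0 T, MeasureTheory.MemLp (iteratedDeriv k (u t)) 2 Z.measure
  continuous : ∀ k : ℕ, ∀ t ∈ Set.Icc 0 T,
    Filter.Tendsto
      (fun s => MeasureTheory.eLpNorm (iteratedDeriv k (u s) - iteratedDeriv k (u t)) 2 Z.measure)
      (nhdsWithin t (Set.Icc 0 T)) (nhds 0)
  equation : ∀ t ∈ Set.Ioc 0 T, ∀ x : ℝ,
    derivWithin (fun s => u s x) (Set.Icc 0 T) t - Complex.I * iteratedDeriv 2 (u t) x
      = α * deriv (fun y => density (u t) y * u t y) x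
        + β * deriv (fun y => Z.hilbert (density (u t)) y * u t y) x
  initial : ∀ x : ℝ, u 0 x = φ x

/-- The norm of the datum in the a priori bounds: `‖φₓ‖_{L²}` on the line and `‖φ‖_{H¹}` on the
torus. -/
def Domain.dataNorm : Domain → (ℝ → ℂ) → ℝ
  | .line, φ => Domain.line.l2Norm (deriv φ)
  | .torus, φ => Domain.torus.h1Norm φ

end

end KDNLS

/-! Write ρ = |u|², J = Im(ū uₓ) and V = αρ + β𝓗ρ. Since V is real, the equation reads uₜ = i uₓₓ +
(Vu)ₓ and gives ρₜ = -2Jₓ + 2Vₓρ + Vρₓ. The operator 𝓗∂ₓ has symbol |ξ|, so d/dt ‖u‖² = ∫ Vₓρ = βB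
with B = ‖D^{1/2}ρ‖². As β < 0, the mass decreases and ∫ B dt ≤ ‖φ‖²/|β|.

At the level of one derivative, with A = ‖D^{1/2}ρₓ‖² and D = ‖D^{1/2}J‖², d/dt ‖uₓ‖² = βA + 3∫
Vₓ|uₓ|², d/dt ∫ VJ = (β/2)A - 2βD + 2∫ Vₓ|uₓ|² + R, where R contains no term as bad as ∫ Vₓ|uₓ|². In
‖uₓ‖² - (3/2)∫ VJ the uncontrolled integral therefore cancels, leaving (β/4)A + 3βD - (3/2)R: both
quadratic terms have the good sign, whatever the size of the datum. The term K M ‖ρ‖⁴, with M the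
initial mass, makes this energy coercive (`exists_energy_bounds`).

The remainder R and the derivative of ‖ρ‖⁴ are estimated by interpolation: Agmon's inequality, L²
between L¹ and Ḣ^{1/2}, and Ḣ¹ between Ḣ^{1/2} and Ḣ^{3/2}. Each term is at most ε(A + D) plus a
constant times (1 + M³)·B·(energy) (`norm_remainder_le`, `remainder_total_le`,
`exists_dtEnergy_le`). What is not absorbed carries a factor B, which is integrable in time by mass
dissipation. Grönwall's argument with the mass itself as integrating factor
(`IsSmoothSolution.energy_inequality`) thus gives a bound independent of T, with exponent
proportional to (1 + M³)M, together with the bound for ∫ A dt.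

For the lower bound on the mass, interpolation gives B ≤ 2‖u‖²√A (`hsq_density_le_mass_mul`), so the
logarithm of the mass falls at rate at most 2|β|√A, and Cauchy–Schwarz in time produces the factor
t^{1/2}.

Line and torus are treated together by integrating over frequencies against a common Plancherel
measure. The only difference is its atom at ξ = 0: means are split off, and on the torus ‖u‖² is
added to the energy to control them. -/

open MeasureTheory

/-! ### The Plancherel measure, common to the line and the torus. -/

namespace KDNLS

noncomputable section

/-- Plancherel measure on the frequency side: `dξ / 2π` on the line, `1 / 2π` times the counting
measure of the integers on the torus. -/
def Domain.dual : Domain → Measure ℝ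
  | .line => ENNReal.ofReal (1 / (2 * Real.pi)) • volume
  | .torus => ENNReal.ofReal (1 / (2 * Real.pi)) •
      Measure.map (fun n : ℤ => (n : ℝ)) Measure.count

/-- The Fourier transform `∫ e^{-iξx} f(x) dx` over the domain. -/
def Domain.ft (Z : Domain) (f : ℝ → ℂ) (ξ : ℝ) : ℂ :=
  ∫ x, Complex.exp (-(Complex.I * ξ * x)) * f x ∂Z.measure

/-- The inverse Fourier transform, an integral against the Plancherel measure. -/
def Domain.ift (Z : Domain) (h : ℝ → ℂ) (x : ℝ) : ℂ :=
  ∫ ξ, Complex.exp (Complex.I * ξ * x) * h ξ ∂Z.dual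

/-- Smooth functions on the domain all of whose derivatives are in `L^p`. -/
structure Domain.Nice (Z : Domain) (p : ENNReal) (f : ℝ → ℂ) : Prop where
  contDiff : ContDiff ℝ ∞ f
  isFun : Z.IsFun f
  memLp : ∀ k : ℕ, MemLp (iteratedDeriv k f) p Z.measure

/-- Rapidly decaying functions of the frequency. -/
structure Domain.Rapid (Z : Domain) (h : ℝ → ℂ) : Prop where
  aesm : AEStronglyMeasurable h Z.dual
  decay : ∀ k : ℕ, ∃ C, ∀ᵐ ξ ∂Z.dual, |ξ| ^ k * ‖h ξ‖ ≤ C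

theorem measurableEmbedding_intCast : MeasurableEmbedding (fun n : ℤ => (n : ℝ)) :=
  Int.isClosedEmbedding_coe_real.measurableEmbedding

instance (Z : Domain) : SFinite Z.measure := by
  cases Z <;> simp only [Domain.measure] <;> infer_instance

instance (Z : Domain) : SFinite Z.dual := by
  cases Z <;> simp only [Domain.dual] <;> infer_instance

theorem inv_two_pi_nonneg : (0:ℝ) ≤ 1 / (2 * Real.pi) := by positivity

theorem lintegral_dual_line (f : ℝ → ENNReal) :
    ∫⁻ ξ, f ξ ∂Domain.line.dual = ENNReal.ofReal (1 / (2 * Real.pi)) * ∫⁻ ξ, f ξ := by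
  simp [Domain.dual]

theorem lintegral_dual_torus (f : ℝ → ENNReal) :
    ∫⁻ ξ, f ξ ∂Domain.torus.dual = ENNReal.ofReal (1 / (2 * Real.pi)) * ∑' n : ℤ, f n := by
  simp only [Domain.dual, lintegral_smul_measure, smul_eq_mul]
  rw [measurableEmbedding_intCast.lintegral_map, lintegral_count]

theorem integral_dual_line (f : ℝ → ℂ) :
    ∫ ξ, f ξ ∂Domain.line.dual = (1 / (2 * Real.pi) : ℝ) * ∫ ξ, f ξ := by
  simp only [Domain.dual, integral_smul_measure]
  rw [ENNReal.toReal_ofReal inv_two_pi_nonneg, Complex.real_smul]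

theorem ae_dual_torus {p : ℝ → Prop} : (∀ᵐ ξ ∂Domain.torus.dual, p ξ) ↔ ∀ n : ℤ, p n := by
  simp only [Domain.dual]
  rw [Measure.ae_ennreal_smul_measure_eq (by simp [Real.pi_pos]),
    measurableEmbedding_intCast.ae_map_iff, Measure.ae_count_iff]

theorem integral_dual_torus {f : ℝ → ℂ} (hf : Integrable f Domain.torus.dual) :
    ∫ ξ, f ξ ∂Domain.torus.dual = (1 / (2 * Real.pi) : ℝ) * ∑' n : ℤ, f n := by
  have hf' : Integrable (fun n : ℤ => f n) Measure.count := by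
    simp only [Domain.dual] at hf
    rw [integrable_smul_measure (by simp [Real.pi_pos]) (by simp),
      measurableEmbedding_intCast.integrable_map_iff] at hf
    exact hf
  simp only [Domain.dual, integral_smul_measure]
  rw [ENNReal.toReal_ofReal inv_two_pi_nonneg, Complex.real_smul,
    measurableEmbedding_intCast.integral_map, integral_countable hf']
  simp [measureReal_def]

theorem integrable_dual_torus_iff {f : ℝ → ℂ} :
    Integrable f Domain.torus.dual ↔ Summable (fun n : ℤ => ‖f n‖) := by
  simp only [Domain.dual]
  rw [integrable_smul_measure (by simp [Real.pi_pos]) (by simp),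
      measurableEmbedding_intCast.integrable_map_iff, integrable_count_iff]
  rfl

theorem integral_inv_sq_add_sq_line {A B : ℝ} (hA : 0 < A) (hB : 0 < B) :
    Integrable (fun ξ : ℝ => 1 / (A ^ 2 + B ^ 2 * ξ ^ 2)) ∧
      ∫ ξ : ℝ, 1 / (A ^ 2 + B ^ 2 * ξ ^ 2) = Real.pi / (A * B) := by
  have e : (fun ξ : ℝ => 1 / (A ^ 2 + B ^ 2 * ξ ^ 2))
      = fun ξ : ℝ => (1 / A ^ 2) * (1 + ((B / A) * ξ) ^ 2)⁻¹ := by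
    ext ξ
    have : 0 < A ^ 2 + B ^ 2 * ξ ^ 2 := by positivity
    field_simp
  rw [e]
  have hBA : B / A ≠ 0 := by positivity
  refine ⟨((integrable_comp_mul_left_iff (fun x : ℝ => (1 + x ^ 2)⁻¹) hBA).2
    integrable_inv_one_add_sq).const_mul _, ?_⟩
  rw [integral_const_mul, Measure.integral_comp_mul_left (fun x : ℝ => (1 + x ^ 2)⁻¹),
    integral_univ_inv_one_add_sq, abs_of_pos (by positivity), smul_eq_mul]
  field_simp

theorem sum_inv_sq_add_sq_le {A B : ℝ} (hA : 0 < A) (hB : 0 < B) (N : ℕ) :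
    ∑ i ∈ Finset.range N, 1 / (A ^ 2 + B ^ 2 * ((i:ℝ) + 1) ^ 2) ≤ Real.pi / (2 * A * B) := by
  have hanti : AntitoneOn (fun ξ : ℝ => 1 / (A ^ 2 + B ^ 2 * ξ ^ 2)) (Set.Icc 0 (0 + (N:ℝ))) := by
    intro x hx y hy hxy
    have := hx.1
    simp only
    gcongr
  have h := hanti.sum_le_integral
  simp only [zero_add, Nat.cast_add, Nat.cast_one] at h
  refine h.trans ?_
  obtain ⟨hi, he⟩ := integral_inv_sq_add_sq_line hA hB
  have hsym : ∫ ξ in Set.Ioi (0:ℝ), 1 / (A ^ 2 + B ^ 2 * ξ ^ 2) = Real.pi / (2 * A * B) := by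
    have h2 := integral_comp_abs (f := fun ξ : ℝ => 1 / (A ^ 2 + B ^ 2 * ξ ^ 2))
    simp only [sq_abs] at h2
    rw [he] at h2
    field_simp at h2 ⊢
    linarith
  rw [← hsym, intervalIntegral.integral_of_le (by positivity)]
  exact setIntegral_mono_set hi.integrableOn (ae_of_all _ fun x => by positivity)
    (Filter.Eventually.of_forall fun x hx => hx.1)

/-- On the line this is the arctangent integral; on the torus each half of the sum is dominated by
the integral over a half line, by monotonicity. Removing ξ = 0 is what makes the constant the same
for both domains, and all the interpolation inequalities rest on it. -/
theorem lintegral_dual_inv_le (Z : Domain) {A B : ℝ} (hA : 0 < A) (hB : 0 < B) :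
    ∫⁻ ξ in {0}ᶜ, ENNReal.ofReal (1 / (A ^ 2 + B ^ 2 * ξ ^ 2)) ∂Z.dual
      ≤ ENNReal.ofReal (1 / (2 * A * B)) := by
  have h2 : ENNReal.ofReal (1 / (2 * A * B)) =
      ENNReal.ofReal (1 / (2 * Real.pi)) * ENNReal.ofReal (Real.pi / (A * B)) := by
    rw [← ENNReal.ofReal_mul (by positivity)]
    congr 1
    have := Real.pi_pos
    field_simp
  cases Z
  · refine (setLIntegral_le_lintegral _ _).trans ?_
    obtain ⟨hi, he⟩ := integral_inv_sq_add_sq_line hA hB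
    rw [lintegral_dual_line, ← ofReal_integral_eq_lintegral_ofReal hi
      (ae_of_all _ fun x => by positivity), he, h2]
  · rw [← lintegral_indicator (measurableSet_singleton _).compl, lintegral_dual_torus, h2]
    gcongr
    -- The integers split into n ≥ 0 and -(n + 1); the term n = 0 is then detached and is killed by
    -- the indicator.
    rw [tsum_of_nat_of_neg_add_one ENNReal.summable ENNReal.summable,
      tsum_eq_zero_add' ENNReal.summable]
    have key : ∑' n : ℕ, ENNReal.ofReal (1 / (A ^ 2 + B ^ 2 * ((n:ℝ) + 1) ^ 2))
        ≤ ENNReal.ofReal (Real.pi / (2 * A * B)) := by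
      apply ENNReal.tsum_le_of_sum_range_le
      intro n
      rw [← ENNReal.ofReal_sum_of_nonneg fun _ _ => by positivity]
      exact ENNReal.ofReal_le_ofReal (sum_inv_sq_add_sq_le hA hB n)
    have e : ENNReal.ofReal (Real.pi / (A * B)) =
        ENNReal.ofReal (Real.pi / (2 * A * B)) + ENNReal.ofReal (Real.pi / (2 * A * B)) := by
      have := Real.pi_pos
      rw [← ENNReal.ofReal_add (by positivity) (by positivity)]
      congr 1
      field_simp
      norm_num
    rw [e]
    gcongr
    · simp only [Nat.cast_zero, Int.cast_zero, Set.mem_compl_iff, Set.mem_singleton_iff,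
        not_true_eq_false, not_false_eq_true, Set.indicator_of_notMem, zero_add]
      refine le_trans (le_of_eq (tsum_congr fun n => ?_)) key
      rw [Set.indicator_of_mem]
      · push_cast; rfl
      · simp only [Set.mem_compl_iff, Set.mem_singleton_iff]; positivity
    · refine le_trans (le_of_eq (tsum_congr fun n => ?_)) key
      rw [Set.indicator_of_mem]
      · push_cast; congr 3; ring
      · simp only [Set.mem_compl_iff, Set.mem_singleton_iff]
        push_cast
        have : (0:ℝ) ≤ n := by positivity
        linarith

/-- The mass of the zero frequency: `0` on the line, `1 / 2π` on the torus. -/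
def Domain.atom (Z : Domain) : ℝ := Z.dual.real {0}

theorem dual_singleton_zero_lt_top (Z : Domain) : Z.dual {0} < ⊤ := by
  cases Z
  · simp [Domain.dual]
  · rw [← lintegral_indicator_one (measurableSet_singleton _), lintegral_dual_torus,
      tsum_eq_single 0]
    · simp
    · intro n hn
      rw [Set.indicator_of_notMem]
      simpa using hn

theorem atom_line : Domain.line.atom = 0 := by
  simp [Domain.atom, Domain.dual, measureReal_def]

theorem atom_torus : Domain.torus.atom = 1 / (2 * Real.pi) := by
  rw [Domain.atom, measureReal_def, ← lintegral_indicator_one (measurableSet_singleton _),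
    lintegral_dual_torus, tsum_eq_single 0]
  · simp [Real.pi_nonneg]
  · intro n hn
    rw [Set.indicator_of_notMem]
    simpa using hn

theorem atom_nonneg (Z : Domain) : 0 ≤ Z.atom := measureReal_nonneg

theorem atom_le_one (Z : Domain) : Z.atom ≤ 1 := by
  cases Z
  · rw [atom_line]; exact zero_le_one
  · rw [atom_torus, div_le_one (by positivity)]
    linarith [Real.pi_gt_three]

theorem integrable_dual_inv (Z : Domain) {A B : ℝ} (hA : 0 < A) (hB : 0 < B) :
    Integrable (fun ξ : ℝ => 1 / (A ^ 2 + B ^ 2 * ξ ^ 2)) Z.dual := by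
  rw [← integrableOn_univ, ← Set.compl_union_self {(0:ℝ)}]
  have hm : Measurable (fun ξ : ℝ => 1 / (A ^ 2 + B ^ 2 * ξ ^ 2)) := by fun_prop
  refine IntegrableOn.union ⟨hm.aestronglyMeasurable, ?_⟩ ?_
  · rw [hasFiniteIntegral_iff_ofReal (ae_of_all _ fun x => by positivity)]
    exact (lintegral_dual_inv_le Z hA hB).trans_lt ENNReal.ofReal_lt_top
  · exact integrableOn_singleton (by simp) (dual_singleton_zero_lt_top Z)

theorem integrable_dual_one_add_sq (Z : Domain) :
    Integrable (fun ξ : ℝ => 1 / (1 + ξ ^ 2)) Z.dual := by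
  simpa using integrable_dual_inv Z one_pos one_pos

theorem integral_dual_inv_le (Z : Domain) {A B : ℝ} (hA : 0 < A) (hB : 0 < B) :
    ∫ ξ in {0}ᶜ, 1 / (A ^ 2 + B ^ 2 * ξ ^ 2) ∂Z.dual ≤ 1 / (2 * A * B) := by
  rw [integral_eq_lintegral_of_nonneg_ae (ae_of_all _ fun x => by positivity)
    (Measurable.aestronglyMeasurable (by fun_prop))]
  exact ENNReal.toReal_le_of_le_ofReal (by positivity) (lintegral_dual_inv_le Z hA hB)

/-- The Plancherel measure is invariant under reflection. -/
theorem lintegral_dual_neg (Z : Domain) (f : ℝ → ENNReal) :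
    ∫⁻ ξ, f (-ξ) ∂Z.dual = ∫⁻ ξ, f ξ ∂Z.dual := by
  cases Z
  · rw [lintegral_dual_line, lintegral_dual_line,
      (Measure.measurePreserving_neg volume).lintegral_comp_emb
        (MeasurableEquiv.neg ℝ).measurableEmbedding]
  · rw [lintegral_dual_torus, lintegral_dual_torus]
    congr 1
    rw [← (Equiv.neg ℤ).tsum_eq]
    simp

theorem measurePreserving_dual_neg (Z : Domain) :
    MeasurePreserving (fun ξ : ℝ => -ξ) Z.dual Z.dual := by
  refine ⟨measurable_neg, ?_⟩
  ext s hs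
  rw [Measure.map_apply measurable_neg hs, ← lintegral_indicator_one hs,
    ← lintegral_indicator_one (measurable_neg hs), ← lintegral_dual_neg Z (s.indicator 1)]
  rfl

theorem ae_dual_torus_int : ∀ᵐ ξ ∂Domain.torus.dual, ∃ n : ℤ, ξ = (n : ℝ) := by
  rw [ae_dual_torus]; exact fun n => ⟨n, rfl⟩

theorem norm_exp_I_mul (ξ x : ℝ) : ‖Complex.exp (Complex.I * ξ * x)‖ = 1 := by
  rw [show Complex.I * (ξ:ℂ) * x = ((ξ * x : ℝ) : ℂ) * Complex.I by push_cast; ring]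
  exact Complex.norm_exp_ofReal_mul_I _

theorem norm_exp_neg_I_mul (ξ x : ℝ) : ‖Complex.exp (-(Complex.I * ξ * x))‖ = 1 := by
  rw [show -(Complex.I * (ξ:ℂ) * x) = ((-(ξ * x) : ℝ) : ℂ) * Complex.I by push_cast; ring]
  exact Complex.norm_exp_ofReal_mul_I _

end

end KDNLS

/-! ### Rapid decay in frequency against smoothness in space. -/

namespace KDNLS

noncomputable section

variable {Z : Domain} {f g h k : ℝ → ℂ}

/-- Two further powers of |ξ| are spent to gain the weight 1/(1 + ξ²), which is integrable on either
dual. -/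
theorem Domain.Rapid.bound (hh : Z.Rapid h) (j : ℕ) :
    ∃ C, ∀ᵐ ξ ∂Z.dual, |ξ| ^ j * ‖h ξ‖ ≤ C * (1 / (1 + ξ ^ 2)) := by
  obtain ⟨C, hC⟩ := hh.decay j
  obtain ⟨D, hD⟩ := hh.decay (j + 2)
  refine ⟨C + D, ?_⟩
  filter_upwards [hC, hD] with ξ h1 h2
  have : 0 < 1 + ξ ^ 2 := by positivity
  rw [mul_one_div, le_div_iff₀ this]
  have e : |ξ| ^ (j + 2) = |ξ| ^ j * ξ ^ 2 := by rw [pow_add, sq_abs]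
  rw [e] at h2
  nlinarith

theorem Domain.Rapid.integrable_pow (hh : Z.Rapid h) (j : ℕ) :
    Integrable (fun ξ => |ξ| ^ j * ‖h ξ‖) Z.dual := by
  obtain ⟨C, hC⟩ := hh.bound j
  refine ((integrable_dual_one_add_sq Z).const_mul C).mono' ?_ ?_
  · exact (Measurable.aestronglyMeasurable (by fun_prop)).mul hh.aesm.norm
  · filter_upwards [hC] with ξ h1
    rwa [Real.norm_of_nonneg (by positivity)]

theorem Domain.Rapid.integrable (hh : Z.Rapid h) : Integrable h Z.dual := by
  rw [← integrable_norm_iff hh.aesm]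
  simpa using hh.integrable_pow 0

theorem Domain.Rapid.integrable_sq (hh : Z.Rapid h) (j : ℕ) :
    Integrable (fun ξ => |ξ| ^ j * ‖h ξ‖ ^ 2) Z.dual := by
  obtain ⟨C, hC⟩ := hh.decay 0
  refine ((hh.integrable_pow j).const_mul C).mono' ?_ ?_
  · exact (Measurable.aestronglyMeasurable (by fun_prop)).mul (hh.aesm.norm.pow 2)
  · filter_upwards [hC] with ξ h1
    rw [Real.norm_of_nonneg (by positivity)]
    simp only [pow_zero, one_mul] at h1
    have : 0 ≤ |ξ| ^ j * ‖h ξ‖ := by positivity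
    nlinarith

theorem Domain.Rapid.mul (hh : Z.Rapid h) {m : ℝ → ℂ} (hm : Measurable m) {C : ℝ}
    (hC : ∀ ξ, ‖m ξ‖ ≤ C * (1 + |ξ|)) : Z.Rapid (fun ξ => m ξ * h ξ) := by
  refine ⟨hm.aestronglyMeasurable.mul hh.aesm, fun j => ?_⟩
  obtain ⟨D, hD⟩ := hh.decay j
  obtain ⟨D', hD'⟩ := hh.decay (j + 1)
  refine ⟨C * (D + D'), ?_⟩
  have hC0 : 0 ≤ C := by simpa using (norm_nonneg _).trans (hC 0)
  filter_upwards [hD, hD'] with ξ h1 h2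
  rw [norm_mul]
  rw [pow_succ] at h2
  calc |ξ| ^ j * (‖m ξ‖ * ‖h ξ‖) ≤ |ξ| ^ j * ((C * (1 + |ξ|)) * ‖h ξ‖) := by gcongr; exact hC ξ
    _ = C * (|ξ| ^ j * ‖h ξ‖ + |ξ| ^ j * |ξ| * ‖h ξ‖) := by ring
    _ ≤ C * (D + D') := by gcongr

theorem Domain.Rapid.mul_bounded (hh : Z.Rapid h) {m : ℝ → ℂ} (hm : Measurable m) {C : ℝ}
    (hC : ∀ ξ, ‖m ξ‖ ≤ C) : Z.Rapid (fun ξ => m ξ * h ξ) := by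
  refine hh.mul hm (C := C) fun ξ => (hC ξ).trans ?_
  have hC0 : 0 ≤ C := (norm_nonneg _).trans (hC 0)
  nlinarith [abs_nonneg ξ]

theorem Domain.Rapid.mul_I (hh : Z.Rapid h) : Z.Rapid (fun ξ => Complex.I * ξ * h ξ) := by
  refine hh.mul (by fun_prop) (C := 1) fun ξ => ?_
  simp

theorem continuous_exp_I (ξ : ℝ) : Continuous fun x : ℝ => Complex.exp (Complex.I * ξ * x) := by
  fun_prop

theorem integrable_exp_mul (hh : Integrable h Z.dual) (x : ℝ) :
    Integrable (fun ξ : ℝ => Complex.exp (Complex.I * ξ * x) * h ξ) Z.dual := by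
  refine hh.bdd_mul (c := 1) (Continuous.aestronglyMeasurable (by fun_prop)) ?_
  exact ae_of_all _ fun ξ => (norm_exp_I_mul ξ x).le

theorem integrable_exp_neg_mul (hf : Integrable f Z.measure) (ξ : ℝ) :
    Integrable (fun x : ℝ => Complex.exp (-(Complex.I * ξ * x)) * f x) Z.measure := by
  refine hf.bdd_mul (c := 1) (Continuous.aestronglyMeasurable (by fun_prop)) ?_
  exact ae_of_all _ fun x => (norm_exp_neg_I_mul ξ x).le

theorem hasDerivAt_exp_I (ξ x : ℝ) : HasDerivAt (fun x : ℝ => Complex.exp (Complex.I * ξ * x))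
    (Complex.exp (Complex.I * ξ * x) * (Complex.I * ξ)) x := by
  have h1 : HasDerivAt (fun x : ℝ => Complex.I * ξ * (x:ℂ)) (Complex.I * ξ) x := by
    simpa using (Complex.ofRealCLM.hasDerivAt (x := x)).const_mul (Complex.I * (ξ:ℂ))
  exact h1.cexp

theorem hasDerivAt_ift (hh : Z.Rapid h) (x : ℝ) :
    HasDerivAt (Z.ift h) (Z.ift (fun ξ => Complex.I * ξ * h ξ) x) x := by
  refine (hasDerivAt_integral_of_dominated_loc_of_deriv_le (𝕜 := ℝ)
    (F := fun x ξ => Complex.exp (Complex.I * ξ * x) * h ξ)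
    (F' := fun x ξ => Complex.exp (Complex.I * ξ * x) * (Complex.I * ξ * h ξ))
    (bound := fun ξ => |ξ| ^ 1 * ‖h ξ‖) (s := Set.univ) Filter.univ_mem
    ?_ (integrable_exp_mul hh.integrable x) ?_ ?_ (hh.integrable_pow 1) ?_).2
  · exact Filter.Eventually.of_forall fun y => (integrable_exp_mul hh.integrable y).1
  · exact (integrable_exp_mul hh.mul_I.integrable x).1
  · refine ae_of_all _ fun ξ y _ => ?_
    rw [norm_mul, norm_exp_I_mul]
    simp
  · refine ae_of_all _ fun ξ y _ => ?_
    have := (hasDerivAt_exp_I ξ y).mul_const (h ξ)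
    rw [mul_assoc] at this
    exact this

theorem deriv_ift (hh : Z.Rapid h) : deriv (Z.ift h) = Z.ift (fun ξ => Complex.I * ξ * h ξ) :=
  funext fun x => (hasDerivAt_ift hh x).deriv

theorem contDiff_ift (hh : Z.Rapid h) : ContDiff ℝ ∞ (Z.ift h) := by
  rw [contDiff_infty]
  intro n
  induction n generalizing h with
  | zero =>
    exact contDiff_zero.2 (continuous_iff_continuousAt.2 fun x => (hasDerivAt_ift hh x).continuousAt)
  | succ n ih =>
    push_cast
    rw [contDiff_succ_iff_deriv]
    refine ⟨fun x => (hasDerivAt_ift hh x).differentiableAt, by simp, ?_⟩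
    rw [deriv_ift hh]
    exact ih hh.mul_I

theorem iteratedDeriv_ift (hh : Z.Rapid h) (j : ℕ) :
    ∃ k, Z.Rapid k ∧ iteratedDeriv j (Z.ift h) = Z.ift k := by
  induction j with
  | zero => exact ⟨h, hh, iteratedDeriv_zero⟩
  | succ j ih =>
    obtain ⟨k, hk, e⟩ := ih
    exact ⟨_, hk.mul_I, by rw [iteratedDeriv_succ, e, deriv_ift hk]⟩

theorem isFun_ift (h : ℝ → ℂ) : Z.IsFun (Z.ift h) := by
  cases Z
  · trivial
  · intro x
    refine integral_congr_ae ?_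
    filter_upwards [ae_dual_torus_int] with ξ ⟨n, hn⟩
    subst hn
    congr 1
    rw [Complex.exp_eq_exp_iff_exists_int]
    exact ⟨n, by push_cast; ring⟩

theorem norm_ift_le (h : ℝ → ℂ) (x : ℝ) : ‖Z.ift h x‖ ≤ ∫ ξ, ‖h ξ‖ ∂Z.dual := by
  refine (norm_integral_le_integral_norm _).trans (le_of_eq ?_)
  simp only [norm_mul, norm_exp_I_mul, one_mul]

theorem norm_ft_le (f : ℝ → ℂ) (ξ : ℝ) : ‖Z.ft f ξ‖ ≤ ∫ x, ‖f x‖ ∂Z.measure := by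
  refine (norm_integral_le_integral_norm _).trans (le_of_eq ?_)
  simp only [norm_mul, norm_exp_neg_I_mul, one_mul]

theorem integral_torus (g : ℝ → ℂ) :
    ∫ x, g x ∂Domain.torus.measure = ∫ x in (0:ℝ)..(2 * Real.pi), g x := by
  rw [intervalIntegral.integral_of_le (by positivity)]; rfl

theorem integral_eq_zero_of_hasDerivAt {g' : ℝ → ℂ} (hg : ∀ x, HasDerivAt g (g' x) x)
    (hZ : Z.IsFun g) (hi : Integrable g Z.measure) (hi' : Integrable g' Z.measure) :
    ∫ x, g' x ∂Z.measure = 0 := by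
  cases Z
  · exact integral_eq_zero_of_hasDerivAt_of_integrable hg hi' hi
  · rw [integral_torus, intervalIntegral.integral_eq_sub_of_hasDerivAt (fun x _ => hg x)]
    · have : g (0 + 2 * Real.pi) = g 0 := hZ 0
      rw [← this]; simp
    · exact (intervalIntegrable_iff_integrableOn_Ioc_of_le (by positivity)).2 hi'

theorem Domain.Nice.differentiable {p} (hf : Z.Nice p f) : Differentiable ℝ f :=
  hf.contDiff.differentiable (by simp)

theorem Domain.Nice.hasDerivAt {p} (hf : Z.Nice p f) (x : ℝ) : HasDerivAt f (deriv f x) x :=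
  (hf.differentiable x).hasDerivAt

theorem Domain.Nice.continuous {p} (hf : Z.Nice p f) : Continuous f := hf.contDiff.continuous

theorem isFun_deriv (hf : Z.IsFun f) : Z.IsFun (deriv f) := by
  cases Z
  · trivial
  · intro x
    have : (fun y => f (y + 2 * Real.pi)) = f := funext hf
    conv_rhs => rw [← this]
    rw [deriv_comp_add_const]

theorem Domain.Nice.deriv {p} (hf : Z.Nice p f) : Z.Nice p (deriv f) := by
  refine ⟨(contDiff_infty_iff_deriv.1 hf.contDiff).2, isFun_deriv hf.isFun, fun k => ?_⟩
  rw [← iteratedDeriv_succ']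
  exact hf.memLp (k + 1)

theorem Domain.Nice.iteratedDeriv {p} (hf : Z.Nice p f) (k : ℕ) : Z.Nice p (iteratedDeriv k f) := by
  induction k with
  | zero => rw [iteratedDeriv_zero]; exact hf
  | succ k ih => rw [iteratedDeriv_succ]; exact ih.deriv

theorem Domain.Nice.memLp_self {p} (hf : Z.Nice p f) : MemLp f p Z.measure := by
  simpa using hf.memLp 0

theorem Domain.Nice.integrable (hf : Z.Nice 1 f) : Integrable f Z.measure :=
  memLp_one_iff_integrable.1 hf.memLp_self

theorem integral_deriv_eq_zero (hf : Z.Nice 1 f) : ∫ x, deriv f x ∂Z.measure = 0 :=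
  integral_eq_zero_of_hasDerivAt hf.hasDerivAt hf.isFun hf.integrable hf.deriv.integrable

/-- Integration by parts needs the character to be a function on the domain. On the torus this
restricts ξ to the integers, which carry the dual measure; hence the almost everywhere form. -/
theorem ft_deriv (hf : Z.Nice 1 f) :
    ∀ᵐ ξ ∂Z.dual, Z.ft (deriv f) ξ = Complex.I * ξ * Z.ft f ξ := by
  have key : ∀ ξ : ℝ, Z.IsFun (fun x : ℝ => Complex.exp (-(Complex.I * ξ * x)) * f x) →
      Z.ft (deriv f) ξ = Complex.I * ξ * Z.ft f ξ := by
    intro ξ hξ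
    have hd : ∀ x : ℝ, HasDerivAt (fun x : ℝ => Complex.exp (-(Complex.I * ξ * x)) * f x)
        (Complex.exp (-(Complex.I * ξ * x)) * deriv f x
          - Complex.I * ξ * (Complex.exp (-(Complex.I * ξ * x)) * f x)) x := by
      intro x
      have h1 := hasDerivAt_exp_I (-ξ) x
      have e : ∀ x : ℝ, Complex.exp (Complex.I * (-ξ : ℝ) * x)
        = Complex.exp (-(Complex.I * ξ * x)) := fun x => by congr 1; push_cast; ring
      simp only [e] at h1
      exact (h1.mul (hf.hasDerivAt x)).congr_deriv (by push_cast; ring)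
    have h0 := integral_eq_zero_of_hasDerivAt hd hξ (integrable_exp_neg_mul hf.integrable ξ)
      ((integrable_exp_neg_mul hf.deriv.integrable ξ).sub
        ((integrable_exp_neg_mul hf.integrable ξ).const_mul _))
    rw [integral_sub (integrable_exp_neg_mul hf.deriv.integrable ξ)
      ((integrable_exp_neg_mul hf.integrable ξ).const_mul _), integral_const_mul] at h0
    exact sub_eq_zero.1 h0
  cases Z
  · exact ae_of_all _ fun ξ => key ξ trivial
  · filter_upwards [ae_dual_torus_int] with ξ ⟨n, hn⟩
    refine key ξ fun x => ?_
    subst hn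
    have h1 : f (x + 2 * Real.pi) = f x := hf.isFun x
    simp only [h1]
    congr 1
    rw [Complex.exp_eq_exp_iff_exists_int]
    exact ⟨-n, by push_cast; ring⟩

theorem continuous_ft (hf : Integrable f Z.measure) : Continuous (Z.ft f) := by
  refine continuous_of_dominated (bound := fun x => ‖f x‖) ?_ ?_ hf.norm ?_
  · exact fun ξ => (integrable_exp_neg_mul hf ξ).1
  · refine fun ξ => ae_of_all _ fun x => ?_
    rw [norm_mul, norm_exp_neg_I_mul, one_mul]
  · exact ae_of_all _ fun x => by fun_prop

theorem rapid_ft (hf : Z.Nice 1 f) : Z.Rapid (Z.ft f) := by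
  refine ⟨(continuous_ft hf.integrable).aestronglyMeasurable, fun k => ?_⟩
  have key : ∀ᵐ ξ ∂Z.dual, ‖Z.ft (iteratedDeriv k f) ξ‖ = |ξ| ^ k * ‖Z.ft f ξ‖ := by
    induction k with
    | zero => simp
    | succ k ih =>
      filter_upwards [ih, ft_deriv (hf.iteratedDeriv k)] with ξ h1 h2
      rw [iteratedDeriv_succ, h2, norm_mul, h1, norm_mul, Complex.norm_I, Complex.norm_real,
        Real.norm_eq_abs]
      ring
  refine ⟨∫ x, ‖iteratedDeriv k f x‖ ∂Z.measure, ?_⟩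
  filter_upwards [key] with ξ h1
  rw [← h1]
  exact norm_ft_le _ _

end

end KDNLS

/-! ### Fourier inversion, and Parseval's identity on the torus. -/

namespace KDNLS

noncomputable section

variable {Z : Domain} {f g h k : ℝ → ℂ}

theorem fourier_eq_ft (f : ℝ → ℂ) (ξ : ℝ) : 𝓕 f ξ = Domain.line.ft f (2 * Real.pi * ξ) := by
  rw [Real.fourier_real_eq_integral_exp_smul]
  refine integral_congr_ae (ae_of_all _ fun x => ?_)
  simp only [smul_eq_mul]
  congr 2
  push_cast; ring

theorem fourierInv_eq_ift (h : ℝ → ℂ) (x : ℝ) :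
    𝓕⁻ (fun ξ : ℝ => h (2 * Real.pi * ξ)) x = Domain.line.ift h x := by
  rw [Real.fourierInv_eq', Domain.ift, integral_dual_line]
  have := Measure.integral_comp_mul_left
    (fun ξ : ℝ => Complex.exp (Complex.I * ξ * x) * h ξ) (2 * Real.pi)
  rw [abs_of_pos (by positivity), Complex.real_smul] at this
  rw [one_div, ← this]
  refine integral_congr_ae (ae_of_all _ fun ξ => ?_)
  simp only [smul_eq_mul]
  congr 2
  simp
  ring

theorem fourierCoeffOn_eq_ft (f : ℝ → ℂ) (n : ℤ) :
    fourierCoeffOn Real.two_pi_pos f n = (1 / (2 * Real.pi) : ℝ) * Domain.torus.ft f n := by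
  rw [fourierCoeffOn_eq_integral, sub_zero, Complex.real_smul, Domain.ft, integral_torus]
  congr 1
  refine intervalIntegral.integral_congr fun x _ => ?_
  simp only [smul_eq_mul]
  rw [fourier_coe_apply]
  congr 2
  have : (Real.pi : ℂ) ≠ 0 := by exact_mod_cast Real.pi_ne_zero
  push_cast
  field_simp

/-- The bridge from the multipliers of the statement (Fourier transform or Fourier series) to
integrals against the Plancherel measure, which are used everywhere else. -/
theorem multiplier_eq_ift {m : ℝ → ℂ} (hm : Z.Rapid (fun ξ => m ξ * Z.ft f ξ)) :
    Z.multiplier m f = Z.ift (fun ξ => m ξ * Z.ft f ξ) := by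
  ext x
  cases Z
  · rw [← fourierInv_eq_ift]
    simp only [Domain.multiplier, fourier_eq_ft]
  · rw [Domain.ift, integral_dual_torus (integrable_exp_mul hm.integrable x), ← tsum_mul_left]
    simp only [Domain.multiplier]
    refine tsum_congr fun n => ?_
    rw [fourierCoeffOn_eq_ft]
    push_cast; ring

/-- Fourier inversion. -/
theorem ift_ft (hf : Z.Nice 1 f) : Z.ift (Z.ft f) = f := by
  have hr := rapid_ft hf
  have hm : Z.multiplier (fun _ => 1) f = Z.ift (Z.ft f) := by
    rw [multiplier_eq_ift] <;> simp only [one_mul]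
    exact hr
  rw [← hm]
  cases Z
  · simp only [Domain.multiplier, one_mul]
    apply hf.continuous.fourierInv_fourier_eq hf.integrable
    have e : 𝓕 f = fun ξ => Domain.line.ft f (2 * Real.pi * ξ) := funext (fourier_eq_ft f)
    rw [e, integrable_comp_mul_left_iff _ (by positivity)]
    have := hr.integrable
    rwa [Domain.dual, integrable_smul_measure (by simp [Real.pi_pos]) (by simp)] at this
  · have : Fact (0 < 2 * Real.pi) := ⟨Real.two_pi_pos⟩
    have hper : Function.Periodic f (2 * Real.pi) := hf.isFun
    let F : C(AddCircle (2 * Real.pi), ℂ) :=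
      ⟨hper.lift, continuous_coinduced_dom.mpr hf.continuous⟩
    have hF : ∀ n, fourierCoeff F n = fourierCoeffOn Real.two_pi_pos f n := by
      intro n
      rw [fourierCoeff_eq_intervalIntegral _ _ 0, fourierCoeffOn_eq_integral]
      simp [F]
    have hs : Summable (fourierCoeff F) := by
      have h1 := (integrable_dual_torus_iff.1 hr.integrable).of_norm
      refine (h1.mul_left ((1 / (2 * Real.pi) : ℝ) : ℂ)).congr fun n => ?_
      rw [hF, fourierCoeffOn_eq_ft]
    ext x
    have h2 := (has_pointwise_sum_fourier_series_of_summable hs (x : AddCircle (2 * Real.pi))).tsum_eq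
    have h3 : F (x : AddCircle (2 * Real.pi)) = f x := by simp [F]
    rw [← h3, ← h2]
    simp only [Domain.multiplier]
    refine tsum_congr fun n => ?_
    rw [hF, fourier_coe_apply, smul_eq_mul, one_mul]
    congr 2
    have : (Real.pi : ℂ) ≠ 0 := by exact_mod_cast Real.pi_ne_zero
    push_cast
    field_simp

theorem integral_exp_torus (m n : ℤ) :
    ∫ x, Complex.exp (-(Complex.I * (n:ℝ) * x)) * Complex.exp (Complex.I * (m:ℝ) * x)
      ∂Domain.torus.measure = if m = n then (2 * Real.pi : ℝ) else 0 := by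
  have e : ∀ x : ℝ, Complex.exp (-(Complex.I * (n:ℝ) * x)) * Complex.exp (Complex.I * (m:ℝ) * x)
      = Complex.exp (Complex.I * ((m - n : ℤ) : ℝ) * x) := fun x => by
    rw [← Complex.exp_add]; congr 1; push_cast; ring
  simp only [e]
  rw [integral_torus]
  split_ifs with hmn
  · subst hmn; simp
  · have hne : (Complex.I * ((m - n : ℤ) : ℝ)) ≠ 0 := by
      simp [Complex.I_ne_zero, sub_eq_zero, hmn]
    have h1 : ∀ x : ℝ, HasDerivAt (fun x : ℝ => Complex.exp (Complex.I * ((m - n : ℤ) : ℝ) * x)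
        / (Complex.I * ((m - n : ℤ) : ℝ))) (Complex.exp (Complex.I * ((m - n : ℤ) : ℝ) * x)) x := by
      intro x
      have := (hasDerivAt_exp_I ((m - n : ℤ) : ℝ) x).div_const (Complex.I * ((m - n : ℤ) : ℝ))
      rwa [mul_div_cancel_right₀ _ hne] at this
    rw [intervalIntegral.integral_eq_sub_of_hasDerivAt (fun x _ => h1 x)
      ((continuous_exp_I _).intervalIntegrable _ _)]
    have h2 : Complex.exp (Complex.I * ((m - n : ℤ) : ℝ) * (2 * Real.pi : ℝ)) = 1 := by
      rw [Complex.exp_eq_one_iff]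
      exact ⟨m - n, by push_cast; ring⟩
    rw [h2]; simp

theorem ft_ift_torus (hh : Domain.torus.Rapid h) :
    ∀ᵐ ξ ∂Domain.torus.dual, Domain.torus.ft (Domain.torus.ift h) ξ = h ξ := by
  rw [ae_dual_torus]
  intro n
  have hfin : IsFiniteMeasure Domain.torus.measure := by
    simp only [Domain.measure]; infer_instance
  have h1 : Integrable (Function.uncurry fun x ξ : ℝ => Complex.exp (-(Complex.I * (n:ℝ) * x)) *
      (Complex.exp (Complex.I * ξ * x) * h ξ)) (Domain.torus.measure.prod Domain.torus.dual) := by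
    have h2 : Integrable (fun p : ℝ × ℝ => (1:ℂ) * h p.2)
      (Domain.torus.measure.prod Domain.torus.dual) := (integrable_const (1:ℂ)).mul_prod hh.integrable
    have h3 : Function.uncurry (fun x ξ : ℝ => Complex.exp (-(Complex.I * (n:ℝ) * x)) *
      (Complex.exp (Complex.I * ξ * x) * h ξ)) = fun p : ℝ × ℝ =>
        (Complex.exp (-(Complex.I * (n:ℝ) * p.1)) * Complex.exp (Complex.I * p.2 * p.1))
          * ((1:ℂ) * h p.2) := by
      ext p; simp [Function.uncurry]; ring
    rw [h3]
    refine h2.bdd_mul (c := 1) (Continuous.aestronglyMeasurable (by fun_prop)) ?_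
    refine ae_of_all _ fun p => ?_
    rw [norm_mul, norm_exp_neg_I_mul, norm_exp_I_mul, one_mul]
  simp only [Domain.ft, Domain.ift, ← integral_const_mul]
  rw [integral_integral_swap h1]
  have h4 : ∀ᵐ (ξ : ℝ) ∂Domain.torus.dual, ∫ x, Complex.exp (-(Complex.I * (n:ℝ) * x)) *
      (Complex.exp (Complex.I * ξ * x) * h ξ) ∂Domain.torus.measure
      = (if ξ = (n : ℝ) then (2 * Real.pi : ℝ) else 0) * h ξ := by
    rw [ae_dual_torus]
    intro m
    simp only [← mul_assoc]
    rw [integral_mul_const, integral_exp_torus]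
    simp
  rw [integral_congr_ae h4, integral_dual_torus, tsum_eq_single n]
  · have : (Real.pi : ℂ) ≠ 0 := by exact_mod_cast Real.pi_ne_zero
    simp
    field_simp
  · intro m hm
    rw [if_neg (by exact_mod_cast hm)]; simp
  · rw [integrable_dual_torus_iff]
    refine summable_of_ne_finset_zero (s := {n}) fun m hm => ?_
    rw [if_neg]
    · simp
    · simpa using hm

/-- Expanding only the conjugated factor and applying Fubini leaves `ft (ift k)`, which is `k` by
orthogonality of the characters. -/
theorem parseval_torus (hh : Domain.torus.Rapid h) (hk : Domain.torus.Rapid k) :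
    ∫ x, (starRingEnd ℂ) (Domain.torus.ift h x) * Domain.torus.ift k x ∂Domain.torus.measure
      = ∫ ξ, (starRingEnd ℂ) (h ξ) * k ξ ∂Domain.torus.dual := by
  have hfin : IsFiniteMeasure Domain.torus.measure := by
    simp only [Domain.measure]; infer_instance
  have hki : Integrable (Domain.torus.ift k) Domain.torus.measure := by
    refine Integrable.of_bound (contDiff_ift hk).continuous.aestronglyMeasurable
      (∫ ξ, ‖k ξ‖ ∂Domain.torus.dual) (ae_of_all _ (norm_ift_le k))
  have e : ∀ x, (starRingEnd ℂ) (Domain.torus.ift h x) * Domain.torus.ift k x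
      = ∫ ξ, (Complex.exp (-(Complex.I * ξ * x)) * (starRingEnd ℂ) (h ξ)) * Domain.torus.ift k x
          ∂Domain.torus.dual := by
    intro x
    rw [integral_mul_const]
    congr 1
    rw [Domain.ift, ← integral_conj]
    refine integral_congr_ae (ae_of_all _ fun ξ => ?_)
    simp only [map_mul, ← Complex.exp_conj]
    congr 2
    simp
  simp only [e]
  rw [integral_integral_swap]
  · refine integral_congr_ae ?_
    filter_upwards [ft_ift_torus hk] with ξ hξ
    rw [← hξ, Domain.ft, ← integral_const_mul]
    refine integral_congr_ae (ae_of_all _ fun x => ?_)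
    simp only
    ring
  · have h2 : Integrable (fun p : ℝ × ℝ => Domain.torus.ift k p.1 * (starRingEnd ℂ) (h p.2))
      (Domain.torus.measure.prod Domain.torus.dual) :=
        hki.mul_prod (Complex.conjCLE.toContinuousLinearMap.integrable_comp hh.integrable)
    have h3 : Function.uncurry (fun x ξ : ℝ => (Complex.exp (-(Complex.I * ξ * x))
        * (starRingEnd ℂ) (h ξ)) * Domain.torus.ift k x) = fun p : ℝ × ℝ =>
        Complex.exp (-(Complex.I * p.2 * p.1))
          * (Domain.torus.ift k p.1 * (starRingEnd ℂ) (h p.2)) := by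
      ext p; simp [Function.uncurry]; ring
    rw [h3]
    refine h2.bdd_mul (c := 1) (Continuous.aestronglyMeasurable (by fun_prop)) ?_
    exact ae_of_all _ fun p => (norm_exp_neg_I_mul _ _).le

end

end KDNLS

/-! ### Parseval's identity on the line, and L² norms in frequency. -/

namespace KDNLS

noncomputable section

variable {Z : Domain} {f g h k : ℝ → ℂ}

/-- Both sides are locally integrable, so it suffices to test against smooth compactly supported φ.
On each side the inverse transform moves onto φ: by the distributional description of the L²
transform, and by Fubini for the integral. -/
theorem coeFn_fourierInv_toLp (h1 : Integrable h) (h2 : MemLp h 2 volume) :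
    ((𝓕⁻ (h2.toLp h) : Lp ℂ 2 (volume : Measure ℝ)) : ℝ → ℂ) =ᵐ[volume] 𝓕⁻ h := by
  have hc : Continuous (𝓕⁻ h) := by
    have : 𝓕⁻ h = fun x => 𝓕 h (-x) := funext (Real.fourierInv_eq_fourier_neg h)
    rw [this]
    exact (VectorFourier.fourierIntegral_continuous Real.continuous_fourierChar
      (innerSL ℝ).continuous₂ h1).comp continuous_neg
  have hG : LocallyIntegrable ((𝓕⁻ (h2.toLp h) : Lp ℂ 2 (volume : Measure ℝ)) : ℝ → ℂ) volume :=
    (Lp.memLp _).locallyIntegrable (by norm_num)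
  have key := ae_eq_zero_of_integral_contDiff_smul_eq_zero (hG.sub hc.locallyIntegrable) ?_
  · filter_upwards [key] with x hx
    simpa [sub_eq_zero] using hx
  intro φ hφ hφc
  have hg₁ : HasCompactSupport (Complex.ofRealCLM ∘ φ) := hφc.comp_left rfl
  have hg₂ : ContDiff ℝ ∞ (Complex.ofRealCLM ∘ φ) := by fun_prop
  set ψ : SchwartzMap ℝ ℂ := hg₁.toSchwartzMap hg₂ with hψ
  have hψa : ∀ x, ψ x = (φ x : ℂ) := fun x => rfl
  have e1 : ∫ x, φ x • ((𝓕⁻ (h2.toLp h) : Lp ℂ 2 (volume : Measure ℝ)) : ℝ → ℂ) x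
      = ∫ x, (𝓕⁻ ψ : SchwartzMap ℝ ℂ) x • h x := by
    have := congrArg (fun F => F ψ) (Lp.fourierInv_toTemperedDistribution_eq (h2.toLp h))
    simp only [TemperedDistribution.fourierInv_apply, Lp.toTemperedDistribution_apply] at this
    simp only [hψa] at this
    rw [show (∫ x, φ x • ((𝓕⁻ (h2.toLp h) : Lp ℂ 2 (volume : Measure ℝ)) : ℝ → ℂ) x)
      = ∫ x, (φ x : ℂ) • ((𝓕⁻ (h2.toLp h) : Lp ℂ 2 (volume : Measure ℝ)) : ℝ → ℂ) x from
        integral_congr_ae (ae_of_all _ fun x => by simp), ← this]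
    refine integral_congr_ae ?_
    filter_upwards [h2.coeFn_toLp] with x hx
    rw [hx]
  have e2 : ∫ x, φ x • 𝓕⁻ h x = ∫ x, (𝓕⁻ ψ : SchwartzMap ℝ ℂ) x • h x := by
    rw [SchwartzMap.fourierInv_coe]
    -- Negating the pairing turns the forward Fourier integral into the inverse one, so the usual
    -- self-adjointness formula applies.
    have h3 := VectorFourier.integral_fourierIntegral_smul_eq_flip (𝕜 := ℝ) (L := -(innerₗ ℝ))
      (μ := volume) (ν := volume)
      Real.continuous_fourierChar 
      (show Continuous fun p : ℝ × ℝ => (-(innerₗ ℝ)) p.1 p.2 by simp; fun_prop) ψ.integrable h1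
    have e3 : ∀ (q : ℝ → ℂ) (x : ℝ),
        VectorFourier.fourierIntegral Real.fourierChar volume (-(innerₗ ℝ)) q x = 𝓕⁻ q x := by
      intro q x
      rw [Real.fourierInv_eq]
      simp [VectorFourier.fourierIntegral]
    have e4 : ∀ (q : ℝ → ℂ) (x : ℝ),
        VectorFourier.fourierIntegral Real.fourierChar volume (-(innerₗ ℝ)).flip q x
          = 𝓕⁻ q x := by
      intro q x
      rw [Real.fourierInv_eq]
      simp [VectorFourier.fourierIntegral, mul_comm]
    simp only [e3, e4] at h3
    rw [h3]
    exact integral_congr_ae (ae_of_all _ fun x => by simp [hψa])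
  simp only [Pi.sub_apply, smul_sub]
  rw [integral_sub, e1, e2, sub_self]
  · exact hG.integrable_smul_left_of_hasCompactSupport hφ.continuous hφc
  · exact hc.locallyIntegrable.integrable_smul_left_of_hasCompactSupport hφ.continuous hφc

theorem memLp_fourierInv (h1 : Integrable h) (h2 : MemLp h 2 volume) : MemLp (𝓕⁻ h) 2 volume :=
  (memLp_congr_ae (coeFn_fourierInv_toLp h1 h2)).1 (Lp.memLp _)

theorem integral_conj_fourierInv_mul (h1 : Integrable h) (h2 : MemLp h 2 volume)
    (k1 : Integrable k) (k2 : MemLp k 2 volume) :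
    ∫ x, (starRingEnd ℂ) (𝓕⁻ h x) * 𝓕⁻ k x = ∫ ξ, (starRingEnd ℂ) (h ξ) * k ξ := by
  have e := (Lp.fourierTransformₗᵢ ℝ ℂ).symm.inner_map_map (h2.toLp h) (k2.toLp k)
  rw [L2.inner_def, L2.inner_def] at e
  simp only [RCLike.inner_apply'] at e
  calc _ = _ := ?_
    _ = _ := e
    _ = _ := ?_
  · refine integral_congr_ae ?_
    filter_upwards [coeFn_fourierInv_toLp h1 h2, coeFn_fourierInv_toLp k1 k2] with x e1 e2
    rw [← e1, ← e2]
    rfl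
  · refine integral_congr_ae ?_
    filter_upwards [h2.coeFn_toLp, k2.coeFn_toLp] with x e1 e2
    rw [e1, e2]

theorem Domain.Rapid.integrable_line (hh : Domain.line.Rapid h) :
    Integrable (fun ξ : ℝ => h (2 * Real.pi * ξ)) := by
  rw [integrable_comp_mul_left_iff _ (by positivity)]
  have := hh.integrable
  rwa [Domain.dual, integrable_smul_measure (by simp [Real.pi_pos]) (by simp)] at this

theorem Domain.Rapid.memLp_line (hh : Domain.line.Rapid h) :
    MemLp (fun ξ : ℝ => h (2 * Real.pi * ξ)) 2 volume := by
  rw [← integrable_norm_rpow_iff hh.integrable_line.1 (by simp) (by simp)]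
  have h2 := hh.integrable_sq 0
  rw [Domain.dual, integrable_smul_measure (by simp [Real.pi_pos]) (by simp)] at h2
  simp only [pow_zero, one_mul] at h2
  have := (integrable_comp_mul_left_iff (fun ξ : ℝ => ‖h ξ‖ ^ 2)
    (by positivity : 2 * Real.pi ≠ 0)).2 h2
  simpa using this

theorem ift_line (h : ℝ → ℂ) : Domain.line.ift h = 𝓕⁻ (fun ξ : ℝ => h (2 * Real.pi * ξ)) :=
  funext fun x => (fourierInv_eq_ift h x).symm

theorem memLp_ift (hh : Z.Rapid h) : MemLp (Z.ift h) 2 Z.measure := by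
  cases Z
  · rw [ift_line]
    exact memLp_fourierInv hh.integrable_line hh.memLp_line
  · have hfin : IsFiniteMeasure Domain.torus.measure := by
      simp only [Domain.measure]; infer_instance
    exact MemLp.of_bound (contDiff_ift hh).continuous.aestronglyMeasurable _
      (ae_of_all _ (norm_ift_le h))

/-- Parseval's identity. -/
theorem parseval (hh : Z.Rapid h) (hk : Z.Rapid k) :
    ∫ x, (starRingEnd ℂ) (Z.ift h x) * Z.ift k x ∂Z.measure
      = ∫ ξ, (starRingEnd ℂ) (h ξ) * k ξ ∂Z.dual := by
  cases Z
  · rw [ift_line, ift_line, integral_dual_line]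
    change ∫ x, (starRingEnd ℂ) (𝓕⁻ (fun ξ : ℝ => h (2 * Real.pi * ξ)) x)
      * 𝓕⁻ (fun ξ : ℝ => k (2 * Real.pi * ξ)) x = _
    rw [integral_conj_fourierInv_mul hh.integrable_line hh.memLp_line hk.integrable_line
      hk.memLp_line, Measure.integral_comp_mul_left (fun ξ => (starRingEnd ℂ) (h ξ) * k ξ),
      abs_of_pos (by positivity), Complex.real_smul, one_div]
  · exact parseval_torus hh hk

theorem nice_ift (hh : Z.Rapid h) : Z.Nice 2 (Z.ift h) := by
  refine ⟨contDiff_ift hh, isFun_ift h, fun j => ?_⟩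
  obtain ⟨k, hk, e⟩ := iteratedDeriv_ift hh j
  rw [e]
  exact memLp_ift hk

/-- Derivatives in L¹ make the transform decay rapidly, and inverse transforms of rapidly decaying
functions are in L². Products of L² functions can therefore be multiplied again. -/
theorem Domain.Nice.two (hf : Z.Nice 1 f) : Z.Nice 2 f := by
  rw [← ift_ft hf]
  exact nice_ift (rapid_ft hf)

theorem l2Norm_nonneg (f : ℝ → ℂ) : 0 ≤ Z.l2Norm f := ENNReal.toReal_nonneg

theorem sq_l2Norm (hf : MemLp f 2 Z.measure) :
    Z.l2Norm f ^ 2 = ∫ x, ‖f x‖ ^ 2 ∂Z.measure := by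
  rw [Domain.l2Norm, hf.eLpNorm_eq_integral_rpow_norm (by simp) (by simp),
    ENNReal.toReal_ofReal (by positivity)]
  have h0 : 0 ≤ ∫ x, ‖f x‖ ^ 2 ∂Z.measure := integral_nonneg fun x => by positivity
  simp only [ENNReal.toReal_ofNat, Real.rpow_ofNat]
  rw [← Real.rpow_natCast, ← Real.rpow_mul h0]
  norm_num

theorem sq_l2Norm_ift (hh : Z.Rapid h) : Z.l2Norm (Z.ift h) ^ 2 = ∫ ξ, ‖h ξ‖ ^ 2 ∂Z.dual := by
  rw [sq_l2Norm (memLp_ift hh)]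
  have e := parseval hh hh
  have e2 : ∀ z : ℂ, (starRingEnd ℂ) z * z = ((‖z‖ ^ 2 : ℝ) : ℂ) := fun z => by
    rw [Complex.conj_mul']; push_cast; rfl
  simp only [e2, integral_complex_ofReal] at e
  exact_mod_cast e

end

end KDNLS

/-! ### Multipliers of order zero and interpolation inequalities. -/

namespace KDNLS

noncomputable section

variable {Z : Domain} {f g h k : ℝ → ℂ} {m m' : ℝ → ℂ} {C C' : ℝ}

/-- Bounded measurable symbols. -/
structure SymbolBound (C : ℝ) (m : ℝ → ℂ) : Prop where
  meas : Measurable m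
  le : ∀ ξ, ‖m ξ‖ ≤ C

theorem SymbolBound.nonneg (hm : SymbolBound C m) : 0 ≤ C := (norm_nonneg _).trans (hm.le 0)

/-- The Fourier multiplier with symbol `m`, as an integral over frequencies. -/
def Domain.op (Z : Domain) (m f : ℝ → ℂ) : ℝ → ℂ := Z.ift (fun ξ => m ξ * Z.ft f ξ)

/-- The symbol of the projection to nonzero frequencies. -/
def oscSym (ξ : ℝ) : ℂ := if ξ = 0 then 0 else 1

/-- The symbol of the Hilbert transform. -/
def hilbertSym (ξ : ℝ) : ℂ := -Complex.I * (Real.sign ξ : ℂ)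

/-- The mean value of `f` on the torus, and `0` on the line. -/
def Domain.mean (Z : Domain) (f : ℝ → ℂ) : ℂ := Z.atom * ∫ x, f x ∂Z.measure

/-- The square of the homogeneous `H^{1/2}` seminorm. -/
def Domain.hsq (Z : Domain) (f : ℝ → ℂ) : ℝ := ∫ ξ, |ξ| * ‖Z.ft f ξ‖ ^ 2 ∂Z.dual

theorem measurable_sign : Measurable Real.sign := by
  unfold Real.sign
  exact Measurable.ite measurableSet_Iio measurable_const
    (Measurable.ite measurableSet_Ioi measurable_const measurable_const)

theorem symbolBound_osc : SymbolBound 1 oscSym := by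
  refine ⟨Measurable.ite (measurableSet_singleton 0) measurable_const measurable_const, ?_⟩
  intro ξ
  unfold oscSym
  split_ifs <;> simp

theorem abs_sign_le (ξ : ℝ) : |Real.sign ξ| ≤ 1 := by
  rcases Real.sign_apply_eq ξ with h | h | h <;> simp [h]

theorem symbolBound_hilbert : SymbolBound 1 hilbertSym := by
  refine ⟨?_, ?_⟩
  · unfold hilbertSym
    exact (Complex.measurable_ofReal.comp measurable_sign).const_mul _
  · intro ξ
    simpa [hilbertSym] using abs_sign_le ξ

theorem SymbolBound.mul (hm : SymbolBound C m) (hm' : SymbolBound C' m') :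
    SymbolBound (C * C') (fun ξ => m ξ * m' ξ) := by
  refine ⟨hm.meas.mul hm'.meas, fun ξ => ?_⟩
  rw [norm_mul]
  exact mul_le_mul (hm.le ξ) (hm'.le ξ) (norm_nonneg _) hm.nonneg

theorem SymbolBound.conj (hm : SymbolBound C m) :
    SymbolBound C (fun ξ => (starRingEnd ℂ) (m ξ)) := by
  refine ⟨Complex.continuous_conj.measurable.comp hm.meas, fun ξ => ?_⟩
  rw [RCLike.norm_conj]; exact hm.le ξ

theorem symbolBound_one : SymbolBound 1 (fun _ => 1) := ⟨measurable_const, by simp⟩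

theorem SymbolBound.rapid (hm : SymbolBound C m) (hf : Z.Nice 1 f) :
    Z.Rapid (fun ξ => m ξ * Z.ft f ξ) := (rapid_ft hf).mul_bounded hm.meas hm.le

theorem nice_op (hm : SymbolBound C m) (hf : Z.Nice 1 f) : Z.Nice 2 (Z.op m f) :=
  nice_ift (hm.rapid hf)

theorem deriv_op (hm : SymbolBound C m) (hf : Z.Nice 1 f) :
    deriv (Z.op m f) = Z.op m (deriv f) := by
  rw [Domain.op, deriv_ift (hm.rapid hf)]
  ext x
  refine integral_congr_ae ?_
  filter_upwards [ft_deriv hf] with ξ hξ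
  rw [hξ]; ring

theorem op_one (hf : Z.Nice 1 f) : Z.op (fun _ => 1) f = f := by
  simp only [Domain.op, one_mul, ift_ft hf]

theorem ft_add (hf : Integrable f Z.measure) (hg : Integrable g Z.measure) (ξ : ℝ) :
    Z.ft (fun x => f x + g x) ξ = Z.ft f ξ + Z.ft g ξ := by
  simp only [Domain.ft, mul_add]
  exact integral_add (integrable_exp_neg_mul hf ξ) (integrable_exp_neg_mul hg ξ)

theorem ft_const_mul (c : ℂ) (ξ : ℝ) : Z.ft (fun x => c * f x) ξ = c * Z.ft f ξ := by
  simp only [Domain.ft, ← integral_const_mul]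
  congr 1; ext x; ring

theorem ift_add (hh : Integrable h Z.dual) (hk : Integrable k Z.dual) (x : ℝ) :
    Z.ift (fun ξ => h ξ + k ξ) x = Z.ift h x + Z.ift k x := by
  simp only [Domain.ift, mul_add]
  exact integral_add (integrable_exp_mul hh x) (integrable_exp_mul hk x)

theorem ift_const_mul (c : ℂ) (x : ℝ) : Z.ift (fun ξ => c * h ξ) x = c * Z.ift h x := by
  simp only [Domain.ift, ← integral_const_mul]
  congr 1; ext x; ring

theorem op_add (hm : SymbolBound C m) (hf : Z.Nice 1 f) (hg : Z.Nice 1 g) (x : ℝ) :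
    Z.op m (fun y => f y + g y) x = Z.op m f x + Z.op m g x := by
  rw [Domain.op, Domain.op, Domain.op,
    ← ift_add (hm.rapid hf).integrable (hm.rapid hg).integrable]
  congr 1; ext ξ
  rw [ft_add hf.integrable hg.integrable]; ring

theorem op_const_mul (c : ℂ) (x : ℝ) : Z.op m (fun y => c * f y) x = c * Z.op m f x := by
  rw [Domain.op, Domain.op, ← ift_const_mul]
  congr 1; ext ξ
  rw [ft_const_mul]; ring

theorem op_symbol_add (hm : SymbolBound C m) (hm' : SymbolBound C' m') (hf : Z.Nice 1 f) (x : ℝ) :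
    Z.op (fun ξ => m ξ + m' ξ) f x = Z.op m f x + Z.op m' f x := by
  rw [Domain.op, Domain.op, Domain.op,
    ← ift_add (hm.rapid hf).integrable (hm'.rapid hf).integrable]
  congr 1; ext ξ; ring

theorem op_symbol_const_mul (c : ℂ) (x : ℝ) : Z.op (fun ξ => c * m ξ) f x = c * Z.op m f x := by
  rw [Domain.op, Domain.op, ← ift_const_mul]
  congr 1; ext ξ; ring

theorem hilbert_eq_op (hf : Z.Nice 1 f) : Z.hilbert f = Z.op hilbertSym f :=
  multiplier_eq_ift (symbolBound_hilbert.rapid hf)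

theorem l2Norm_le_of_sq {a : ℝ} (ha : 0 ≤ a) (h : Z.l2Norm f ^ 2 ≤ a ^ 2) : Z.l2Norm f ≤ a :=
  (pow_le_pow_iff_left₀ (l2Norm_nonneg _) ha two_ne_zero).1 h

theorem sq_l2Norm_op (hm : SymbolBound C m) (hf : Z.Nice 1 f) :
    Z.l2Norm (Z.op m f) ^ 2 = ∫ ξ, ‖m ξ‖ ^ 2 * ‖Z.ft f ξ‖ ^ 2 ∂Z.dual := by
  rw [Domain.op, sq_l2Norm_ift (hm.rapid hf)]
  simp only [norm_mul, mul_pow]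

theorem integrable_norm_sq_mul (hm : SymbolBound C m) (hf : Z.Nice 1 f) :
    Integrable (fun ξ => ‖m ξ‖ ^ 2 * ‖Z.ft f ξ‖ ^ 2) Z.dual := by
  simpa [norm_mul, mul_pow] using (hm.rapid hf).integrable_sq 0

/-- By Parseval, a pointwise comparison of symbols is a comparison of L² norms. -/
theorem l2Norm_op_le_of_le (hm : SymbolBound C m) (hm' : SymbolBound C' m') {c : ℝ} (hc : 0 ≤ c)
    (hle : ∀ ξ, ‖m ξ‖ ≤ c * ‖m' ξ‖) (hf : Z.Nice 1 f) :
    Z.l2Norm (Z.op m f) ≤ c * Z.l2Norm (Z.op m' f) := by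
  refine l2Norm_le_of_sq (mul_nonneg hc (l2Norm_nonneg _)) ?_
  rw [mul_pow, sq_l2Norm_op hm hf, sq_l2Norm_op hm' hf, ← integral_const_mul]
  refine integral_mono (integrable_norm_sq_mul hm hf)
    ((integrable_norm_sq_mul hm' hf).const_mul _) fun ξ => ?_
  have := pow_le_pow_left₀ (norm_nonneg _) (hle ξ) 2
  rw [mul_pow] at this
  simp only
  rw [← mul_assoc]
  gcongr

theorem l2Norm_op_le (hm : SymbolBound C m) (hf : Z.Nice 1 f) :
    Z.l2Norm (Z.op m f) ≤ C * Z.l2Norm f := by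
  have := l2Norm_op_le_of_le hm symbolBound_one hm.nonneg (fun ξ => by simpa using hm.le ξ) hf
  rwa [op_one hf] at this

theorem l2Norm_op_le_osc (hm : SymbolBound C m) (h0 : m 0 = 0) (hf : Z.Nice 1 f) :
    Z.l2Norm (Z.op m f) ≤ C * Z.l2Norm (Z.op oscSym f) := by
  refine l2Norm_op_le_of_le hm symbolBound_osc hm.nonneg (fun ξ => ?_) hf
  unfold oscSym
  split_ifs with h
  · simp [h, h0]
  · simpa using hm.le ξ

theorem integral_mul_le_sqrt_mul_sqrt {α : Type*} [MeasurableSpace α] {μ : Measure α} {p q : α → ℝ}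
    (hp : AEStronglyMeasurable p μ) (hq : AEStronglyMeasurable q μ) (hp0 : ∀ x, 0 ≤ p x)
    (hq0 : ∀ x, 0 ≤ q x) (hp2 : Integrable (fun x => p x ^ 2) μ)
    (hq2 : Integrable (fun x => q x ^ 2) μ) :
    ∫ x, p x * q x ∂μ ≤ √(∫ x, p x ^ 2 ∂μ) * √(∫ x, q x ^ 2 ∂μ) := by
  have h := integral_mul_le_Lp_mul_Lq_of_nonneg Real.HolderConjugate.two_two
    (ae_of_all μ hp0) (ae_of_all μ hq0)
    (by simpa using (memLp_two_iff_integrable_sq hp).2 hp2)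
    (by simpa using (memLp_two_iff_integrable_sq hq).2 hq2)
  simpa [Real.sqrt_eq_rpow] using h

theorem hsq_nonneg (f : ℝ → ℂ) : 0 ≤ Z.hsq f := integral_nonneg fun ξ => by positivity

theorem integrable_hsq (hf : Z.Nice 1 f) : Integrable (fun ξ => |ξ| * ‖Z.ft f ξ‖ ^ 2) Z.dual := by
  simpa using (rapid_ft hf).integrable_sq 1

theorem sq_l2Norm_deriv (hf : Z.Nice 1 f) :
    Z.l2Norm (deriv f) ^ 2 = ∫ ξ, ξ ^ 2 * ‖Z.ft f ξ‖ ^ 2 ∂Z.dual := by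
  conv_lhs => rw [← ift_ft hf.deriv]
  rw [sq_l2Norm_ift (rapid_ft hf.deriv)]
  refine integral_congr_ae ?_
  filter_upwards [ft_deriv hf] with ξ hξ
  rw [hξ, norm_mul, norm_mul, Complex.norm_I, Complex.norm_real, mul_pow, one_mul,
    Real.norm_eq_abs, sq_abs]

theorem hsq_deriv (hf : Z.Nice 1 f) :
    Z.hsq (deriv f) = ∫ ξ, |ξ| ^ 3 * ‖Z.ft f ξ‖ ^ 2 ∂Z.dual := by
  refine integral_congr_ae ?_
  filter_upwards [ft_deriv hf] with ξ hξ
  rw [hξ, norm_mul, norm_mul, Complex.norm_I, Complex.norm_real, one_mul, Real.norm_eq_abs]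
  ring

theorem aesm_ft (hf : Z.Nice 1 f) : AEStronglyMeasurable (Z.ft f) Z.dual := (rapid_ft hf).aesm

/-- Cauchy–Schwarz with ξ² = |ξ|^{1/2}·|ξ|^{3/2}: Ḣ¹ lies between Ḣ^{1/2} and Ḣ^{3/2}. -/
theorem sq_l2Norm_deriv_le (hf : Z.Nice 1 f) :
    Z.l2Norm (deriv f) ^ 2 ≤ √(Z.hsq f) * √(Z.hsq (deriv f)) := by
  have e1 : ∀ ξ : ℝ, (√|ξ| * ‖Z.ft f ξ‖) ^ 2 = |ξ| * ‖Z.ft f ξ‖ ^ 2 := fun ξ => by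
    rw [mul_pow, Real.sq_sqrt (abs_nonneg _)]
  have e2 : ∀ ξ : ℝ, (√|ξ| * |ξ| * ‖Z.ft f ξ‖) ^ 2 = |ξ| ^ 3 * ‖Z.ft f ξ‖ ^ 2 := fun ξ => by
    rw [mul_pow, mul_pow, Real.sq_sqrt (abs_nonneg _)]; ring
  have h := integral_mul_le_sqrt_mul_sqrt (μ := Z.dual) (p := fun ξ : ℝ => √|ξ| * ‖Z.ft f ξ‖)
    (q := fun ξ : ℝ => √|ξ| * |ξ| * ‖Z.ft f ξ‖)
    ((Continuous.aestronglyMeasurable (by fun_prop)).mul (aesm_ft hf).norm)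
    ((Continuous.aestronglyMeasurable (by fun_prop)).mul (aesm_ft hf).norm)
    (fun ξ => by positivity) (fun ξ => by positivity)
    (by simp only [e1]; exact integrable_hsq hf)
    (by simp only [e2]; exact (rapid_ft hf).integrable_sq 3)
  simp only [e1, e2] at h
  rw [← hsq_deriv hf] at h
  refine le_trans (le_of_eq ?_) h
  rw [sq_l2Norm_deriv hf]
  refine integral_congr_ae (ae_of_all _ fun ξ => ?_)
  have := Real.mul_self_sqrt (abs_nonneg ξ)
  simp only
  calc ξ ^ 2 * ‖Z.ft f ξ‖ ^ 2 = |ξ| * |ξ| * ‖Z.ft f ξ‖ ^ 2 := by rw [← sq_abs]; ring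
    _ = (√|ξ| * √|ξ|) * |ξ| * ‖Z.ft f ξ‖ ^ 2 := by rw [this]
    _ = _ := by ring

theorem sq_l2Norm_osc (hf : Z.Nice 1 f) :
    Z.l2Norm (Z.op oscSym f) ^ 2 = ∫ ξ in {0}ᶜ, ‖Z.ft f ξ‖ ^ 2 ∂Z.dual := by
  rw [sq_l2Norm_op symbolBound_osc hf, ← integral_indicator (measurableSet_singleton _).compl]
  refine integral_congr_ae (ae_of_all _ fun ξ => ?_)
  by_cases h : ξ = 0 <;> simp [oscSym, h]

/-- Cauchy–Schwarz again; the weight |ξ| vanishes at the origin, so the mean may be dropped from the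
L² factor. -/
theorem hsq_le (hf : Z.Nice 1 f) :
    Z.hsq f ≤ Z.l2Norm (Z.op oscSym f) * Z.l2Norm (deriv f) := by
  have e1 : ∀ ξ : ℝ, (‖oscSym ξ‖ * ‖Z.ft f ξ‖) ^ 2 = ‖oscSym ξ‖ ^ 2 * ‖Z.ft f ξ‖ ^ 2 :=
    fun ξ => by rw [mul_pow]
  have e2 : ∀ ξ : ℝ, (|ξ| * ‖Z.ft f ξ‖) ^ 2 = ξ ^ 2 * ‖Z.ft f ξ‖ ^ 2 := fun ξ => by
    rw [mul_pow, sq_abs]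
  have h := integral_mul_le_sqrt_mul_sqrt (μ := Z.dual) (p := fun ξ : ℝ => ‖oscSym ξ‖ * ‖Z.ft f ξ‖)
    (q := fun ξ : ℝ => |ξ| * ‖Z.ft f ξ‖)
    (symbolBound_osc.meas.norm.aestronglyMeasurable.mul (aesm_ft hf).norm)
    ((Continuous.aestronglyMeasurable (by fun_prop)).mul (aesm_ft hf).norm)
    (fun ξ => by positivity) (fun ξ => by positivity)
    (by simp only [e1]; exact integrable_norm_sq_mul symbolBound_osc hf)
    (by simp only [e2]; simpa using (rapid_ft hf).integrable_sq 2)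
  simp only [e1, e2] at h
  rw [← sq_l2Norm_deriv hf, ← sq_l2Norm_op symbolBound_osc hf, Real.sqrt_sq (l2Norm_nonneg _),
    Real.sqrt_sq (l2Norm_nonneg _)] at h
  refine le_trans (le_of_eq ?_) h
  refine integral_congr_ae (ae_of_all _ fun ξ => ?_)
  by_cases hξ : ξ = 0
  · simp [hξ]
  · simp [oscSym, hξ]; ring

theorem integrable_ft_norm (hf : Z.Nice 1 f) : Integrable (fun ξ => ‖Z.ft f ξ‖) Z.dual :=
  (rapid_ft hf).integrable.norm

/-- Agmon's inequality in frequency: Cauchy–Schwarz against the weight A² + B²ξ², optimised in A and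
B. -/
theorem sq_integral_ft_le (hf : Z.Nice 1 f) :
    (∫ ξ in {0}ᶜ, ‖Z.ft f ξ‖ ∂Z.dual) ^ 2
      ≤ Z.l2Norm (Z.op oscSym f) * Z.l2Norm (deriv f) := by
  set n := Z.l2Norm (Z.op oscSym f) with hn
  set y := Z.l2Norm (deriv f) with hy
  have hn0 : 0 ≤ n := l2Norm_nonneg _
  have hy0 : 0 ≤ y := l2Norm_nonneg _
  have hnn : ∫ ξ in {0}ᶜ, ‖Z.ft f ξ‖ ^ 2 ∂Z.dual = n ^ 2 := (sq_l2Norm_osc hf).symm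
  have hi0 : Integrable (fun ξ => ‖Z.ft f ξ‖ ^ 2) Z.dual := by
    simpa using (rapid_ft hf).integrable_sq 0
  have hi2 : Integrable (fun ξ : ℝ => ξ ^ 2 * ‖Z.ft f ξ‖ ^ 2) Z.dual := by
    simpa using (rapid_ft hf).integrable_sq 2
  have hyy : ∫ ξ in {0}ᶜ, ξ ^ 2 * ‖Z.ft f ξ‖ ^ 2 ∂Z.dual ≤ y ^ 2 := by
    rw [sq_l2Norm_deriv hf]
    exact setIntegral_le_integral hi2 (ae_of_all _ fun ξ => by positivity)
  have key : ∀ A B : ℝ, 0 < A → 0 < B → (∫ ξ in {0}ᶜ, ‖Z.ft f ξ‖ ∂Z.dual) ^ 2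
      ≤ 1 / (2 * A * B) * (A ^ 2 * n ^ 2 + B ^ 2 * y ^ 2) := by
    intro A B hA hB
    have hpos : ∀ ξ : ℝ, 0 < A ^ 2 + B ^ 2 * ξ ^ 2 := fun ξ => by positivity
    have e1 : ∀ ξ : ℝ, (√(1 / (A ^ 2 + B ^ 2 * ξ ^ 2))) ^ 2 = 1 / (A ^ 2 + B ^ 2 * ξ ^ 2) :=
      fun ξ => Real.sq_sqrt (by positivity)
    have e2 : ∀ ξ : ℝ, (√(A ^ 2 + B ^ 2 * ξ ^ 2) * ‖Z.ft f ξ‖) ^ 2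
        = A ^ 2 * ‖Z.ft f ξ‖ ^ 2 + B ^ 2 * (ξ ^ 2 * ‖Z.ft f ξ‖ ^ 2) := fun ξ => by
      rw [mul_pow, Real.sq_sqrt (hpos ξ).le]; ring
    have h := integral_mul_le_sqrt_mul_sqrt (μ := Z.dual.restrict {0}ᶜ)
      (p := fun ξ : ℝ => √(1 / (A ^ 2 + B ^ 2 * ξ ^ 2)))
      (q := fun ξ : ℝ => √(A ^ 2 + B ^ 2 * ξ ^ 2) * ‖Z.ft f ξ‖)
      (Measurable.aestronglyMeasurable (by fun_prop))
      ((Continuous.aestronglyMeasurable (by fun_prop)).mul (aesm_ft hf).norm.restrict)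
      (fun ξ => by positivity) (fun ξ => by positivity)
      (by simp only [e1]; exact (integrable_dual_inv Z hA hB).integrableOn)
      (by simp only [e2]; exact ((hi0.const_mul _).add (hi2.const_mul _)).integrableOn)
    simp only [e1, e2] at h
    have e3 : ∀ ξ : ℝ, √(1 / (A ^ 2 + B ^ 2 * ξ ^ 2)) * (√(A ^ 2 + B ^ 2 * ξ ^ 2) * ‖Z.ft f ξ‖)
        = ‖Z.ft f ξ‖ := fun ξ => by
      rw [← mul_assoc, ← Real.sqrt_mul (by positivity), one_div_mul_cancel (hpos ξ).ne',
        Real.sqrt_one, one_mul]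
    simp only [e3] at h
    rw [integral_add (hi0.const_mul _).integrableOn (hi2.const_mul _).integrableOn,
      integral_const_mul, integral_const_mul, hnn] at h
    have hI : 0 ≤ ∫ ξ in {0}ᶜ, ‖Z.ft f ξ‖ ∂Z.dual := integral_nonneg fun ξ => norm_nonneg _
    have h2 : 0 ≤ ∫ ξ in {0}ᶜ, ξ ^ 2 * ‖Z.ft f ξ‖ ^ 2 ∂Z.dual :=
      integral_nonneg fun ξ => by positivity
    have h3 : 0 ≤ ∫ ξ in {0}ᶜ, 1 / (A ^ 2 + B ^ 2 * ξ ^ 2) ∂Z.dual :=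
      integral_nonneg fun ξ => by positivity
    have h4 := pow_le_pow_left₀ hI h 2
    rw [mul_pow, Real.sq_sqrt h3, Real.sq_sqrt (by positivity)] at h4
    refine h4.trans ?_
    gcongr
    exact integral_dual_inv_le Z hA hB
  have key2 : ∀ ε : ℝ, 0 < ε → (∫ ξ in {0}ᶜ, ‖Z.ft f ξ‖ ∂Z.dual) ^ 2 ≤ (n + ε) * (y + ε) := by
    intro ε hε
    -- The optimal weights are A = y and B = n; the shift by ε allows either norm to vanish, and ε →
    -- 0 at the end.
    refine (key (y + ε) (n + ε) (by positivity) (by positivity)).trans ?_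
    rw [one_div, inv_mul_le_iff₀ (by positivity)]
    have h1 : n ^ 2 ≤ (n + ε) ^ 2 := by gcongr; linarith
    have h2 : y ^ 2 ≤ (y + ε) ^ 2 := by gcongr; linarith
    calc (y + ε) ^ 2 * n ^ 2 + (n + ε) ^ 2 * y ^ 2
        ≤ (y + ε) ^ 2 * (n + ε) ^ 2 + (n + ε) ^ 2 * (y + ε) ^ 2 := by gcongr
      _ = _ := by ring
  have ht : Filter.Tendsto (fun ε : ℝ => (n + ε) * (y + ε)) (nhdsWithin 0 (Set.Ioi 0))
      (nhds ((n + 0) * (y + 0))) := by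
    apply Filter.Tendsto.mono_left _ nhdsWithin_le_nhds
    exact Continuous.tendsto (by fun_prop) 0
  rw [add_zero, add_zero] at ht
  exact ge_of_tendsto ht (Filter.eventually_of_mem self_mem_nhdsWithin fun ε hε => key2 ε hε)

/-- The sup norm is at most the L¹ norm in frequency. The symbol must vanish at 0, because on the
torus no derivative controls the mean. -/
theorem sq_norm_op_le (hm : SymbolBound C m) (h0 : m 0 = 0) (hf : Z.Nice 1 f) (x : ℝ) :
    ‖Z.op m f x‖ ^ 2 ≤ C ^ 2 * (Z.l2Norm (Z.op oscSym f) * Z.l2Norm (deriv f)) := by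
  have h1 : ‖Z.op m f x‖ ≤ C * ∫ ξ in {0}ᶜ, ‖Z.ft f ξ‖ ∂Z.dual := by
    refine (norm_ift_le _ x).trans ?_
    rw [← integral_const_mul, ← integral_indicator (measurableSet_singleton _).compl]
    refine integral_mono (hm.rapid hf).integrable.norm
      (((integrable_ft_norm hf).const_mul C).indicator (measurableSet_singleton _).compl) ?_
    intro ξ
    simp only [norm_mul]
    by_cases hξ : ξ = 0
    · simp [hξ, h0]
    · simp only [Set.mem_compl_iff, Set.mem_singleton_iff, hξ, not_false_eq_true,
        Set.indicator_of_mem]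
      gcongr
      exact hm.le ξ
  have h2 := pow_le_pow_left₀ (norm_nonneg _) h1 2
  rw [mul_pow] at h2
  refine h2.trans ?_
  gcongr
  exact sq_integral_ft_le hf

/-- Interpolation of `L²` between `L¹` and the homogeneous `H^{1/2}`. -/
theorem sq_l2Norm_osc_le (hf : Z.Nice 1 f) :
    Z.l2Norm (Z.op oscSym f) ^ 2 ≤ 2 * (∫ x, ‖f x‖ ∂Z.measure) * √(Z.hsq f) := by
  set l := ∫ x, ‖f x‖ ∂Z.measure with hl
  have hl0 : 0 ≤ l := integral_nonneg fun x => norm_nonneg _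
  have hi0 : Integrable (fun ξ => ‖Z.ft f ξ‖ ^ 2) Z.dual := by
    simpa using (rapid_ft hf).integrable_sq 0
  -- For |ξ| ≤ R the transform is at most ‖f‖_{L¹}; for |ξ| ≥ R one inserts |ξ|/R ≥ 1. The indicator
  -- of |ξ| ≤ R is replaced by 2R²/(R² + ξ²), whose integral off the origin is at most R on either
  -- domain.
  have key : ∀ R : ℝ, 0 < R → Z.l2Norm (Z.op oscSym f) ^ 2 ≤ R * l ^ 2 + Z.hsq f / R := by
    intro R hR
    rw [sq_l2Norm_osc hf]
    have h1 : ∫ ξ in {0}ᶜ, ‖Z.ft f ξ‖ ^ 2 ∂Z.dual ≤ ∫ ξ in {0}ᶜ,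
        (2 * R ^ 2 * l ^ 2 * (1 / (R ^ 2 + 1 ^ 2 * ξ ^ 2)) + 1 / R * (|ξ| * ‖Z.ft f ξ‖ ^ 2)) ∂Z.dual := by
      refine integral_mono hi0.integrableOn
        (((integrable_dual_inv Z hR one_pos).const_mul _).add
          ((integrable_hsq hf).const_mul _)).integrableOn fun ξ => ?_
      have h2 : ‖Z.ft f ξ‖ ^ 2 ≤ l ^ 2 := by
        gcongr; exact norm_ft_le f ξ
      simp only
      rcases le_total |ξ| R with hξ | hξ
      · have h3 : ξ ^ 2 ≤ R ^ 2 := by rw [← sq_abs]; gcongr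
        have h4 : 1 ≤ 2 * R ^ 2 * (1 / (R ^ 2 + 1 ^ 2 * ξ ^ 2)) := by
          rw [mul_one_div, le_div_iff₀ (by positivity)]; linarith
        calc ‖Z.ft f ξ‖ ^ 2 ≤ 1 * l ^ 2 + 0 := by linarith
          _ ≤ (2 * R ^ 2 * (1 / (R ^ 2 + 1 ^ 2 * ξ ^ 2))) * l ^ 2
              + 1 / R * (|ξ| * ‖Z.ft f ξ‖ ^ 2) := by gcongr; positivity
          _ = _ := by ring
      · calc ‖Z.ft f ξ‖ ^ 2 = 0 + 1 * ‖Z.ft f ξ‖ ^ 2 := by ring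
          _ ≤ 2 * R ^ 2 * l ^ 2 * (1 / (R ^ 2 + 1 ^ 2 * ξ ^ 2))
              + (1 / R * |ξ|) * ‖Z.ft f ξ‖ ^ 2 := by
            gcongr
            · positivity
            · rw [one_div, ← div_eq_inv_mul, one_le_div hR]; exact hξ
          _ = _ := by ring
    refine h1.trans ?_
    rw [integral_add ((integrable_dual_inv Z hR one_pos).const_mul _).integrableOn
      ((integrable_hsq hf).const_mul _).integrableOn, integral_const_mul, integral_const_mul]
    have h5 := integral_dual_inv_le Z hR one_pos
    have h6 : ∫ ξ in {0}ᶜ, |ξ| * ‖Z.ft f ξ‖ ^ 2 ∂Z.dual ≤ Z.hsq f :=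
      setIntegral_le_integral (integrable_hsq hf) (ae_of_all _ fun ξ => by positivity)
    calc _ ≤ 2 * R ^ 2 * l ^ 2 * (1 / (2 * R * 1)) + 1 / R * Z.hsq f := by gcongr
      _ = _ := by field_simp
  set s := √(Z.hsq f) with hs
  have hs2 : Z.hsq f = s ^ 2 := (Real.sq_sqrt (hsq_nonneg f)).symm
  have hs0 : 0 ≤ s := Real.sqrt_nonneg _
  have key2 : ∀ ε : ℝ, 0 < ε → Z.l2Norm (Z.op oscSym f) ^ 2 ≤ 2 * (l + ε) * (s + ε) := by
    intro ε hε
    -- R = s/l balances the two terms; ε again covers degenerate values.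
    refine (key ((s + ε) / (l + ε)) (by positivity)).trans ?_
    rw [hs2]
    have h1 : l ^ 2 ≤ (l + ε) ^ 2 := by gcongr; linarith
    have h2 : s ^ 2 ≤ (s + ε) ^ 2 := by gcongr; linarith
    calc _ ≤ (s + ε) / (l + ε) * (l + ε) ^ 2 + (s + ε) ^ 2 / ((s + ε) / (l + ε)) := by gcongr
      _ = _ := by field_simp; ring
  have ht : Filter.Tendsto (fun ε : ℝ => 2 * (l + ε) * (s + ε)) (nhdsWithin 0 (Set.Ioi 0))
      (nhds (2 * (l + 0) * (s + 0))) := by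
    apply Filter.Tendsto.mono_left _ nhdsWithin_le_nhds
    exact Continuous.tendsto (by fun_prop) 0
  rw [add_zero, add_zero] at ht
  exact ge_of_tendsto ht (Filter.eventually_of_mem self_mem_nhdsWithin fun ε hε => key2 ε hε)

end

end KDNLS

/-! ### Pairings in Ḣ^{1/2}, real-valued functions and the zero frequency. -/

namespace KDNLS

noncomputable section

variable {Z : Domain} {f g h k : ℝ → ℂ} {m m' : ℝ → ℂ} {C C' : ℝ}

theorem integral_conj_op_mul_op (hm : SymbolBound C m) (hm' : SymbolBound C' m')
    (hf : Z.Nice 1 f) (hg : Z.Nice 1 g) :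
    ∫ x, (starRingEnd ℂ) (Z.op m f x) * Z.op m' g x ∂Z.measure
      = ∫ ξ, (starRingEnd ℂ) (m ξ * Z.ft f ξ) * (m' ξ * Z.ft g ξ) ∂Z.dual :=
  parseval (hm.rapid hf) (hm'.rapid hg)

theorem integral_conj_op_mul (hm : SymbolBound C m) (hf : Z.Nice 1 f) (hg : Z.Nice 1 g) :
    ∫ x, (starRingEnd ℂ) (Z.op m f x) * g x ∂Z.measure
      = ∫ x, (starRingEnd ℂ) (f x) * Z.op (fun ξ => (starRingEnd ℂ) (m ξ)) g x ∂Z.measure := by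
  conv_lhs => rw [← op_one hg]
  conv_rhs => rw [← op_one hf]
  rw [integral_conj_op_mul_op hm symbolBound_one hf hg,
    integral_conj_op_mul_op symbolBound_one hm.conj hf hg]
  refine integral_congr_ae (ae_of_all _ fun ξ => ?_)
  simp only [map_mul, map_one]
  ring

theorem integral_ft_ft_le (hf : Z.Nice 1 f) (hg : Z.Nice 1 g) :
    ∫ ξ, |ξ| * ‖Z.ft f ξ‖ * ‖Z.ft g ξ‖ ∂Z.dual ≤ √(Z.hsq f) * √(Z.hsq g) := by
  have e1 : ∀ (f : ℝ → ℂ) (ξ : ℝ), (√|ξ| * ‖Z.ft f ξ‖) ^ 2 = |ξ| * ‖Z.ft f ξ‖ ^ 2 := fun f ξ => by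
    rw [mul_pow, Real.sq_sqrt (abs_nonneg _)]
  have h := integral_mul_le_sqrt_mul_sqrt (μ := Z.dual) (p := fun ξ : ℝ => √|ξ| * ‖Z.ft f ξ‖)
    (q := fun ξ : ℝ => √|ξ| * ‖Z.ft g ξ‖)
    ((Continuous.aestronglyMeasurable (by fun_prop)).mul (aesm_ft hf).norm)
    ((Continuous.aestronglyMeasurable (by fun_prop)).mul (aesm_ft hg).norm)
    (fun ξ => by positivity) (fun ξ => by positivity)
    (by simp only [e1]; exact integrable_hsq hf) (by simp only [e1]; exact integrable_hsq hg)
  simp only [e1] at h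
  refine le_trans (le_of_eq ?_) h
  refine integral_congr_ae (ae_of_all _ fun ξ => ?_)
  have := Real.mul_self_sqrt (abs_nonneg ξ)
  simp only
  calc |ξ| * ‖Z.ft f ξ‖ * ‖Z.ft g ξ‖ = (√|ξ| * √|ξ|) * ‖Z.ft f ξ‖ * ‖Z.ft g ξ‖ := by rw [this]
    _ = _ := by ring

/-- One transform decays rapidly and the other is bounded by an L¹ norm, so the product still decays
rapidly. -/
theorem integrable_ft_ft (hf : Z.Nice 1 f) (hg : Z.Nice 1 g) :
    Integrable (fun ξ => |ξ| * ‖Z.ft f ξ‖ * ‖Z.ft g ξ‖) Z.dual := by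
  have h1 : Z.Rapid (fun ξ => Z.ft f ξ * Z.ft g ξ) := by
    refine ⟨(aesm_ft hf).mul (aesm_ft hg), fun j => ?_⟩
    obtain ⟨D, hD⟩ := (rapid_ft hf).decay j
    refine ⟨D * ∫ x, ‖g x‖ ∂Z.measure, ?_⟩
    filter_upwards [hD] with ξ h1
    rw [norm_mul, ← mul_assoc]
    exact mul_le_mul h1 (norm_ft_le g ξ) (norm_nonneg _) ((by positivity : _ ≤ _).trans h1)
  simpa [mul_assoc] using h1.integrable_pow 1

/-- Duality of `H^{1/2}` and its derivative, with multipliers of order zero. -/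
theorem norm_integral_conj_op_mul_op_deriv_le (hm : SymbolBound C m) (hm' : SymbolBound C' m')
    (hf : Z.Nice 1 f) (hg : Z.Nice 1 g) :
    ‖∫ x, (starRingEnd ℂ) (Z.op m f x) * Z.op m' (deriv g) x ∂Z.measure‖
      ≤ C * C' * (√(Z.hsq f) * √(Z.hsq g)) := by
  rw [integral_conj_op_mul_op hm hm' hf hg.deriv]
  refine (norm_integral_le_integral_norm _).trans ?_
  have h1 : ∫ ξ, ‖(starRingEnd ℂ) (m ξ * Z.ft f ξ) * (m' ξ * Z.ft (deriv g) ξ)‖ ∂Z.dual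
      ≤ ∫ ξ, C * C' * (|ξ| * ‖Z.ft f ξ‖ * ‖Z.ft g ξ‖) ∂Z.dual := by
    refine integral_mono_of_nonneg (ae_of_all _ fun ξ => norm_nonneg _)
      ((integrable_ft_ft hf hg).const_mul _) ?_
    filter_upwards [ft_deriv hg] with ξ hξ
    rw [hξ]
    simp only [norm_mul, RCLike.norm_conj, Complex.norm_I, Complex.norm_real, Real.norm_eq_abs,
      one_mul]
    have := mul_le_mul (hm.le ξ) (hm'.le ξ) (norm_nonneg _) hm.nonneg
    calc ‖m ξ‖ * ‖Z.ft f ξ‖ * (‖m' ξ‖ * (|ξ| * ‖Z.ft g ξ‖))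
        = (‖m ξ‖ * ‖m' ξ‖) * (|ξ| * ‖Z.ft f ξ‖ * ‖Z.ft g ξ‖) := by ring
      _ ≤ _ := by gcongr
  refine h1.trans ?_
  rw [integral_const_mul]
  have h2 := hm.nonneg
  have h3 := hm'.nonneg
  gcongr
  exact integral_ft_ft_le hf hg

theorem sign_mul_self_eq_abs (ξ : ℝ) : Real.sign ξ * ξ = |ξ| := by
  rcases lt_trichotomy ξ 0 with h | h | h
  · rw [Real.sign_of_neg h, abs_of_neg h]; ring
  · simp [h]
  · rw [Real.sign_of_pos h, abs_of_pos h, one_mul]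

/-- The source of all dissipation: (-i sgn ξ)(iξ) = |ξ|. -/
theorem integral_conj_mul_hilbert_deriv (hf : Z.Nice 1 f) :
    ∫ x, (starRingEnd ℂ) (f x) * Z.op hilbertSym (deriv f) x ∂Z.measure = (Z.hsq f : ℂ) := by
  conv_lhs => enter [2, x]; rw [← op_one hf]
  simp only [op_one hf]
  have := integral_conj_op_mul_op symbolBound_one symbolBound_hilbert hf hf.deriv
  rw [op_one hf] at this
  rw [this, Domain.hsq, ← integral_complex_ofReal]
  refine integral_congr_ae ?_
  filter_upwards [ft_deriv hf] with ξ hξ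
  rw [hξ, one_mul, hilbertSym]
  have e : (Real.sign ξ : ℂ) * ξ = (|ξ| : ℝ) := by
    rw [← Complex.ofReal_mul, sign_mul_self_eq_abs]
  calc (starRingEnd ℂ) (Z.ft f ξ) * (-Complex.I * (Real.sign ξ : ℂ) * (Complex.I * ξ * Z.ft f ξ))
      = -(Complex.I * Complex.I) * ((Real.sign ξ : ℂ) * ξ) *
        ((starRingEnd ℂ) (Z.ft f ξ) * Z.ft f ξ) := by ring
    _ = _ := by
      rw [e, Complex.I_mul_I, Complex.conj_mul']
      push_cast; ring

theorem eLpNorm_halfD_sq (hf : Z.Nice 1 f) :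
    eLpNorm (Z.halfD f) 2 Z.measure ^ 2 = ENNReal.ofReal (Z.hsq f) := by
  have hr : Z.Rapid (fun ξ : ℝ => ((√|ξ| : ℝ) : ℂ) * Z.ft f ξ) := by
    refine (rapid_ft hf).mul (C := 1) (by fun_prop) fun ξ => ?_
    rw [Complex.norm_real, Real.norm_of_nonneg (Real.sqrt_nonneg _), one_mul,
      Real.sqrt_le_left (by positivity)]
    nlinarith [abs_nonneg ξ]
  have e : Z.halfD f = Z.ift (fun ξ : ℝ => ((√|ξ| : ℝ) : ℂ) * Z.ft f ξ) := multiplier_eq_ift hr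
  have h1 := sq_l2Norm_ift hr
  rw [← e, Domain.l2Norm] at h1
  have hfin : eLpNorm (Z.halfD f) 2 Z.measure ≠ ⊤ := by rw [e]; exact (memLp_ift hr).2.ne
  rw [← ENNReal.ofReal_toReal hfin, ← ENNReal.ofReal_pow ENNReal.toReal_nonneg, h1, Domain.hsq]
  congr 1
  refine integral_congr_ae (ae_of_all _ fun ξ => ?_)
  simp only [norm_mul, mul_pow]
  rw [Complex.norm_real, Real.norm_of_nonneg (Real.sqrt_nonneg _), Real.sq_sqrt (abs_nonneg _)]

/-- Functions whose values are real. -/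
def IsReal (f : ℝ → ℂ) : Prop := ∀ x, (starRingEnd ℂ) (f x) = f x

theorem ft_neg_of_isReal (hr : IsReal f) (ξ : ℝ) :
    Z.ft f (-ξ) = (starRingEnd ℂ) (Z.ft f ξ) := by
  rw [Domain.ft, Domain.ft, ← integral_conj]
  refine integral_congr_ae (ae_of_all _ fun x => ?_)
  simp only [map_mul, ← Complex.exp_conj, hr x]
  congr 2
  simp

theorem isReal_op (hsym : ∀ ξ, m (-ξ) = (starRingEnd ℂ) (m ξ)) (hr : IsReal f) :
    IsReal (Z.op m f) := by
  intro x
  rw [Domain.op, Domain.ift, ← integral_conj,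
    ← (measurePreserving_dual_neg Z).integral_comp (MeasurableEquiv.neg ℝ).measurableEmbedding]
  refine integral_congr_ae (ae_of_all _ fun ξ => ?_)
  simp only [map_mul, ← Complex.exp_conj, hsym, ft_neg_of_isReal hr, Complex.conj_conj]
  congr 2
  simp

theorem isReal_deriv (hr : IsReal f) : IsReal (deriv f) := by
  intro x
  have h2 : (fun x => star (f x)) = f := funext hr
  have h1 : deriv (fun x => star (f x)) x = star (deriv f x) := deriv.star
  rw [h2] at h1
  exact h1.symm

theorem hilbertSym_neg (ξ : ℝ) : hilbertSym (-ξ) = (starRingEnd ℂ) (hilbertSym ξ) := by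
  simp [hilbertSym, Real.sign_neg]

theorem oscSym_neg (ξ : ℝ) : oscSym (-ξ) = (starRingEnd ℂ) (oscSym ξ) := by
  unfold oscSym
  by_cases h : ξ = 0 <;> simp [h]

/-- Splitting off the zero frequency. -/
theorem op_eq_mean_add (hm : SymbolBound C m) (hf : Z.Nice 1 f) (x : ℝ) :
    Z.op m f x = m 0 * Z.mean f + Z.op (fun ξ => m ξ * oscSym ξ) f x := by
  have h1 := integrable_exp_mul (hm.rapid hf).integrable x
  rw [Domain.op, Domain.ift, ← integral_add_compl (measurableSet_singleton 0) h1]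
  congr 1
  · rw [Measure.restrict_singleton, integral_smul_measure, integral_dirac]
    have : Z.ft f 0 = ∫ x, f x ∂Z.measure := by simp [Domain.ft]
    rw [Domain.mean, ← this, Complex.real_smul]
    simp only [Complex.ofReal_zero, mul_zero, zero_mul, Complex.exp_zero, one_mul]
    rw [Domain.atom, measureReal_def]; ring
  · rw [Domain.op, Domain.ift, ← integral_indicator (measurableSet_singleton _).compl]
    refine integral_congr_ae (ae_of_all _ fun ξ => ?_)
    by_cases h : ξ = 0 <;> simp [oscSym, h]

theorem eq_mean_add_osc (hf : Z.Nice 1 f) (x : ℝ) : f x = Z.mean f + Z.op oscSym f x := by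
  have := op_eq_mean_add symbolBound_one hf x
  rw [op_one hf] at this
  simpa using this

theorem norm_mean_le (f : ℝ → ℂ) : ‖Z.mean f‖ ≤ Z.atom * ∫ x, ‖f x‖ ∂Z.measure := by
  rw [Domain.mean, norm_mul, Complex.norm_real, Real.norm_of_nonneg (atom_nonneg Z)]
  gcongr
  · exact atom_nonneg Z
  · exact norm_integral_le_integral_norm _

end

end KDNLS

/-! ### Products, integration by parts, the density and its supremum. -/

namespace KDNLS

noncomputable section

variable {Z : Domain} {f g h k : ℝ → ℂ} {m m' : ℝ → ℂ} {C C' : ℝ}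

theorem isFun_add (hf : Z.IsFun f) (hg : Z.IsFun g) : Z.IsFun (fun x => f x + g x) := by
  cases Z
  · trivial
  · exact Function.Periodic.add hf hg

theorem isFun_mul (hf : Z.IsFun f) (hg : Z.IsFun g) : Z.IsFun (fun x => f x * g x) := by
  cases Z
  · trivial
  · exact Function.Periodic.mul hf hg

theorem isFun_comp (φ : ℂ → ℂ) (hf : Z.IsFun f) : Z.IsFun (fun x => φ (f x)) := by
  cases Z
  · trivial
  · exact Function.Periodic.comp hf φ

theorem Domain.Nice.contDiffAt {p} (hf : Z.Nice p f) (n : ℕ) (x : ℝ) : ContDiffAt ℝ n f x :=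
  (hf.contDiff.of_le (by exact_mod_cast le_top)).contDiffAt

theorem Domain.Nice.add {p} (hf : Z.Nice p f) (hg : Z.Nice p g) :
    Z.Nice p (fun x => f x + g x) := by
  refine ⟨hf.contDiff.add hg.contDiff, isFun_add hf.isFun hg.isFun, fun k => ?_⟩
  have : _root_.iteratedDeriv k (fun x => f x + g x)
      = _root_.iteratedDeriv k f + _root_.iteratedDeriv k g := by
    ext x
    exact iteratedDeriv_fun_add (hf.contDiffAt k x) (hg.contDiffAt k x)
  rw [this]
  exact (hf.memLp k).add (hg.memLp k)

theorem Domain.Nice.const_mul {p} (hf : Z.Nice p f) (c : ℂ) : Z.Nice p (fun x => c * f x) := by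
  refine ⟨contDiff_const.mul hf.contDiff, isFun_comp (fun z => c * z) hf.isFun, fun k => ?_⟩
  have : _root_.iteratedDeriv k (fun x => c * f x) = fun x => c * _root_.iteratedDeriv k f x := by
    ext x
    exact iteratedDeriv_const_mul_field c f
  rw [this]
  exact (hf.memLp k).const_mul c

theorem Domain.Nice.sub {p} (hf : Z.Nice p f) (hg : Z.Nice p g) :
    Z.Nice p (fun x => f x - g x) := by
  have := hf.add (hg.const_mul (-1))
  simpa [sub_eq_add_neg] using this

theorem iteratedDeriv_conj (f : ℝ → ℂ) (k : ℕ) :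
    iteratedDeriv k (fun x => (starRingEnd ℂ) (f x))
      = fun x => (starRingEnd ℂ) (iteratedDeriv k f x) := by
  induction k with
  | zero => simp
  | succ k ih =>
    rw [iteratedDeriv_succ, ih, iteratedDeriv_succ]
    exact deriv.star' (f := iteratedDeriv k f)

theorem Domain.Nice.conj {p} (hf : Z.Nice p f) : Z.Nice p (fun x => (starRingEnd ℂ) (f x)) := by
  refine ⟨Complex.conjCLE.contDiff.comp hf.contDiff, isFun_comp _ hf.isFun, fun k => ?_⟩
  rw [iteratedDeriv_conj]
  exact (hf.memLp k).star

theorem deriv_mul_eq {p q} (hf : Z.Nice p f) (hg : Z.Nice q g) :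
    deriv (fun x => f x * g x) = fun x => deriv f x * g x + f x * deriv g x :=
  funext fun x => ((hf.hasDerivAt x).mul (hg.hasDerivAt x)).deriv

/-- The induction must quantify over both factors, since the product rule replaces one of them by
its derivative. -/
theorem Domain.Nice.mul (hf : Z.Nice 2 f) (hg : Z.Nice 2 g) : Z.Nice 1 (fun x => f x * g x) := by
  have key : ∀ k : ℕ, ∀ f g : ℝ → ℂ, Z.Nice 2 f → Z.Nice 2 g →
      MemLp (_root_.iteratedDeriv k (fun x => f x * g x)) 1 Z.measure := by
    intro k
    induction k with
    | zero =>
      intro f g hf hg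
      rw [iteratedDeriv_zero, memLp_one_iff_integrable]
      exact hf.memLp_self.integrable_mul hg.memLp_self
    | succ k ih =>
      intro f g hf hg
      rw [iteratedDeriv_succ', deriv_mul_eq hf hg]
      have : _root_.iteratedDeriv k (fun x => _root_.deriv f x * g x + f x * _root_.deriv g x)
        = _root_.iteratedDeriv k (fun x => _root_.deriv f x * g x)
          + _root_.iteratedDeriv k (fun x => f x * _root_.deriv g x) := by
        ext x
        have e : ∀ {a b : ℝ → ℂ}, Z.Nice 2 a → Z.Nice 2 b →
            ContDiffAt ℝ k (fun x => a x * b x) x := fun ha hb =>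
          (ha.contDiffAt k x).mul (hb.contDiffAt k x)
        exact iteratedDeriv_fun_add (e hf.deriv hg) (e hf hg.deriv)
      rw [this]
      exact (ih _ _ hf.deriv hg).add (ih _ _ hf hg.deriv)
  exact ⟨hf.contDiff.mul hg.contDiff, isFun_mul hf.isFun hg.isFun, fun k => key k f g hf hg⟩

/-- Integration by parts. -/
theorem integral_deriv_mul (hf : Z.Nice 2 f) (hg : Z.Nice 2 g) :
    ∫ x, deriv f x * g x ∂Z.measure = -∫ x, f x * deriv g x ∂Z.measure := by
  have h := integral_deriv_eq_zero (hf.mul hg)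
  rw [deriv_mul_eq hf hg, integral_add (hf.deriv.mul hg).integrable (hf.mul hg.deriv).integrable] at h
  exact eq_neg_of_add_eq_zero_left h

theorem l2Norm_mono (hg : MemLp g 2 Z.measure) {c : ℝ}
    (hc : 0 ≤ c) (hle : ∀ x, ‖f x‖ ≤ c * ‖g x‖) : Z.l2Norm f ≤ c * Z.l2Norm g := by
  have h := eLpNorm_le_mul_eLpNorm_of_ae_le_mul (p := 2) (ae_of_all Z.measure hle)
  have := ENNReal.toReal_mono (by finiteness [hg.2.ne]) h
  rwa [ENNReal.toReal_mul, ENNReal.toReal_ofReal hc] at this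

theorem norm_integral_mul_le (hf : MemLp f 2 Z.measure) (hg : MemLp g 2 Z.measure) :
    ‖∫ x, f x * g x ∂Z.measure‖ ≤ Z.l2Norm f * Z.l2Norm g := by
  refine (norm_integral_le_integral_norm _).trans ?_
  simp only [norm_mul]
  have h := integral_mul_le_sqrt_mul_sqrt hf.1.norm hg.1.norm (fun x => norm_nonneg _)
    (fun x => norm_nonneg _) (by simpa using hf.integrable_norm_rpow (by simp) (by simp))
    (by simpa using hg.integrable_norm_rpow (by simp) (by simp))
  rwa [← sq_l2Norm hf, ← sq_l2Norm hg, Real.sqrt_sq (l2Norm_nonneg _),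
    Real.sqrt_sq (l2Norm_nonneg _)] at h

theorem integral_norm_mul_le (hf : MemLp f 2 Z.measure) (hg : MemLp g 2 Z.measure) :
    ∫ x, ‖f x * g x‖ ∂Z.measure ≤ Z.l2Norm f * Z.l2Norm g := by
  simp only [norm_mul]
  have h := integral_mul_le_sqrt_mul_sqrt hf.1.norm hg.1.norm (fun x => norm_nonneg _)
    (fun x => norm_nonneg _) (by simpa using hf.integrable_norm_rpow (by simp) (by simp))
    (by simpa using hg.integrable_norm_rpow (by simp) (by simp))
  rwa [← sq_l2Norm hf, ← sq_l2Norm hg, Real.sqrt_sq (l2Norm_nonneg _),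
    Real.sqrt_sq (l2Norm_nonneg _)] at h

theorem density_eq (f : ℝ → ℂ) : density f = fun x => (starRingEnd ℂ) (f x) * f x := by
  ext x
  rw [density, Complex.conj_mul']; push_cast; rfl

theorem norm_density (f : ℝ → ℂ) (x : ℝ) : ‖density f x‖ = ‖f x‖ ^ 2 := by
  rw [density, Complex.norm_real, Real.norm_of_nonneg (by positivity)]

theorem nice_density (hf : Z.Nice 2 f) : Z.Nice 1 (density f) := by
  rw [density_eq]; exact hf.conj.mul hf

theorem isReal_density (f : ℝ → ℂ) : IsReal (density f) := fun _ => Complex.conj_ofReal _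

theorem deriv_density (hf : Z.Nice 2 f) :
    deriv (density f) = fun x => (starRingEnd ℂ) (deriv f x) * f x
      + (starRingEnd ℂ) (f x) * deriv f x := by
  rw [density_eq, deriv_mul_eq hf.conj hf]
  ext x
  have : deriv (fun x => (starRingEnd ℂ) (f x)) x = (starRingEnd ℂ) (deriv f x) :=
    deriv.star (f := f)
  rw [this]

/-- The supremum of `|f|²`. -/
def supSq (f : ℝ → ℂ) : ℝ := ⨆ x, ‖f x‖ ^ 2

theorem supSq_nonneg (f : ℝ → ℂ) : 0 ≤ supSq f := Real.iSup_nonneg fun x => by positivity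

/-- The content is boundedness, without which the real supremum is a junk value: the density has all
derivatives in L¹, hence an integrable transform. -/
theorem le_supSq (hf : Z.Nice 2 f) (x : ℝ) : ‖f x‖ ^ 2 ≤ supSq f := by
  refine le_ciSup (f := fun x => ‖f x‖ ^ 2) ⟨∫ ξ, ‖Z.ft (density f) ξ‖ ∂Z.dual, ?_⟩ x
  rintro _ ⟨y, rfl⟩
  simp only
  rw [← norm_density]
  conv_lhs => rw [← ift_ft (nice_density hf)]
  exact norm_ift_le _ _

theorem norm_le_sqrt_supSq (hf : Z.Nice 2 f) (x : ℝ) : ‖f x‖ ≤ √(supSq f) :=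
  Real.le_sqrt_of_sq_le (le_supSq hf x)

theorem l2Norm_mul_le (hf : Z.Nice 2 f) (hg : MemLp g 2 Z.measure) :
    Z.l2Norm (fun x => f x * g x) ≤ √(supSq f) * Z.l2Norm g := by
  refine l2Norm_mono hg (Real.sqrt_nonneg _) fun x => ?_
  rw [norm_mul]
  gcongr
  exact norm_le_sqrt_supSq hf x

theorem l2Norm_density_le (hf : Z.Nice 2 f) :
    Z.l2Norm (density f) ≤ √(supSq f) * Z.l2Norm f := by
  refine l2Norm_mono hf.memLp_self
    (Real.sqrt_nonneg _) fun x => ?_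
  rw [norm_density, sq]
  gcongr
  exact norm_le_sqrt_supSq hf x

theorem l2Norm_deriv_density_le (hf : Z.Nice 2 f) :
    Z.l2Norm (deriv (density f)) ≤ 2 * √(supSq f) * Z.l2Norm (deriv f) := by
  refine l2Norm_mono hf.deriv.memLp_self
    (by positivity) fun x => ?_
  rw [deriv_density hf]
  refine (norm_add_le _ _).trans ?_
  simp only [norm_mul, RCLike.norm_conj]
  have := norm_le_sqrt_supSq hf x
  have h2 := norm_nonneg (deriv f x)
  nlinarith

theorem integral_norm_density (hf : Z.Nice 2 f) :
    ∫ x, ‖density f x‖ ∂Z.measure = Z.l2Norm f ^ 2 := by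
  rw [sq_l2Norm hf.memLp_self]
  simp only [norm_density]

/-- Agmon's inequality is applied to the density, whose mean costs the atom times the mass. Its
oscillating part is at most (2S‖f‖‖f'‖)^{1/2} ≤ S/2 + ‖f‖‖f'‖, with S the supremum, and S/2 is
absorbed. -/
theorem supSq_le (hf : Z.Nice 2 f) :
    supSq f ≤ 2 * (Z.atom * Z.l2Norm f ^ 2) + 2 * (Z.l2Norm f * Z.l2Norm (deriv f)) := by
  set S := supSq f with hS
  have hS0 : 0 ≤ S := supSq_nonneg f
  set p := Z.l2Norm f
  set q := Z.l2Norm (deriv f)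
  have hp : 0 ≤ p := l2Norm_nonneg _
  have hq : 0 ≤ q := l2Norm_nonneg _
  have hρ := nice_density hf
  have h1 : ∀ x, ‖f x‖ ^ 2 ≤ Z.atom * p ^ 2 + (S / 2 + p * q) := by
    intro x
    rw [← norm_density, eq_mean_add_osc hρ x]
    refine (norm_add_le _ _).trans (add_le_add ?_ ?_)
    · rw [← integral_norm_density hf]; exact norm_mean_le _
    · have h2 := sq_norm_op_le symbolBound_osc (by simp [oscSym]) hρ x
      have h3 : Z.l2Norm (Z.op oscSym (density f)) ≤ √S * p := by
        have := l2Norm_op_le symbolBound_osc hρ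
        rw [one_mul] at this
        exact this.trans (l2Norm_density_le hf)
      have h4 := l2Norm_deriv_density_le hf
      refine (pow_le_pow_iff_left₀ (norm_nonneg _) (by positivity) two_ne_zero).1 ?_
      refine h2.trans ?_
      calc (1:ℝ) ^ 2 * (Z.l2Norm (Z.op oscSym (density f)) * Z.l2Norm (deriv (density f)))
          ≤ 1 ^ 2 * ((√S * p) * (2 * √S * q)) := by
            gcongr
            exact l2Norm_nonneg _
        _ = 2 * (√S * √S) * (p * q) := by ring
        _ = 2 * S * (p * q) := by rw [Real.mul_self_sqrt hS0]
        _ ≤ (S / 2 + p * q) ^ 2 := by nlinarith [sq_nonneg (S / 2 - p * q)]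
  have h2 : S ≤ Z.atom * p ^ 2 + (S / 2 + p * q) := ciSup_le h1
  linarith

theorem sqrt_supSq_le (hf : Z.Nice 2 f) :
    √(supSq f) ≤ 2 * (Z.l2Norm f + Z.l2Norm (deriv f)) := by
  have h := supSq_le hf
  have hp : 0 ≤ Z.l2Norm f := l2Norm_nonneg _
  have hq : 0 ≤ Z.l2Norm (deriv f) := l2Norm_nonneg _
  rw [Real.sqrt_le_left (by positivity)]
  refine h.trans ?_
  have := mul_le_mul_of_nonneg_right (atom_le_one Z) (sq_nonneg (Z.l2Norm f))
  nlinarith [mul_nonneg hp hq]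

end

end KDNLS

/-! ### Families continuous in time with values in every Sobolev space. -/

namespace KDNLS

noncomputable section

variable {Z : Domain} {f g h k : ℝ → ℂ} {m m' : ℝ → ℂ} {C C' : ℝ}

open Classical in
/-- The class of `f` in `L²` (zero if `f` is not square integrable). -/
def Domain.toL2 (Z : Domain) (f : ℝ → ℂ) : Lp ℂ 2 Z.measure :=
  if hf : MemLp f 2 Z.measure then hf.toLp f else 0

theorem toL2_eq (hf : MemLp f 2 Z.measure) : Z.toL2 f = hf.toLp f := dif_pos hf

theorem norm_toL2 (hf : MemLp f 2 Z.measure) : ‖Z.toL2 f‖ = Z.l2Norm f := by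
  rw [toL2_eq hf, Lp.norm_toLp]; rfl

theorem toL2_add (hf : MemLp f 2 Z.measure) (hg : MemLp g 2 Z.measure) :
    Z.toL2 (fun x => f x + g x) = Z.toL2 f + Z.toL2 g := by
  rw [toL2_eq hf, toL2_eq hg, toL2_eq (f := fun x => f x + g x) (hf.add hg)]
  rfl

theorem toL2_sub (hf : MemLp f 2 Z.measure) (hg : MemLp g 2 Z.measure) :
    Z.toL2 (fun x => f x - g x) = Z.toL2 f - Z.toL2 g := by
  rw [toL2_eq hf, toL2_eq hg, toL2_eq (f := fun x => f x - g x) (hf.sub hg)]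
  rfl

theorem toL2_const_mul (hf : MemLp f 2 Z.measure) (c : ℂ) :
    Z.toL2 (fun x => c * f x) = c • Z.toL2 f := by
  rw [toL2_eq hf, toL2_eq (f := fun x => c * f x) (hf.const_mul c)]
  rfl

theorem inner_toL2 (hf : MemLp f 2 Z.measure) (hg : MemLp g 2 Z.measure) :
    inner ℂ (Z.toL2 f) (Z.toL2 g) = ∫ x, (starRingEnd ℂ) (f x) * g x ∂Z.measure := by
  rw [toL2_eq hf, toL2_eq hg, L2.inner_def]
  refine integral_congr_ae ?_
  filter_upwards [hf.coeFn_toLp, hg.coeFn_toLp] with x h1 h2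
  rw [h1, h2, RCLike.inner_apply']

theorem dist_toL2 (hf : MemLp f 2 Z.measure) (hg : MemLp g 2 Z.measure) :
    dist (Z.toL2 f) (Z.toL2 g) = Z.l2Norm (fun x => f x - g x) := by
  rw [dist_eq_norm, ← toL2_sub hf hg, norm_toL2 (f := fun x => f x - g x) (hf.sub hg)]

theorem l2Norm_add_le (hf : MemLp f 2 Z.measure) (hg : MemLp g 2 Z.measure) :
    Z.l2Norm (fun x => f x + g x) ≤ Z.l2Norm f + Z.l2Norm g := by
  rw [← norm_toL2 (f := fun x => f x + g x) (hf.add hg), toL2_add hf hg, ← norm_toL2 hf,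
    ← norm_toL2 hg]
  exact norm_add_le _ _

theorem l2Norm_conj (f : ℝ → ℂ) : Z.l2Norm (fun x => (starRingEnd ℂ) (f x)) = Z.l2Norm f := by
  rw [Domain.l2Norm, Domain.l2Norm]
  congr 1
  exact eLpNorm_congr_norm_ae (ae_of_all _ fun x => RCLike.norm_conj _)

/-- Families of smooth functions, continuous in time with values in every Sobolev space. -/
structure Domain.Fam (Z : Domain) (I : Set ℝ) (f : ℝ → ℝ → ℂ) : Prop where
  nice : ∀ t ∈ I, Z.Nice 2 (f t)
  cont : ∀ k : ℕ, ContinuousOn (fun t => Z.toL2 (iteratedDeriv k (f t))) I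

variable {I : Set ℝ} {F G : ℝ → ℝ → ℂ}

theorem Domain.Fam.congr (hF : Z.Fam I F) (e : ∀ t ∈ I, F t = G t) : Z.Fam I G := by
  refine ⟨fun t ht => e t ht ▸ hF.nice t ht, fun k => (hF.cont k).congr fun t ht => ?_⟩
  simp only [e t ht]

theorem Domain.Fam.cont_zero (hF : Z.Fam I F) : ContinuousOn (fun t => Z.toL2 (F t)) I := by
  simpa using hF.cont 0

theorem Domain.Fam.deriv (hF : Z.Fam I F) : Z.Fam I (fun t => deriv (F t)) := by
  refine ⟨fun t ht => (hF.nice t ht).deriv, fun k => ?_⟩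
  simp only [← iteratedDeriv_succ']
  exact hF.cont (k + 1)

theorem Domain.Fam.add (hF : Z.Fam I F) (hG : Z.Fam I G) :
    Z.Fam I (fun t x => F t x + G t x) := by
  refine ⟨fun t ht => (hF.nice t ht).add (hG.nice t ht), fun k => ?_⟩
  refine ((hF.cont k).add (hG.cont k)).congr fun t ht => ?_
  change _ = Z.toL2 _ + Z.toL2 _
  rw [← toL2_add ((hF.nice t ht).memLp k) ((hG.nice t ht).memLp k)]
  congr 1
  ext x
  exact iteratedDeriv_fun_add ((hF.nice t ht).contDiffAt k x) ((hG.nice t ht).contDiffAt k x)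

theorem Domain.Fam.const_mul (hF : Z.Fam I F) (c : ℂ) : Z.Fam I (fun t x => c * F t x) := by
  refine ⟨fun t ht => (hF.nice t ht).const_mul c, fun k => ?_⟩
  refine ((hF.cont k).const_smul c).congr fun t ht => ?_
  simp only [Pi.smul_apply]
  rw [← toL2_const_mul ((hF.nice t ht).memLp k)]
  congr 1
  ext x
  exact iteratedDeriv_const_mul_field c (F t)

theorem Domain.Fam.sub (hF : Z.Fam I F) (hG : Z.Fam I G) :
    Z.Fam I (fun t x => F t x - G t x) := by
  simpa [sub_eq_add_neg] using hF.add (hG.const_mul (-1))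

theorem continuousOn_toL2_of_le {F' : ℝ → ℝ → ℂ} {c : ℝ}
    (hF : ∀ t ∈ I, MemLp (F t) 2 Z.measure) (hF' : ∀ t ∈ I, MemLp (F' t) 2 Z.measure)
    (hle : ∀ s ∈ I, ∀ t ∈ I,
      Z.l2Norm (fun x => F' s x - F' t x) ≤ c * Z.l2Norm (fun x => F s x - F t x))
    (hc : ContinuousOn (fun t => Z.toL2 (F t)) I) : ContinuousOn (fun t => Z.toL2 (F' t)) I := by
  intro t ht
  have h1 := tendsto_iff_dist_tendsto_zero.1 (hc t ht)
  refine tendsto_iff_dist_tendsto_zero.2 ?_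
  have h2 := h1.const_mul c
  rw [mul_zero] at h2
  refine squeeze_zero' (Filter.Eventually.of_forall fun s => dist_nonneg) ?_ h2
  filter_upwards [self_mem_nhdsWithin] with s hs
  rw [dist_toL2 (hF' s hs) (hF' t ht), dist_toL2 (hF s hs) (hF t ht)]
  exact hle s hs t ht

theorem Domain.Fam.conj (hF : Z.Fam I F) : Z.Fam I (fun t x => (starRingEnd ℂ) (F t x)) := by
  refine ⟨fun t ht => (hF.nice t ht).conj, fun k => ?_⟩
  simp only [iteratedDeriv_conj]
  refine continuousOn_toL2_of_le (c := 1) (fun t ht => (hF.nice t ht).memLp k)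
    (fun t ht => ((hF.nice t ht).memLp k).star) (fun s _ t _ => ?_) (hF.cont k)
  rw [one_mul, ← l2Norm_conj]
  simp

theorem iteratedDeriv_op (hm : SymbolBound C m) (hf : Z.Nice 1 f) (k : ℕ) :
    iteratedDeriv k (Z.op m f) = Z.op m (iteratedDeriv k f) := by
  induction k with
  | zero => simp
  | succ k ih => rw [iteratedDeriv_succ, ih, deriv_op hm (hf.iteratedDeriv k), iteratedDeriv_succ]

theorem op_sub (hm : SymbolBound C m) (hf : Z.Nice 1 f) (hg : Z.Nice 1 g) (x : ℝ) :
    Z.op m (fun y => f y - g y) x = Z.op m f x - Z.op m g x := by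
  have := op_add hm hf (hg.const_mul (-1)) x
  rw [op_const_mul] at this
  simpa [sub_eq_add_neg] using this

theorem l2Norm_op_sub_le (hm : SymbolBound C m) (hf : Z.Nice 1 f) (hg : Z.Nice 1 g) :
    Z.l2Norm (fun x => Z.op m f x - Z.op m g x) ≤ C * Z.l2Norm (fun x => f x - g x) := by
  have e : (fun x => Z.op m f x - Z.op m g x) = Z.op m (fun x => f x - g x) :=
    funext fun x => (op_sub hm hf hg x).symm
  rw [e]
  exact l2Norm_op_le hm (hf.sub hg)

theorem Domain.Fam.op (hm : SymbolBound C m) (hF : Z.Fam I F) (h1 : ∀ t ∈ I, Z.Nice 1 (F t)) :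
    Z.Fam I (fun t => Z.op m (F t)) := by
  refine ⟨fun t ht => nice_op hm (h1 t ht), fun k => ?_⟩
  have e : ∀ t ∈ I, iteratedDeriv k (Z.op m (F t)) = Z.op m (iteratedDeriv k (F t)) :=
    fun t ht => iteratedDeriv_op hm (h1 t ht) k
  refine continuousOn_toL2_of_le (c := C) (fun t ht => (hF.nice t ht).memLp k)
    (fun t ht => (nice_op hm (h1 t ht)).memLp k) (fun s hs t ht => ?_) (hF.cont k)
  rw [e s hs, e t ht]
  exact l2Norm_op_sub_le hm ((h1 s hs).iteratedDeriv k) ((h1 t ht).iteratedDeriv k)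

theorem Domain.Fam.continuousOn_l2Norm (hF : Z.Fam I F) :
    ContinuousOn (fun t => Z.l2Norm (F t)) I :=
  hF.cont_zero.norm.congr fun t ht => (norm_toL2 (hF.nice t ht).memLp_self).symm

/-- The difference of products is G(s)(F(s) - F(t)) + F(t)(G(s) - G(t)). The sup norm of G(s) is
bounded by its H¹ norm, which converges as s → t. -/
theorem Domain.Fam.continuousOn_mul (hF : Z.Fam I F) (hG : Z.Fam I G) :
    ContinuousOn (fun t => Z.toL2 (fun x => F t x * G t x)) I := by
  intro t ht
  have hFt := tendsto_iff_dist_tendsto_zero.1 (hF.cont_zero t ht)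
  have hGt := tendsto_iff_dist_tendsto_zero.1 (hG.cont_zero t ht)
  have hGn := (hG.continuousOn_l2Norm t ht).tendsto
  have hGn' := (hG.deriv.continuousOn_l2Norm t ht).tendsto
  refine tendsto_iff_dist_tendsto_zero.2 ?_
  have h2 := (((hGn.add hGn').const_mul 2).mul hFt).add (hGt.const_mul (√(supSq (F t))))
  rw [mul_zero, mul_zero, add_zero] at h2
  refine squeeze_zero' (Filter.Eventually.of_forall fun s => dist_nonneg) ?_ h2
  filter_upwards [self_mem_nhdsWithin] with s hs
  have a := hF.nice s hs
  have b := hF.nice t ht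
  have c := hG.nice s hs
  have d := hG.nice t ht
  rw [dist_toL2 (a.mul c).two.memLp_self (b.mul d).two.memLp_self,
    dist_toL2 a.memLp_self b.memLp_self, dist_toL2 c.memLp_self d.memLp_self]
  have e : (fun x => F s x * G s x - F t x * G t x)
      = fun x => G s x * (F s x - F t x) + F t x * (G s x - G t x) := by ext x; ring
  rw [e]
  refine (l2Norm_add_le (c.mul (a.sub b)).two.memLp_self (b.mul (c.sub d)).two.memLp_self).trans ?_
  gcongr
  · refine (l2Norm_mul_le c (a.sub b).memLp_self).trans ?_
    gcongr
    · exact l2Norm_nonneg _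
    · exact sqrt_supSq_le c
  · exact l2Norm_mul_le b (c.sub d).memLp_self

theorem Domain.Fam.mul (hF : Z.Fam I F) (hG : Z.Fam I G) :
    Z.Fam I (fun t x => F t x * G t x) := by
  refine ⟨fun t ht => ((hF.nice t ht).mul (hG.nice t ht)).two, fun k => ?_⟩
  induction k generalizing F G with
  | zero =>
    simp only [iteratedDeriv_zero]
    exact hF.continuousOn_mul hG
  | succ k ih =>
    refine ((ih hF.deriv hG).add (ih hF hG.deriv)).congr fun t ht => ?_
    have a := hF.nice t ht
    have b := hG.nice t ht
    change _ = Z.toL2 _ + Z.toL2 _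
    rw [← toL2_add ((a.deriv.mul b).two.memLp k) ((a.mul b.deriv).two.memLp k),
      iteratedDeriv_succ', deriv_mul_eq a b]
    congr 1
    ext x
    exact iteratedDeriv_fun_add ((a.deriv.mul b).contDiffAt k x) ((a.mul b.deriv).contDiffAt k x)

theorem Domain.Fam.continuousOn_integral (hF : Z.Fam I F) (hG : Z.Fam I G) :
    ContinuousOn (fun t => ∫ x, (starRingEnd ℂ) (F t x) * G t x ∂Z.measure) I :=
  (ContinuousOn.inner (𝕜 := ℂ) hF.cont_zero hG.cont_zero).congr fun t ht =>
    (inner_toL2 (hF.nice t ht).memLp_self (hG.nice t ht).memLp_self).symm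

end

end KDNLS

/-! ### Differentiation in time with values in L². -/

namespace KDNLS

noncomputable section

variable {Z : Domain} {m : ℝ → ℂ} {C : ℝ} {F G : ℝ → ℝ → ℂ}

theorem sq_lintegral_le {α : Type*} [MeasurableSpace α] {μ : Measure α} {φ : α → ENNReal}
    (hφ : AEMeasurable φ μ) : (∫⁻ a, φ a ∂μ) ^ 2 ≤ μ Set.univ * ∫⁻ a, φ a ^ 2 ∂μ := by
  have h := ENNReal.lintegral_mul_le_Lp_mul_Lq μ Real.HolderConjugate.two_two hφ
    (aemeasurable_const (b := (1 : ENNReal)))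
  simp only [Pi.mul_apply, mul_one, lintegral_const,
    ENNReal.rpow_ofNat] at h
  have h2 := pow_le_pow_left₀ (by positivity) h 2
  rw [mul_pow] at h2
  have e : ∀ a : ENNReal, (a ^ (1 / 2 : ℝ)) ^ 2 = a := fun a => by
    rw [← ENNReal.rpow_natCast, ← ENNReal.rpow_mul]; norm_num
  rw [e, e, one_pow, one_mul, mul_comm] at h2
  exact h2

theorem eLpNorm_two_sq (f : ℝ → ℂ) (μ : Measure ℝ) :
    eLpNorm f 2 μ ^ 2 = ∫⁻ x, ‖f x‖ₑ ^ 2 ∂μ := by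
  rw [eLpNorm_eq_lintegral_rpow_enorm_toReal (by simp) (by simp)]
  simp only [ENNReal.toReal_ofNat, ENNReal.rpow_ofNat]
  rw [← ENNReal.rpow_natCast, ← ENNReal.rpow_mul]; norm_num

/-- The fundamental theorem of calculus at each x, then Cauchy–Schwarz in τ and Tonelli. Joint
continuity of G serves only for measurability in (τ, x). -/
theorem l2Norm_increment_le {s t ε : ℝ} (hε : 0 ≤ ε)
    (hG : ∀ τ ∈ Set.uIcc t s, MemLp (G τ) 2 Z.measure)
    (hd : ∀ τ ∈ Set.uIcc t s, ∀ x, HasDerivAt (fun s => F s x) (G τ x) τ)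
    (hj : ContinuousOn (Function.uncurry G) (Set.uIcc t s ×ˢ Set.univ))
    (hle : ∀ τ ∈ Set.uIcc t s, Z.l2Norm (fun x => G τ x - G t x) ≤ ε) :
    Z.l2Norm (fun x => F s x - F t x - ((s - t : ℝ) : ℂ) * G t x) ≤ ε * |s - t| := by
  have ht : t ∈ Set.uIcc t s := Set.left_mem_uIcc
  have hGx : ∀ x, ContinuousOn (fun τ => G τ x) (Set.uIcc t s) := fun x =>
    hj.comp (f := fun τ => (τ, x)) (by fun_prop) fun τ hτ => ⟨hτ, trivial⟩
  have hsub : Set.uIoc t s ⊆ Set.uIcc t s := Set.uIoc_subset_uIcc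
  have hjoint : ContinuousOn (fun p : ℝ × ℝ => G p.1 p.2 - G t p.2) (Set.uIcc t s ×ˢ Set.univ) := by
    refine hj.sub (hj.comp (f := fun p : ℝ × ℝ => (t, p.2)) (by fun_prop) ?_)
    exact fun p hp => ⟨ht, trivial⟩
  have h1 : ∀ x, ‖F s x - F t x - ((s - t : ℝ) : ℂ) * G t x‖ₑ
      ≤ ∫⁻ τ in Set.uIoc t s, ‖G τ x - G t x‖ₑ := by
    intro x
    have e1 : ∫ τ in t..s, G τ x = F s x - F t x :=
      intervalIntegral.integral_eq_sub_of_hasDerivAt (fun τ hτ => hd τ hτ x)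
        (hGx x).intervalIntegrable
    have e2 : F s x - F t x - ((s - t : ℝ) : ℂ) * G t x = ∫ τ in t..s, (G τ x - G t x) := by
      rw [intervalIntegral.integral_sub (hGx x).intervalIntegrable (by simp), e1,
        intervalIntegral.integral_const, Complex.real_smul]
    rw [e2]
    have e3 : ‖∫ τ in t..s, (G τ x - G t x)‖ₑ = ‖∫ τ in Set.uIoc t s, (G τ x - G t x)‖ₑ := by
      rw [← ofReal_norm, ← ofReal_norm,
        intervalIntegral.norm_intervalIntegral_eq]
    rw [e3]
    exact enorm_integral_le_lintegral_enorm _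
  have hvol : volume (Set.uIoc t s) = ENNReal.ofReal |s - t| := Real.volume_uIoc
  have h2 : eLpNorm (fun x => F s x - F t x - ((s - t : ℝ) : ℂ) * G t x) 2 Z.measure ^ 2
      ≤ ENNReal.ofReal (ε * |s - t|) ^ 2 := by
    rw [eLpNorm_two_sq]
    have hm : AEMeasurable (fun p : ℝ × ℝ => ‖G p.1 p.2 - G t p.2‖ₑ ^ 2)
        ((volume.restrict (Set.uIoc t s)).prod Z.measure) := by
      have h3 : AEStronglyMeasurable (fun p : ℝ × ℝ => G p.1 p.2 - G t p.2)
          ((volume.restrict (Set.uIoc t s)).prod Z.measure) := by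
        have h4 := (hjoint.mono (Set.prod_mono_left hsub)).aestronglyMeasurable
          (μ := volume.prod Z.measure) (measurableSet_uIoc.prod MeasurableSet.univ)
        rwa [← Measure.prod_restrict, Measure.restrict_univ] at h4
      exact h3.enorm.pow_const 2
    calc ∫⁻ x, ‖F s x - F t x - ((s - t : ℝ) : ℂ) * G t x‖ₑ ^ 2 ∂Z.measure
        ≤ ∫⁻ x, (ENNReal.ofReal |s - t| *
            ∫⁻ τ in Set.uIoc t s, ‖G τ x - G t x‖ₑ ^ 2) ∂Z.measure := by
          refine lintegral_mono fun x => ?_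
          refine (pow_le_pow_left₀ (by positivity) (h1 x) 2).trans ?_
          have h5 : AEMeasurable (fun τ => ‖G τ x - G t x‖ₑ) (volume.restrict (Set.uIoc t s)) := by
            refine (((hGx x).mono hsub).aestronglyMeasurable measurableSet_uIoc |>.sub
              aestronglyMeasurable_const).enorm
          have := sq_lintegral_le h5
          rwa [Measure.restrict_apply_univ, hvol] at this
      _ = ENNReal.ofReal |s - t| * ∫⁻ τ in Set.uIoc t s,
            ∫⁻ x, ‖G τ x - G t x‖ₑ ^ 2 ∂Z.measure := by
          rw [lintegral_const_mul' _ _ ENNReal.ofReal_ne_top]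
          congr 1
          exact (lintegral_lintegral_swap
            (f := fun τ x => ‖G τ x - G t x‖ₑ ^ 2) hm).symm
      _ ≤ ENNReal.ofReal |s - t| * ∫⁻ _ in Set.uIoc t s, ENNReal.ofReal ε ^ 2 := by
          refine mul_le_mul_right ?_ _
          refine setLIntegral_mono measurable_const fun τ hτ => ?_
          rw [← eLpNorm_two_sq]
          gcongr
          have hmem : MemLp (fun x => G τ x - G t x) 2 Z.measure :=
            (hG τ (hsub hτ)).sub (hG t ht)
          rw [← ENNReal.ofReal_toReal hmem.2.ne]
          exact ENNReal.ofReal_le_ofReal (hle τ (hsub hτ))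
      _ = ENNReal.ofReal (ε * |s - t|) ^ 2 := by
          rw [lintegral_const, Measure.restrict_apply_univ, hvol, ENNReal.ofReal_mul hε]
          ring
  have h6 : eLpNorm (fun x => F s x - F t x - ((s - t : ℝ) : ℂ) * G t x) 2 Z.measure
      ≤ ENNReal.ofReal (ε * |s - t|) :=
    (ENNReal.pow_le_pow_left_iff two_ne_zero).1 h2
  exact ENNReal.toReal_le_of_le_ofReal (by positivity) h6

/-- A pointwise time derivative becomes an L² derivative once it is continuous in time with values
in L²: the Taylor remainder is then at most ε|s - t|. -/
theorem hasDerivAt_toL2 {a b t : ℝ} (hF : ∀ t ∈ Set.Ioo a b, MemLp (F t) 2 Z.measure)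
    (hG : ∀ t ∈ Set.Ioo a b, MemLp (G t) 2 Z.measure)
    (hd : ∀ t ∈ Set.Ioo a b, ∀ x, HasDerivAt (fun s => F s x) (G t x) t)
    (hj : ContinuousOn (Function.uncurry G) (Set.Ioo a b ×ˢ Set.univ))
    (hc : ContinuousOn (fun t => Z.toL2 (G t)) (Set.Ioo a b)) (ht : t ∈ Set.Ioo a b) :
    HasDerivAt (fun s => Z.toL2 (F s)) (Z.toL2 (G t)) t := by
  rw [hasDerivAt_iff_isLittleO, Asymptotics.isLittleO_iff]
  intro ε hε
  have h1 : ∀ᶠ s in nhds t, dist (Z.toL2 (G s)) (Z.toL2 (G t)) < ε :=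
    (hc.continuousAt (isOpen_Ioo.mem_nhds ht)).eventually (Metric.ball_mem_nhds _ hε)
  have h2 : ∀ᶠ s in nhds t, s ∈ Set.Ioo a b := isOpen_Ioo.mem_nhds ht
  obtain ⟨δ, hδ, hball⟩ := Metric.eventually_nhds_iff_ball.1 (h1.and h2)
  filter_upwards [Metric.ball_mem_nhds t hδ] with s hs
  have hsub : Set.uIcc t s ⊆ Metric.ball t δ := by
    have hconv : (Metric.ball t δ).OrdConnected := by
      rw [Real.ball_eq_Ioo]; exact Set.ordConnected_Ioo
    exact hconv.uIcc_subset (Metric.mem_ball_self hδ) hs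
  have hI : ∀ τ ∈ Set.uIcc t s, τ ∈ Set.Ioo a b := fun τ hτ => (hball τ (hsub hτ)).2
  have hs' : s ∈ Set.Ioo a b := hI s Set.right_mem_uIcc
  have key := l2Norm_increment_le (Z := Z) (F := F) (G := G) (s := s) (t := t) hε.le
    (fun τ hτ => hG τ (hI τ hτ)) (fun τ hτ => hd τ (hI τ hτ))
    (hj.mono (Set.prod_mono_left hI)) (fun τ hτ => by
      rw [← dist_toL2 (hG τ (hI τ hτ)) (hG t ht)]
      exact (hball τ (hsub hτ)).1.le)
  have e : Z.toL2 (F s) - Z.toL2 (F t) - (s - t) • Z.toL2 (G t)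
      = Z.toL2 (fun x => F s x - F t x - ((s - t : ℝ) : ℂ) * G t x) := by
    rw [toL2_sub (f := fun x => F s x - F t x) ((hF s hs').sub (hF t ht))
      ((hG t ht).const_mul _), toL2_sub (hF s hs') (hF t ht), toL2_const_mul (hG t ht)]
    rfl
  rw [e, norm_toL2, Real.norm_eq_abs]
  · exact key
  · exact ((hF s hs').sub (hF t ht)).sub ((hG t ht).const_mul _)

/-- The multiplier is linear and bounded on L², so it sends a Taylor remainder o(s - t) to another
one. This differentiates the nonlocal V without a pointwise derivative. -/
theorem hasDerivAt_toL2_op {I : Set ℝ} {t : ℝ} {g : ℝ → ℂ} (hm : SymbolBound C m)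
    (hI : I ∈ nhds t) (hF : ∀ s ∈ I, Z.Nice 1 (F s)) (hg : Z.Nice 1 g)
    (h : HasDerivAt (fun s => Z.toL2 (F s)) (Z.toL2 g) t) :
    HasDerivAt (fun s => Z.toL2 (Z.op m (F s))) (Z.toL2 (Z.op m g)) t := by
  rw [hasDerivAt_iff_isLittleO] at h ⊢
  refine Asymptotics.IsBigO.trans_isLittleO ?_ h
  refine Asymptotics.IsBigO.of_bound C ?_
  have ht : t ∈ I := mem_of_mem_nhds hI
  have e : ∀ {a b c : ℝ → ℂ} (r : ℝ), MemLp a 2 Z.measure → MemLp b 2 Z.measure →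
      MemLp c 2 Z.measure → Z.toL2 a - Z.toL2 b - r • Z.toL2 c
      = Z.toL2 (fun x => a x - b x - (r : ℂ) * c x) := by
    intro a b c r ha hb hc
    rw [toL2_sub (f := fun x => a x - b x) (ha.sub hb) (hc.const_mul _), toL2_sub ha hb,
      toL2_const_mul hc]
    rfl
  filter_upwards [hI] with s hs
  have a := hF s hs
  have b := hF t ht
  have hn := (a.sub b).sub (hg.const_mul ((s - t : ℝ) : ℂ))
  rw [e _ (nice_op hm a).memLp_self (nice_op hm b).memLp_self (nice_op hm hg).memLp_self,
    e _ a.two.memLp_self b.two.memLp_self hg.two.memLp_self]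
  have e2 : (fun x => Z.op m (F s) x - Z.op m (F t) x - ((s - t : ℝ) : ℂ) * Z.op m g x)
      = Z.op m (fun x => F s x - F t x - ((s - t : ℝ) : ℂ) * g x) := by
    ext x
    rw [op_sub hm (a.sub b) (hg.const_mul _), op_sub hm a b, op_const_mul]
  rw [e2, norm_toL2 (nice_op hm hn).memLp_self, norm_toL2 hn.two.memLp_self]
  exact l2Norm_op_le hm hn

theorem hasDerivAt_integral_conj_mul {I : Set ℝ} {t : ℝ} {f' g' : ℝ → ℂ} (hI : I ∈ nhds t)
    (hF : ∀ s ∈ I, MemLp (F s) 2 Z.measure) (hG : ∀ s ∈ I, MemLp (G s) 2 Z.measure)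
    (hf' : MemLp f' 2 Z.measure) (hg' : MemLp g' 2 Z.measure)
    (h1 : HasDerivAt (fun s => Z.toL2 (F s)) (Z.toL2 f') t)
    (h2 : HasDerivAt (fun s => Z.toL2 (G s)) (Z.toL2 g') t) :
    HasDerivAt (fun s => ∫ x, (starRingEnd ℂ) (F s x) * G s x ∂Z.measure)
      (∫ x, (starRingEnd ℂ) (F t x) * g' x ∂Z.measure
        + ∫ x, (starRingEnd ℂ) (f' x) * G t x ∂Z.measure) t := by
  have ht : t ∈ I := mem_of_mem_nhds hI
  have := HasDerivAt.inner ℂ h1 h2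
  rw [inner_toL2 (hF t ht) hg', inner_toL2 hf' (hG t ht)] at this
  refine this.congr_of_eventuallyEq ?_
  filter_upwards [hI] with s hs
  rw [inner_toL2 (hF s hs) (hG s hs)]

end

end KDNLS

/-! ### Velocity, density and momentum: pointwise evolution equations. -/

namespace KDNLS

noncomputable section

variable {Z : Domain} {f g : ℝ → ℂ} {α β : ℝ} {u : ℝ → ℂ}

/-- The symbol of `f ↦ α f + β 𝓗 f`. -/
def velSym (α β ξ : ℝ) : ℂ := α * 1 + β * hilbertSym ξ

/-- The real velocity `α |u|² + β 𝓗(|u|²)`. -/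
def Domain.vel (Z : Domain) (α β : ℝ) (u : ℝ → ℂ) : ℝ → ℂ := Z.op (velSym α β) (density u)

/-- The momentum density `Im (ū uₓ)`. -/
def momentum (u : ℝ → ℂ) (x : ℝ) : ℂ :=
  -(Complex.I / 2) * ((starRingEnd ℂ) (u x) * deriv u x - u x * (starRingEnd ℂ) (deriv u x))

theorem symbolBound_vel (α β : ℝ) : SymbolBound (|α| + |β|) (velSym α β) := by
  refine ⟨?_, fun ξ => ?_⟩
  · unfold velSym
    exact (symbolBound_hilbert.meas.const_mul _).const_add _
  · refine (norm_add_le _ _).trans ?_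
    rw [norm_mul, norm_mul, Complex.norm_real, Complex.norm_real, norm_one, mul_one,
      Real.norm_eq_abs, Real.norm_eq_abs]
    have := symbolBound_hilbert.le ξ
    have h := abs_nonneg β
    nlinarith

theorem velSym_neg (ξ : ℝ) : velSym α β (-ξ) = (starRingEnd ℂ) (velSym α β ξ) := by
  simp [velSym, hilbertSym_neg]

theorem op_vel (hf : Z.Nice 1 f) (x : ℝ) :
    Z.op (velSym α β) f x = α * f x + β * Z.op hilbertSym f x := by
  have e : velSym α β = fun ξ => (α * (1 : ℂ)) + β * hilbertSym ξ := rfl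
  have h1 : SymbolBound (‖(α : ℂ)‖ * 1) (fun _ => (α : ℂ) * 1) :=
    (⟨measurable_const, fun _ => le_rfl⟩ : SymbolBound ‖(α : ℂ)‖ fun _ => (α : ℂ)).mul symbolBound_one
  have h2 : SymbolBound (‖(β : ℂ)‖ * 1) (fun ξ => (β : ℂ) * hilbertSym ξ) :=
    (⟨measurable_const, fun _ => le_rfl⟩ : SymbolBound ‖(β : ℂ)‖ fun _ => (β : ℂ)).mul
      symbolBound_hilbert
  rw [e, op_symbol_add h1 h2 hf, op_symbol_const_mul, op_symbol_const_mul, op_one hf]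

theorem nice_vel (hu : Z.Nice 2 u) : Z.Nice 2 (Z.vel α β u) :=
  nice_op (symbolBound_vel α β) (nice_density hu)

theorem isReal_vel (Z : Domain) (α β : ℝ) (u : ℝ → ℂ) : IsReal (Z.vel α β u) :=
  isReal_op (fun ξ => velSym_neg ξ) (isReal_density u)

theorem deriv_vel (hu : Z.Nice 2 u) :
    deriv (Z.vel α β u) = Z.op (velSym α β) (deriv (density u)) :=
  deriv_op (symbolBound_vel α β) (nice_density hu)

theorem nice_momentum (hu : Z.Nice 2 u) : Z.Nice 1 (momentum u) :=
  ((hu.conj.mul hu.deriv).sub (hu.mul hu.deriv.conj)).const_mul _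

theorem isReal_momentum (u : ℝ → ℂ) : IsReal (momentum u) := by
  intro x
  simp [momentum, Complex.conj_ofNat]
  ring

theorem deriv_conj_apply (f : ℝ → ℂ) (x : ℝ) :
    deriv (fun x => (starRingEnd ℂ) (f x)) x = (starRingEnd ℂ) (deriv f x) := deriv.star (f := f)

theorem deriv_momentum (hu : Z.Nice 2 u) :
    deriv (momentum u) = fun x => -(Complex.I / 2) *
      ((starRingEnd ℂ) (u x) * deriv (deriv u) x - u x * (starRingEnd ℂ) (deriv (deriv u) x)) := by
  ext x
  have h1 := (hu.conj.hasDerivAt x).mul (hu.deriv.hasDerivAt x)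
  have h2 := (hu.hasDerivAt x).mul (hu.deriv.conj.hasDerivAt x)
  have h3 := ((h1.sub h2).const_mul (-(Complex.I / 2))).deriv
  rw [deriv_conj_apply, deriv_conj_apply] at h3
  refine Eq.trans ?_ (h3.trans ?_)
  · rfl
  · ring

theorem norm_momentum_le (u : ℝ → ℂ) (x : ℝ) : ‖momentum u x‖ ≤ ‖u x * deriv u x‖ := by
  rw [momentum, norm_mul]
  have h1 : ‖-(Complex.I / 2)‖ = 1 / 2 := by simp
  rw [h1]
  have h2 := norm_sub_le ((starRingEnd ℂ) (u x) * deriv u x) (u x * (starRingEnd ℂ) (deriv u x))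
  simp only [norm_mul, RCLike.norm_conj] at h2 ⊢
  linarith

theorem integral_norm_momentum_le (hu : Z.Nice 2 u) :
    ∫ x, ‖momentum u x‖ ∂Z.measure ≤ Z.l2Norm u * Z.l2Norm (deriv u) := by
  refine le_trans ?_ (integral_norm_mul_le hu.memLp_self hu.deriv.memLp_self)
  exact integral_mono (nice_momentum hu).integrable.norm (hu.mul hu.deriv).integrable.norm
    (norm_momentum_le u)

theorem l2Norm_momentum_le (hu : Z.Nice 2 u) :
    Z.l2Norm (momentum u) ≤ √(supSq u) * Z.l2Norm (deriv u) := by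
  have h := l2Norm_mono (f := momentum u) (hu.mul hu.deriv).two.memLp_self zero_le_one
    (fun x => by rw [one_mul]; exact norm_momentum_le u x)
  rw [one_mul] at h
  exact h.trans (l2Norm_mul_le hu hu.deriv.memLp_self)

/-- The nonlinear part of the time derivative of the density. -/
def Domain.flux (Z : Domain) (α β : ℝ) (u : ℝ → ℂ) (x : ℝ) : ℂ :=
  2 * (deriv (Z.vel α β u) x * density u x) + Z.vel α β u x * deriv (density u) x

/-- The time derivative of `u`. -/
def Domain.dtU (Z : Domain) (α β : ℝ) (u : ℝ → ℂ) (x : ℝ) : ℂ :=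
  Complex.I * deriv (deriv u) x + (deriv (Z.vel α β u) x * u x + Z.vel α β u x * deriv u x)

/-- The time derivative of the density. -/
def Domain.dtDensity (Z : Domain) (α β : ℝ) (u : ℝ → ℂ) (x : ℝ) : ℂ :=
  (-2) * deriv (momentum u) x + Z.flux α β u x

/-- The time derivative of the momentum density. -/
def Domain.dtMomentum (Z : Domain) (α β : ℝ) (u : ℝ → ℂ) (x : ℝ) : ℂ :=
  ((1 / 2) * deriv (deriv (deriv (density u))) x + (-2) * deriv (density (deriv u)) x)
    + (3 * (deriv (Z.vel α β u) x * momentum u x) + Z.vel α β u x * deriv (momentum u) x)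

theorem nice_flux (hu : Z.Nice 2 u) : Z.Nice 1 (Z.flux α β u) :=
  (((nice_vel hu).deriv.mul (nice_density hu).two).const_mul 2).add
    ((nice_vel hu).mul (nice_density hu).two.deriv)

theorem nice_dtU (hu : Z.Nice 2 u) : Z.Nice 2 (Z.dtU α β u) :=
  (hu.deriv.deriv.const_mul _).add
    (((nice_vel hu).deriv.mul hu).two.add ((nice_vel hu).mul hu.deriv).two)

theorem nice_dtDensity (hu : Z.Nice 2 u) : Z.Nice 1 (Z.dtDensity α β u) :=
  ((nice_momentum hu).deriv.const_mul _).add (nice_flux hu)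

theorem nice_dtMomentum (hu : Z.Nice 2 u) : Z.Nice 1 (Z.dtMomentum α β u) :=
  (((nice_density hu).deriv.deriv.deriv.const_mul _).add
    ((nice_density hu.deriv).deriv.const_mul _)).add
    ((((nice_vel hu).deriv.mul (nice_momentum hu).two).const_mul 3).add
      ((nice_vel hu).mul (nice_momentum hu).two.deriv))

theorem deriv_dtU (hu : Z.Nice 2 u) (x : ℝ) : deriv (Z.dtU α β u) x
    = Complex.I * deriv (deriv (deriv u)) x + (deriv (deriv (Z.vel α β u)) x * u x
      + 2 * (deriv (Z.vel α β u) x * deriv u x) + Z.vel α β u x * deriv (deriv u) x) := by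
  have hV := nice_vel (α := α) (β := β) hu
  have h := ((hu.deriv.deriv.hasDerivAt x).const_mul Complex.I).add
    (((hV.deriv.hasDerivAt x).mul (hu.hasDerivAt x)).add
      ((hV.hasDerivAt x).mul (hu.deriv.hasDerivAt x)))
  refine Eq.trans ?_ (h.deriv.trans ?_)
  · rfl
  · ring

theorem conj_deriv_vel (Z : Domain) (α β : ℝ) (u : ℝ → ℂ) (x : ℝ) :
    (starRingEnd ℂ) (deriv (Z.vel α β u) x) = deriv (Z.vel α β u) x :=
  isReal_deriv (isReal_vel Z α β u) x

theorem density_apply (u : ℝ → ℂ) (x : ℝ) : density u x = (starRingEnd ℂ) (u x) * u x :=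
  congrFun (density_eq u) x

/-- Local balance of the density. It relies on V being real, so that V and Vₓ pass through the
conjugation. -/
theorem conj_mul_dtU (hu : Z.Nice 2 u) (x : ℝ) :
    (starRingEnd ℂ) (Z.dtU α β u x) * u x + (starRingEnd ℂ) (u x) * Z.dtU α β u x
      = Z.dtDensity α β u x := by
  rw [Domain.dtDensity, Domain.flux, deriv_momentum hu, deriv_density hu, density_apply]
  simp only [Domain.dtU, map_add, map_mul, Complex.conj_I, conj_deriv_vel Z α β u, isReal_vel Z α β u x]
  ring

theorem deriv_density_two (hu : Z.Nice 2 u) : deriv (deriv (density u)) = fun x =>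
    (starRingEnd ℂ) (deriv (deriv u) x) * u x + 2 * density (deriv u) x
      + (starRingEnd ℂ) (u x) * deriv (deriv u) x := by
  rw [deriv_density hu]
  ext x
  have h := ((hu.deriv.conj.hasDerivAt x).mul (hu.hasDerivAt x)).add
    ((hu.conj.hasDerivAt x).mul (hu.deriv.hasDerivAt x))
  rw [deriv_conj_apply, deriv_conj_apply] at h
  refine Eq.trans ?_ (h.deriv.trans ?_)
  · rfl
  · rw [density_apply]; ring

theorem deriv_density_three (hu : Z.Nice 2 u) : deriv (deriv (deriv (density u))) = fun x =>
    (starRingEnd ℂ) (deriv (deriv (deriv u)) x) * u x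
      + 3 * ((starRingEnd ℂ) (deriv (deriv u) x) * deriv u x
        + (starRingEnd ℂ) (deriv u x) * deriv (deriv u) x)
      + (starRingEnd ℂ) (u x) * deriv (deriv (deriv u)) x := by
  rw [deriv_density_two hu]
  ext x
  have h := (((hu.deriv.deriv.conj.hasDerivAt x).mul (hu.hasDerivAt x)).add
    (((nice_density hu.deriv).hasDerivAt x).const_mul 2)).add
    ((hu.conj.hasDerivAt x).mul (hu.deriv.deriv.hasDerivAt x))
  rw [deriv_conj_apply, deriv_conj_apply, deriv_density hu.deriv] at h
  refine Eq.trans ?_ (h.deriv.trans ?_)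
  · rfl
  · ring

/-- The time derivative of the momentum density in terms of that of `u`. -/
theorem momentum_dtU (hu : Z.Nice 2 u) (x : ℝ) :
    -(Complex.I / 2) * (((starRingEnd ℂ) (Z.dtU α β u x) * deriv u x
        + (starRingEnd ℂ) (u x) * deriv (Z.dtU α β u) x)
      - (Z.dtU α β u x * (starRingEnd ℂ) (deriv u x)
        + u x * (starRingEnd ℂ) (deriv (Z.dtU α β u) x))) = Z.dtMomentum α β u x := by
  have hV2 : (starRingEnd ℂ) (deriv (deriv (Z.vel α β u)) x) = deriv (deriv (Z.vel α β u)) x :=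
    isReal_deriv (isReal_deriv (isReal_vel Z α β u)) x
  rw [Domain.dtMomentum, deriv_density_three hu, deriv_density hu.deriv, deriv_momentum hu,
    deriv_dtU hu, momentum]
  simp only [Domain.dtU, map_add, map_mul, Complex.conj_I, conj_deriv_vel Z α β u, isReal_vel Z α β u x,
    hV2, Complex.conj_ofNat]
  ring_nf
  simp only [Complex.I_sq]
  ring

/-- The time derivative of `|uₓ|²`. -/
theorem conj_mul_deriv_dtU (hu : Z.Nice 2 u) (x : ℝ) :
    (starRingEnd ℂ) (deriv (Z.dtU α β u) x) * deriv u x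
      + (starRingEnd ℂ) (deriv u x) * deriv (Z.dtU α β u) x
      = (-2) * deriv (momentum (deriv u)) x + (deriv (deriv (Z.vel α β u)) x * deriv (density u) x
        + (4 * (deriv (Z.vel α β u) x * density (deriv u) x)
          + Z.vel α β u x * deriv (density (deriv u)) x)) := by
  have hV2 : (starRingEnd ℂ) (deriv (deriv (Z.vel α β u)) x) = deriv (deriv (Z.vel α β u)) x :=
    isReal_deriv (isReal_deriv (isReal_vel Z α β u)) x
  rw [deriv_momentum hu.deriv, deriv_dtU hu, deriv_density hu, deriv_density hu.deriv, density_apply]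
  simp only [map_add, map_mul, Complex.conj_I, conj_deriv_vel Z α β u, isReal_vel Z α β u x,
    hV2, Complex.conj_ofNat]
  ring

end

end KDNLS

/-! ### Integral identities and the cancellation behind the energy. -/

namespace KDNLS

noncomputable section

variable {Z : Domain} {f g : ℝ → ℂ} {α β : ℝ} {u : ℝ → ℂ}

theorem integral_add_three {ν : Measure ℝ} {h : ℝ → ℂ} (hf : Integrable f ν) (hg : Integrable g ν)
    (hh : Integrable h ν) :
    ∫ x, (f x + (g x + h x)) ∂ν = ∫ x, f x ∂ν + (∫ x, g x ∂ν + ∫ x, h x ∂ν) := by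
  rw [← integral_add hg hh]
  exact integral_add hf (hg.add hh)

theorem integral_add_four {ν : Measure ℝ} {h k : ℝ → ℂ} (hf : Integrable f ν) (hg : Integrable g ν)
    (hh : Integrable h ν) (hk : Integrable k ν) :
    ∫ x, (f x + (g x + (h x + k x))) ∂ν
      = ∫ x, f x ∂ν + (∫ x, g x ∂ν + (∫ x, h x ∂ν + ∫ x, k x ∂ν)) := by
  rw [← integral_add_three hg hh hk]
  exact integral_add hf (hg.add (hh.add hk))

theorem integral_conj_mul_of_isReal (hf : IsReal f) (g : ℝ → ℂ) :
    ∫ x, (starRingEnd ℂ) (f x) * g x ∂Z.measure = ∫ x, f x * g x ∂Z.measure := by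
  refine integral_congr_ae (ae_of_all _ fun x => ?_)
  simp only [hf x]

theorem integral_mul_deriv_self (hf : Z.Nice 2 f) : ∫ x, f x * deriv f x ∂Z.measure = 0 := by
  have h := integral_deriv_mul hf hf
  have e : ∫ x, deriv f x * f x ∂Z.measure = ∫ x, f x * deriv f x ∂Z.measure := by
    simp only [mul_comm]
  rw [e] at h
  exact self_eq_neg.1 h

/-- The α part is the integral of a total derivative; only the Hilbert transform contributes. -/
theorem integral_mul_vel_deriv (hf : Z.Nice 1 f) (hr : IsReal f) :
    ∫ x, f x * Z.op (velSym α β) (deriv f) x ∂Z.measure = (β : ℂ) * (Z.hsq f : ℂ) := by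
  have hH := nice_op symbolBound_hilbert hf.deriv
  have e : ∀ x, f x * Z.op (velSym α β) (deriv f) x
      = α * (f x * deriv f x) + β * (f x * Z.op hilbertSym (deriv f) x) := fun x => by
    rw [op_vel hf.deriv]; ring
  simp only [e]
  rw [integral_add ((hf.two.mul hf.two.deriv).integrable.const_mul _)
    ((hf.two.mul hH).integrable.const_mul _), integral_const_mul, integral_const_mul,
    integral_mul_deriv_self hf.two, ← integral_conj_mul_hilbert_deriv hf,
    integral_conj_mul_of_isReal hr]
  ring

theorem integral_deriv_vel_mul_density (hu : Z.Nice 2 u) :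
    ∫ x, deriv (Z.vel α β u) x * density u x ∂Z.measure = (β : ℂ) * (Z.hsq (density u) : ℂ) := by
  rw [deriv_vel hu, ← integral_mul_vel_deriv (α := α) (nice_density hu) (isReal_density u)]
  simp only [mul_comm]

theorem integral_flux (hu : Z.Nice 2 u) :
    ∫ x, Z.flux α β u x ∂Z.measure = (β : ℂ) * (Z.hsq (density u) : ℂ) := by
  have hV := nice_vel (α := α) (β := β) hu
  have hρ := (nice_density hu).two
  simp only [Domain.flux]
  have h := integral_deriv_mul hV hρ
  rw [integral_add ((hV.deriv.mul hρ).integrable.const_mul _) (hV.mul hρ.deriv).integrable,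
    integral_const_mul, ← neg_neg (∫ x, Z.vel α β u x * deriv (density u) x ∂Z.measure), ← h,
    integral_deriv_vel_mul_density hu]
  ring

/-- Mass dissipation: the dispersive flux -2Jₓ integrates to zero and 2∫ Vₓρ + ∫ Vρₓ = ∫ Vₓρ. -/
theorem integral_dtDensity (hu : Z.Nice 2 u) :
    ∫ x, Z.dtDensity α β u x ∂Z.measure = (β : ℂ) * (Z.hsq (density u) : ℂ) := by
  simp only [Domain.dtDensity]
  rw [integral_add ((nice_momentum hu).deriv.integrable.const_mul _) (nice_flux hu).integrable,
    integral_const_mul, integral_deriv_eq_zero (nice_momentum hu), integral_flux hu]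
  ring

theorem deriv_deriv_vel (hu : Z.Nice 2 u) :
    deriv (deriv (Z.vel α β u)) = Z.op (velSym α β) (deriv (deriv (density u))) := by
  rw [deriv_vel hu, deriv_op (symbolBound_vel α β) (nice_density hu).deriv]

theorem integral_deriv_deriv_vel_mul (hu : Z.Nice 2 u) :
    ∫ x, deriv (deriv (Z.vel α β u)) x * deriv (density u) x ∂Z.measure
      = (β : ℂ) * (Z.hsq (deriv (density u)) : ℂ) := by
  rw [deriv_deriv_vel hu, ← integral_mul_vel_deriv (α := α) (nice_density hu).deriv
    (isReal_deriv (isReal_density u))]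
  simp only [mul_comm]

/-- The coefficient 3 is 4 - 1, the -1 coming from V(|uₓ|²)ₓ by parts. This integral has no sign,
and the energy is built to cancel it. -/
theorem integral_conj_mul_deriv_dtU (hu : Z.Nice 2 u) :
    ∫ x, ((starRingEnd ℂ) (deriv (Z.dtU α β u) x) * deriv u x
      + (starRingEnd ℂ) (deriv u x) * deriv (Z.dtU α β u) x) ∂Z.measure
      = (β : ℂ) * (Z.hsq (deriv (density u)) : ℂ)
        + 3 * ∫ x, deriv (Z.vel α β u) x * density (deriv u) x ∂Z.measure := by
  have hV := nice_vel (α := α) (β := β) hu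
  have hρ := (nice_density hu).two
  have he := (nice_density hu.deriv).two
  simp only [conj_mul_deriv_dtU hu]
  have h := integral_deriv_mul hV he
  rw [integral_add_four ((nice_momentum hu.deriv).deriv.integrable.const_mul _)
    (hV.deriv.deriv.mul hρ.deriv).integrable ((hV.deriv.mul he).integrable.const_mul _)
    (hV.mul he.deriv).integrable,
    integral_const_mul, integral_const_mul, integral_deriv_eq_zero (nice_momentum hu.deriv),
    integral_deriv_deriv_vel_mul hu,
    ← neg_neg (∫ x, Z.vel α β u x * deriv (density (deriv u)) x ∂Z.measure), ← h]
  ring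

/-- Here 3/2 = 2 - 1/2 after integrating by parts. The α part vanishes because ρ²ρₓ is a total
derivative. -/
theorem integral_density_mul_dtDensity (hu : Z.Nice 2 u) :
    ∫ x, density u x * Z.dtDensity α β u x ∂Z.measure
      = 2 * (∫ x, momentum u x * deriv (density u) x ∂Z.measure)
        + (3 / 2) * (β * ∫ x, Z.op hilbertSym (deriv (density u)) x
            * (density u x * density u x) ∂Z.measure) := by
  have hV := nice_vel (α := α) (β := β) hu
  have hρ := (nice_density hu).two
  have hJ := (nice_momentum hu).two
  have hρρ := (hρ.mul hρ).two
  have hH := nice_op symbolBound_hilbert (nice_density hu).deriv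
  have h1 := integral_deriv_mul hJ hρ
  have h2 := integral_deriv_mul hV hρρ
  have h3 : ∫ x, deriv (density u) x * (density u x * density u x) ∂Z.measure = 0 := by
    have h4 := integral_deriv_mul hρ hρρ
    rw [deriv_mul_eq hρ hρ] at h4
    have e : ∫ x, density u x * (deriv (density u) x * density u x
        + density u x * deriv (density u) x) ∂Z.measure
        = 2 * ∫ x, deriv (density u) x * (density u x * density u x) ∂Z.measure := by
      rw [← integral_const_mul]
      congr 1; ext x; ring
    rw [e] at h4
    linear_combination (1 / 3) * h4
  have h5 : ∫ x, deriv (Z.vel α β u) x * (density u x * density u x) ∂Z.measure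
      = β * ∫ x, Z.op hilbertSym (deriv (density u)) x * (density u x * density u x) ∂Z.measure := by
    have e : ∀ x, deriv (Z.vel α β u) x * (density u x * density u x)
        = α * (deriv (density u) x * (density u x * density u x))
          + β * (Z.op hilbertSym (deriv (density u)) x * (density u x * density u x)) := fun x => by
      rw [deriv_vel hu, op_vel (nice_density hu).deriv]; ring
    simp only [e]
    rw [integral_add ((hρ.deriv.mul hρρ).integrable.const_mul _)
      ((hH.mul hρρ).integrable.const_mul _), integral_const_mul, integral_const_mul, h3]
    ring
  have e : ∀ x, density u x * Z.dtDensity α β u x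
      = (-2) * (deriv (momentum u) x * density u x)
        + (2 * (deriv (Z.vel α β u) x * (density u x * density u x))
          + (1 / 2) * (Z.vel α β u x * deriv (fun x => density u x * density u x) x)) := fun x => by
    rw [deriv_mul_eq hρ hρ, Domain.dtDensity, Domain.flux]; ring
  simp only [e]
  rw [integral_add_three ((hJ.deriv.mul hρ).integrable.const_mul _)
    ((hV.deriv.mul hρρ).integrable.const_mul _) ((hV.mul hρρ.deriv).integrable.const_mul _),
    integral_const_mul, integral_const_mul, integral_const_mul, h1,
    ← neg_neg (∫ x, Z.vel α β u x * deriv (fun x => density u x * density u x) x ∂Z.measure), ← h2,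
    h5]
  ring

/-- The momentum density with the adjoint of `f ↦ α f + β 𝓗 f` applied. -/
def Domain.dualMomentum (Z : Domain) (α β : ℝ) (u : ℝ → ℂ) : ℝ → ℂ :=
  Z.op (fun ξ => (starRingEnd ℂ) (velSym α β ξ)) (momentum u)

/-- The quintic remainder in the time derivative of `∫ V J`. -/
def Domain.remainder (Z : Domain) (α β : ℝ) (u : ℝ → ℂ) : ℂ :=
  ∫ x, Z.flux α β u x * Z.dualMomentum α β u x ∂Z.measure
    + ∫ x, (Z.vel α β u x * deriv (Z.vel α β u) x) * momentum u x ∂Z.measure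

theorem nice_dualMomentum (hu : Z.Nice 2 u) : Z.Nice 2 (Z.dualMomentum α β u) :=
  nice_op (symbolBound_vel α β).conj (nice_momentum hu)

theorem conj_velSym (ξ : ℝ) : (starRingEnd ℂ) (velSym α β ξ) = velSym α (-β) ξ := by
  simp [velSym, hilbertSym]

/-- Two sign changes compensate: the adjoint replaces β by -β, and integration by parts gives
another minus. -/
theorem integral_deriv_momentum_mul_dual (hu : Z.Nice 2 u) :
    ∫ x, deriv (momentum u) x * Z.dualMomentum α β u x ∂Z.measure
      = (β : ℂ) * (Z.hsq (momentum u) : ℂ) := by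
  have hJ := nice_momentum hu
  have hH := nice_op symbolBound_hilbert hJ
  rw [integral_deriv_mul hJ.two (nice_dualMomentum hu)]
  have e : deriv (Z.dualMomentum α β u) = Z.op (velSym α (-β)) (deriv (momentum u)) := by
    rw [← deriv_op (symbolBound_vel α (-β)) hJ]
    simp only [Domain.dualMomentum, conj_velSym]
  rw [e, integral_mul_vel_deriv hJ (isReal_momentum u)]
  push_cast; ring

theorem isReal_dtDensity (hu : Z.Nice 2 u) : IsReal (Z.dtDensity α β u) := by
  intro x
  rw [← conj_mul_dtU hu]
  simp only [map_add, map_mul, Complex.conj_conj]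
  ring

theorem integral_op_dtDensity_mul (hu : Z.Nice 2 u) :
    ∫ x, Z.op (velSym α β) (Z.dtDensity α β u) x * momentum u x ∂Z.measure
      = -2 * ((β : ℂ) * (Z.hsq (momentum u) : ℂ))
        + ∫ x, Z.flux α β u x * Z.dualMomentum α β u x ∂Z.measure := by
  have hr : IsReal (Z.op (velSym α β) (Z.dtDensity α β u)) :=
    isReal_op (fun ξ => velSym_neg ξ) (isReal_dtDensity hu)
  rw [← integral_conj_mul_of_isReal hr, integral_conj_op_mul (symbolBound_vel α β)
    (nice_dtDensity hu) (nice_momentum hu), integral_conj_mul_of_isReal (isReal_dtDensity hu)]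
  change ∫ x, Z.dtDensity α β u x * Z.dualMomentum α β u x ∂Z.measure = _
  have hW := nice_dualMomentum (α := α) (β := β) hu
  have e : ∀ x, Z.dtDensity α β u x * Z.dualMomentum α β u x
      = (-2) * (deriv (momentum u) x * Z.dualMomentum α β u x)
        + Z.flux α β u x * Z.dualMomentum α β u x := fun x => by rw [Domain.dtDensity]; ring
  simp only [e]
  rw [integral_add (((nice_momentum hu).two.deriv.mul hW).integrable.const_mul _)
    ((nice_flux hu).two.mul hW).integrable, integral_const_mul,
    integral_deriv_momentum_mul_dual hu]

/-- Two integrations by parts turn ½∫ Vρₓₓₓ into ½∫ Vₓₓρₓ, which is dissipative; -2∫ V(|uₓ|²)ₓ gives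
the multiple 2 of the integral to be cancelled. -/
theorem integral_vel_mul_dtMomentum (hu : Z.Nice 2 u) :
    ∫ x, Z.vel α β u x * Z.dtMomentum α β u x ∂Z.measure
      = (1 / 2) * ((β : ℂ) * (Z.hsq (deriv (density u)) : ℂ))
        + 2 * (∫ x, deriv (Z.vel α β u) x * density (deriv u) x ∂Z.measure)
        + ∫ x, (Z.vel α β u x * deriv (Z.vel α β u) x) * momentum u x ∂Z.measure := by
  have hV := nice_vel (α := α) (β := β) hu
  have hρ := (nice_density hu).two
  have he := (nice_density hu.deriv).two
  have hJ := (nice_momentum hu).two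
  have hVV := (hV.mul hV).two
  have h1 := integral_deriv_mul hV hρ.deriv.deriv
  have h2 := integral_deriv_mul hV.deriv hρ.deriv
  have h3 := integral_deriv_mul hV he
  have h4 := integral_deriv_mul hVV hJ
  have e4 : ∫ x, deriv (fun x => Z.vel α β u x * Z.vel α β u x) x * momentum u x ∂Z.measure
      = 2 * ∫ x, (Z.vel α β u x * deriv (Z.vel α β u) x) * momentum u x ∂Z.measure := by
    rw [← integral_const_mul, deriv_mul_eq hV hV]
    congr 1; ext x; ring
  have e : ∀ x, Z.vel α β u x * Z.dtMomentum α β u x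
      = (1 / 2) * (Z.vel α β u x * deriv (deriv (deriv (density u))) x)
        + ((-2) * (Z.vel α β u x * deriv (density (deriv u)) x)
        + (3 * ((Z.vel α β u x * deriv (Z.vel α β u) x) * momentum u x)
        + (Z.vel α β u x * Z.vel α β u x) * deriv (momentum u) x)) := fun x => by
    rw [Domain.dtMomentum]; ring
  simp only [e]
  have i1 := (hV.mul hρ.deriv.deriv.deriv).integrable.const_mul (1 / 2)
  have i2 := (hV.mul he.deriv).integrable.const_mul (-2)
  have i3 := ((hV.mul hV.deriv).two.mul hJ).integrable.const_mul 3
  have i4 := (hVV.mul hJ.deriv).integrable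
  rw [integral_add_four i1 i2 i3 i4, integral_const_mul, integral_const_mul, integral_const_mul]
  rw [integral_deriv_deriv_vel_mul hu] at h2
  rw [e4] at h4
  linear_combination (1 / 2) * h1 - (1 / 2) * h2 - 2 * h3 + h4

/-- The derivative of ∫ VJ. It contains ∫ Vₓ|uₓ|² twice, against three times for ‖uₓ‖², which forces
the weight 3/2 in the energy. -/
theorem integral_dt_vel_mul_momentum (hu : Z.Nice 2 u) :
    ∫ x, Z.op (velSym α β) (Z.dtDensity α β u) x * momentum u x ∂Z.measure
      + ∫ x, Z.vel α β u x * Z.dtMomentum α β u x ∂Z.measure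
      = -2 * ((β : ℂ) * (Z.hsq (momentum u) : ℂ))
        + (1 / 2) * ((β : ℂ) * (Z.hsq (deriv (density u)) : ℂ))
        + 2 * (∫ x, deriv (Z.vel α β u) x * density (deriv u) x ∂Z.measure)
        + Z.remainder α β u := by
  rw [integral_op_dtDensity_mul hu, integral_vel_mul_dtMomentum hu, Domain.remainder]
  ring

end

end KDNLS

/-! ### The remainder: splitting off means and estimating trilinear terms. -/

namespace KDNLS

noncomputable section

variable {Z : Domain} {f g h m m' m'' : ℝ → ℂ} {C C' C'' : ℝ} {α β : ℝ} {u : ℝ → ℂ}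

theorem norm_integral_op_mul_op_deriv_le (hm : SymbolBound C m) (hm' : SymbolBound C' m')
    (hs : ∀ ξ, m (-ξ) = (starRingEnd ℂ) (m ξ)) (hr : IsReal f)
    (hf : Z.Nice 1 f) (hg : Z.Nice 1 g) :
    ‖∫ x, Z.op m f x * Z.op m' (deriv g) x ∂Z.measure‖ ≤ C * C' * (√(Z.hsq f) * √(Z.hsq g)) := by
  rw [← integral_conj_mul_of_isReal (isReal_op hs hr)]
  exact norm_integral_conj_op_mul_op_deriv_le hm hm' hf hg

/-- Agmon's inequality on the first factor and L² on the other two. The two factors without a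
derivative need symbols vanishing at 0. -/
theorem norm_integral_op_mul_op_deriv_mul_op_le (hm : SymbolBound C m) (hm' : SymbolBound C' m')
    (hm'' : SymbolBound C'' m'') (h0 : m 0 = 0) (h0'' : m'' 0 = 0)
    (hf : Z.Nice 1 f) (hg : Z.Nice 1 g) (hh : Z.Nice 1 h) :
    ‖∫ x, Z.op m f x * (Z.op m' (deriv g) x * Z.op m'' h x) ∂Z.measure‖
      ≤ C * C' * C'' * (√(Z.l2Norm (Z.op oscSym f) * Z.l2Norm (deriv f)) * Z.l2Norm (deriv g)
        * Z.l2Norm (Z.op oscSym h)) := by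
  have n1 := nice_op hm hf
  have n2 := nice_op hm' hg.deriv
  have n3 := nice_op hm'' hh
  have hC := hm.nonneg
  have hC' := hm'.nonneg
  have b : ∀ x, ‖Z.op m f x‖ ≤ C * √(Z.l2Norm (Z.op oscSym f) * Z.l2Norm (deriv f)) := fun x => by
    refine (sq_le_sq₀ (norm_nonneg _) (by positivity)).1 ?_
    rw [mul_pow, Real.sq_sqrt (mul_nonneg (l2Norm_nonneg _) (l2Norm_nonneg _))]
    exact sq_norm_op_le hm h0 hf x
  refine (norm_integral_le_integral_norm _).trans ?_
  calc ∫ x, ‖Z.op m f x * (Z.op m' (deriv g) x * Z.op m'' h x)‖ ∂Z.measure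
      ≤ ∫ x, C * √(Z.l2Norm (Z.op oscSym f) * Z.l2Norm (deriv f))
          * ‖Z.op m' (deriv g) x * Z.op m'' h x‖ ∂Z.measure := by
        refine integral_mono (n1.mul (n2.mul n3).two).integrable.norm
          ((n2.mul n3).integrable.norm.const_mul _) fun x => ?_
        simp only
        rw [norm_mul (Z.op m f x)]
        gcongr
        exact b x
    _ = C * √(Z.l2Norm (Z.op oscSym f) * Z.l2Norm (deriv f))
          * ∫ x, ‖Z.op m' (deriv g) x * Z.op m'' h x‖ ∂Z.measure := integral_const_mul _ _
    _ ≤ C * √(Z.l2Norm (Z.op oscSym f) * Z.l2Norm (deriv f))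
          * ((C' * Z.l2Norm (deriv g)) * (C'' * Z.l2Norm (Z.op oscSym h))) := by
        gcongr
        refine (integral_norm_mul_le n2.memLp_self n3.memLp_self).trans ?_
        have := l2Norm_nonneg (Z := Z) (deriv g)
        gcongr
        · exact l2Norm_nonneg _
        · exact l2Norm_op_le hm' hg.deriv
        · exact l2Norm_op_le_osc hm'' h0'' hh
    _ = _ := by ring

theorem velSym_zero : velSym α β 0 = α := by simp [velSym, hilbertSym]

theorem oscSym_zero : oscSym 0 = 0 := if_pos rfl

/-- The velocity with its mean removed. -/
def Domain.oscVel (Z : Domain) (α β : ℝ) (u : ℝ → ℂ) : ℝ → ℂ :=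
  Z.op (fun ξ => velSym α β ξ * oscSym ξ) (density u)

/-- The dual momentum with its mean removed. -/
def Domain.oscDualMomentum (Z : Domain) (α β : ℝ) (u : ℝ → ℂ) : ℝ → ℂ :=
  Z.op (fun ξ => (starRingEnd ℂ) (velSym α β ξ) * oscSym ξ) (momentum u)

theorem vel_eq_mean_add (hu : Z.Nice 2 u) (x : ℝ) :
    Z.vel α β u x = α * Z.mean (density u) + Z.oscVel α β u x := by
  rw [Domain.vel, op_eq_mean_add (symbolBound_vel α β) (nice_density hu), velSym_zero]
  rfl

theorem dualMomentum_eq_mean_add (hu : Z.Nice 2 u) (x : ℝ) :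
    Z.dualMomentum α β u x = α * Z.mean (momentum u) + Z.oscDualMomentum α β u x := by
  rw [Domain.dualMomentum, op_eq_mean_add (symbolBound_vel α β).conj (nice_momentum hu),
    velSym_zero, Complex.conj_ofReal]
  rfl

theorem norm_add_three_le {a b c : ℂ} {A B D : ℝ} (ha : ‖a‖ ≤ A) (hb : ‖b‖ ≤ B) (hc : ‖c‖ ≤ D) :
    ‖a + (b + c)‖ ≤ A + (B + D) :=
  (norm_add_le _ _).trans (add_le_add ha ((norm_add_le _ _).trans (add_le_add hb hc)))

theorem norm_mul_le_of_le' {a b : ℂ} {A B : ℝ} (ha : ‖a‖ ≤ A) (hb : ‖b‖ ≤ B) :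
    ‖a * b‖ ≤ A * B := by
  rw [norm_mul]
  have := (norm_nonneg _).trans ha
  gcongr

/-- Every undifferentiated factor is split into mean and oscillation. A term with a mean reduces to
a bilinear Ḣ^{1/2} pairing of a function with a derivative; fully oscillating terms are trilinear.
On the line the means are zero. -/
theorem norm_remainder_le (hu : Z.Nice 2 u) :
    ‖Z.remainder α β u‖ ≤ 4 * (|α| + |β|) ^ 2 *
      (√(Z.l2Norm (Z.op oscSym (density u)) * Z.l2Norm (deriv (density u)))
          * Z.l2Norm (deriv (density u)) * Z.l2Norm (Z.op oscSym (momentum u))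
        + ‖Z.mean (momentum u)‖ * Z.hsq (density u)
        + ‖Z.mean (density u)‖ * (√(Z.hsq (density u)) * √(Z.hsq (momentum u)))) := by
  have hρ := nice_density hu
  have hJ := nice_momentum hu
  have rρ := isReal_density u
  have rJ := isReal_momentum u
  have sa := symbolBound_vel α β
  have sb := sa.conj
  have so := symbolBound_osc
  have s1 := symbolBound_one
  have sao := sa.mul so
  have sbo := sb.mul so
  have hL : 0 ≤ |α| + |β| := sa.nonneg
  have hαL : ‖(α : ℂ)‖ ≤ |α| + |β| := by
    rw [Complex.norm_real, Real.norm_eq_abs]; linarith [abs_nonneg β]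
  have ya := fun ξ => velSym_neg (α := α) (β := β) ξ
  have yb : ∀ ξ, (starRingEnd ℂ) (velSym α β (-ξ))
      = (starRingEnd ℂ) ((starRingEnd ℂ) (velSym α β ξ)) := fun ξ => by rw [ya]
  have yo := oscSym_neg
  have yao : ∀ ξ, velSym α β (-ξ) * oscSym (-ξ)
      = (starRingEnd ℂ) (velSym α β ξ * oscSym ξ) := fun ξ => by rw [ya, yo, map_mul]
  have y1 : ∀ ξ : ℝ, (1 : ℂ) = (starRingEnd ℂ) 1 := fun ξ => by simp
  have hB := hsq_nonneg (Z := Z) (density u)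
  have sB : √(Z.hsq (density u)) * √(Z.hsq (density u)) = Z.hsq (density u) :=
    Real.mul_self_sqrt hB
  have z1 : velSym α β 0 * oscSym 0 = 0 := by rw [oscSym_zero, mul_zero]
  have z2 : (starRingEnd ℂ) (velSym α β 0) * oscSym 0 = 0 := by rw [oscSym_zero, mul_zero]
  have eV := deriv_vel (α := α) (β := β) hu
  have o1 : Z.op (fun _ => 1) (deriv (density u)) = deriv (density u) := op_one hρ.deriv
  have oJ : Z.op (fun _ => 1) (momentum u) = momentum u := op_one hJ
  -- the three pairings with the mean of the density
  have p1 := norm_integral_op_mul_op_deriv_le sb sa yb rJ hJ hρ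
  have p2 := norm_integral_op_mul_op_deriv_le sb s1 yb rJ hJ hρ
  have p3 := norm_integral_op_mul_op_deriv_le s1 sa y1 rJ hJ hρ
  -- the three pairings with the mean of the momentum
  have q1 := norm_integral_op_mul_op_deriv_le so sa yo rρ hρ hρ
  have q2 := norm_integral_op_mul_op_deriv_le sao s1 yao rρ hρ hρ
  have q3 := norm_integral_op_mul_op_deriv_le sao sa yao rρ hρ hρ
  -- the oscillating trilinear terms
  have t1 := norm_integral_op_mul_op_deriv_mul_op_le so sa sbo oscSym_zero z2 hρ hρ hJ
  have t2 := norm_integral_op_mul_op_deriv_mul_op_le sao s1 sbo z1 z2 hρ hρ hJ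
  have t3 := norm_integral_op_mul_op_deriv_mul_op_le sao sa so z1 oscSym_zero hρ hρ hJ
  rw [o1] at p2 q2 t2
  rw [oJ] at p3
  rw [← eV] at p1 p3 q1 q3 t1 t3
  rw [sB] at q1 q2 q3
  have nV := nice_vel (α := α) (β := β) hu
  have nOV : Z.Nice 2 (Z.oscVel α β u) := nice_op sao hρ
  have nOW : Z.Nice 2 (Z.oscDualMomentum α β u) := nice_op sbo hJ
  have nOρ := nice_op so hρ
  have nOJ := nice_op so hJ
  have nW := nice_dualMomentum (α := α) (β := β) hu
  change ‖∫ x, Z.dualMomentum α β u x * _ ∂_‖ ≤ _ at p1 p2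
  change ‖∫ x, Z.oscVel α β u x * _ ∂_‖ ≤ _ at q2 q3
  change ‖∫ x, _ * (_ * Z.oscDualMomentum α β u x) ∂_‖ ≤ _ at t1
  change ‖∫ x, Z.oscVel α β u x * (_ * Z.oscDualMomentum α β u x) ∂_‖ ≤ _ at t2
  change ‖∫ x, Z.oscVel α β u x * _ ∂_‖ ≤ _ at t3
  set V := Z.vel α β u
  set V' := deriv V
  set W := Z.dualMomentum α β u
  set V₀ := Z.oscVel α β u
  set W₀ := Z.oscDualMomentum α β u
  set ρ := density u with hρdef
  set ρ' := deriv ρ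
  set J := momentum u
  set ρ₀ := Z.op oscSym ρ
  set J₀ := Z.op oscSym J
  set k := Z.mean ρ
  set j := Z.mean J
  have ip1 : Integrable (fun x => 2 * (W x * V' x)) Z.measure :=
    (nW.mul nV.deriv).integrable.const_mul _
  have ip2 : Integrable (fun x => α * (W x * ρ' x)) Z.measure :=
    (nW.mul hρ.two.deriv).integrable.const_mul _
  have ip3 : Integrable (fun x => α * (J x * V' x)) Z.measure :=
    (hJ.two.mul nV.deriv).integrable.const_mul _
  have iq1 : Integrable (fun x => (α * 2) * (ρ₀ x * V' x)) Z.measure :=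
    (nOρ.mul nV.deriv).integrable.const_mul _
  have iq2 : Integrable (fun x => α * (V₀ x * ρ' x)) Z.measure :=
    (nOV.mul hρ.two.deriv).integrable.const_mul _
  have iq3 : Integrable (fun x => V₀ x * V' x) Z.measure := (nOV.mul nV.deriv).integrable
  have it1 : Integrable (fun x => 2 * (ρ₀ x * (V' x * W₀ x))) Z.measure :=
    (nOρ.mul (nV.deriv.mul nOW).two).integrable.const_mul _
  have it2 : Integrable (fun x => V₀ x * (ρ' x * W₀ x)) Z.measure :=
    (nOV.mul (hρ.two.deriv.mul nOW).two).integrable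
  have it3 : Integrable (fun x => V₀ x * (V' x * J₀ x)) Z.measure :=
    (nOV.mul (nV.deriv.mul nOJ).two).integrable
  have ip : Integrable (fun x => k * (2 * (W x * V' x) + (α * (W x * ρ' x) + α * (J x * V' x))))
      Z.measure := (ip1.add (ip2.add ip3)).const_mul k
  have iq : Integrable (fun x => j * ((α * 2) * (ρ₀ x * V' x) + (α * (V₀ x * ρ' x) + V₀ x * V' x)))
      Z.measure := (iq1.add (iq2.add iq3)).const_mul j
  have it : Integrable (fun x => 2 * (ρ₀ x * (V' x * W₀ x)) + (V₀ x * (ρ' x * W₀ x)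
      + V₀ x * (V' x * J₀ x))) Z.measure := it1.add (it2.add it3)
  -- Nine integrals: three with the mean k of ρ, three with the mean j of J, three purely
  -- oscillating. Some factors are left unsplit, so that no product of two means occurs.
  have key : Z.remainder α β u
      = k * (2 * (∫ x, W x * V' x ∂Z.measure)
          + (α * (∫ x, W x * ρ' x ∂Z.measure) + α * ∫ x, J x * V' x ∂Z.measure))
        + (j * ((α * 2) * (∫ x, ρ₀ x * V' x ∂Z.measure)
          + (α * (∫ x, V₀ x * ρ' x ∂Z.measure) + ∫ x, V₀ x * V' x ∂Z.measure))
        + (2 * (∫ x, ρ₀ x * (V' x * W₀ x) ∂Z.measure)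
          + ((∫ x, V₀ x * (ρ' x * W₀ x) ∂Z.measure) + ∫ x, V₀ x * (V' x * J₀ x) ∂Z.measure))) := by
    rw [← integral_const_mul 2 (fun x => W x * V' x), ← integral_const_mul (α : ℂ) (fun x => W x * ρ' x),
      ← integral_const_mul (α : ℂ) (fun x => J x * V' x),
      ← integral_const_mul (α * 2 : ℂ) (fun x => ρ₀ x * V' x),
      ← integral_const_mul (α : ℂ) (fun x => V₀ x * ρ' x),
      ← integral_const_mul 2 (fun x => ρ₀ x * (V' x * W₀ x)),
      ← integral_add_three ip1 ip2 ip3, ← integral_add_three iq1 iq2 iq3,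
      ← integral_add_three it1 it2 it3, ← integral_const_mul, ← integral_const_mul,
      ← integral_add_three ip iq it, Domain.remainder,
      ← integral_add ((nice_flux hu).two.mul nW).integrable
        ((nV.mul nV.deriv).two.mul hJ.two).integrable]
    congr 1
    ext x
    have e1 : V x = α * k + V₀ x := vel_eq_mean_add hu x
    have e2 : W x = α * j + W₀ x := dualMomentum_eq_mean_add hu x
    have e3 : ρ x = k + ρ₀ x := eq_mean_add_osc hρ x
    have e4 : J x = j + J₀ x := eq_mean_add_osc hJ x
    change (2 * (V' x * ρ x) + V x * ρ' x) * W x + V x * V' x * J x = _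
    rw [e1, e3, e4, e2]
    ring
  rw [key]
  have n2 : ‖(2 : ℂ)‖ ≤ 2 := by simp
  refine (norm_add_three_le
    (norm_mul_le_of_le' le_rfl (norm_add_three_le (norm_mul_le_of_le' n2 p1)
      (norm_mul_le_of_le' hαL p2) (norm_mul_le_of_le' hαL p3)))
    (norm_mul_le_of_le' le_rfl (norm_add_three_le
      (norm_mul_le_of_le' (norm_mul_le_of_le' hαL n2) q1) (norm_mul_le_of_le' hαL q2) q3))
    (norm_add_three_le (norm_mul_le_of_le' n2 t1) t2 t3)).trans (le_of_eq ?_)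
  ring

end

end KDNLS

/-! ### Estimates of density and momentum by the mass and the size. -/

namespace KDNLS

noncomputable section

variable {Z : Domain} {f : ℝ → ℂ} {α β : ℝ} {u : ℝ → ℂ}

/-- The weight of the `L²` norm in the energy: no weight on the line. -/
def Domain.massWeight : Domain → ℝ
  | .line => 0
  | .torus => 1

theorem massWeight_nonneg (Z : Domain) : 0 ≤ Z.massWeight := by
  cases Z <;> simp [Domain.massWeight]

theorem atom_le_massWeight (Z : Domain) : Z.atom ≤ Z.massWeight := by
  cases Z
  · simp [Domain.massWeight, atom_line]
  · exact atom_le_one _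

theorem massWeight_sq (Z : Domain) : Z.massWeight ^ 2 = Z.massWeight := by
  cases Z <;> simp [Domain.massWeight]

/-- The leading part of the energy: `‖uₓ‖²` on the line and `‖u‖_{H¹}²` on the torus. -/
def Domain.size (Z : Domain) (u : ℝ → ℂ) : ℝ :=
  Z.massWeight * Z.l2Norm u ^ 2 + Z.l2Norm (deriv u) ^ 2

theorem dataNorm_sq (Z : Domain) (u : ℝ → ℂ) : Z.dataNorm u ^ 2 = Z.size u := by
  cases Z
  · simp [Domain.dataNorm, Domain.size, Domain.massWeight]
  · simp only [Domain.dataNorm, Domain.size, Domain.massWeight, Domain.h1Norm]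
    rw [Real.sq_sqrt (by positivity), one_mul]

theorem dataNorm_nonneg (Z : Domain) (u : ℝ → ℂ) : 0 ≤ Z.dataNorm u := by
  cases Z
  · exact l2Norm_nonneg _
  · exact Real.sqrt_nonneg _

theorem l2Norm_deriv_le_dataNorm (Z : Domain) (u : ℝ → ℂ) : Z.l2Norm (deriv u) ≤ Z.dataNorm u := by
  refine (sq_le_sq₀ (l2Norm_nonneg _) (dataNorm_nonneg _ _)).1 ?_
  rw [dataNorm_sq, Domain.size]
  nlinarith [massWeight_nonneg Z, sq_nonneg (Z.l2Norm u)]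

theorem atom_mul_le_dataNorm (Z : Domain) (u : ℝ → ℂ) : Z.atom * Z.l2Norm u ≤ Z.dataNorm u := by
  refine (sq_le_sq₀ (mul_nonneg (atom_nonneg Z) (l2Norm_nonneg _)) (dataNorm_nonneg _ _)).1 ?_
  rw [dataNorm_sq, Domain.size, mul_pow, ← massWeight_sq]
  have h := pow_le_pow_left₀ (atom_nonneg Z) (atom_le_massWeight Z) 2
  have := mul_le_mul_of_nonneg_right h (sq_nonneg (Z.l2Norm u))
  nlinarith [sq_nonneg (Z.l2Norm (deriv u))]

theorem supSq_le_dataNorm (hu : Z.Nice 2 u) : supSq u ≤ 4 * (Z.l2Norm u * Z.dataNorm u) := by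
  have h := supSq_le hu
  have h1 := mul_le_mul_of_nonneg_left (atom_mul_le_dataNorm Z u) (l2Norm_nonneg (Z := Z) u)
  have h2 := mul_le_mul_of_nonneg_left (l2Norm_deriv_le_dataNorm Z u) (l2Norm_nonneg (Z := Z) u)
  nlinarith

theorem sq_l2Norm_density_le (hu : Z.Nice 2 u) :
    Z.l2Norm (density u) ^ 2 ≤ supSq u * Z.l2Norm u ^ 2 := by
  have h := pow_le_pow_left₀ (l2Norm_nonneg _) (l2Norm_density_le hu) 2
  rwa [mul_pow, Real.sq_sqrt (supSq_nonneg u)] at h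

theorem sq_l2Norm_density_le_dataNorm (hu : Z.Nice 2 u) :
    Z.l2Norm (density u) ^ 2 ≤ 4 * (Z.l2Norm u ^ 3 * Z.dataNorm u) := by
  refine (sq_l2Norm_density_le hu).trans ?_
  have := mul_le_mul_of_nonneg_right (supSq_le_dataNorm hu) (sq_nonneg (Z.l2Norm u))
  linarith

theorem l2Norm_osc_density_le (hu : Z.Nice 2 u) :
    Z.l2Norm (Z.op oscSym (density u)) ≤ Z.l2Norm (density u) := by
  simpa using l2Norm_op_le symbolBound_osc (nice_density hu)

theorem sq_l2Norm_osc_density_le (hu : Z.Nice 2 u) :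
    Z.l2Norm (Z.op oscSym (density u)) ^ 2 ≤ 2 * Z.l2Norm u ^ 2 * √(Z.hsq (density u)) := by
  have h := sq_l2Norm_osc_le (nice_density hu)
  rwa [integral_norm_density hu] at h

theorem sq_l2Norm_osc_momentum_le (hu : Z.Nice 2 u) :
    Z.l2Norm (Z.op oscSym (momentum u)) ^ 2
      ≤ 2 * (Z.l2Norm u * Z.l2Norm (deriv u)) * √(Z.hsq (momentum u)) := by
  refine (sq_l2Norm_osc_le (nice_momentum hu)).trans ?_
  gcongr
  exact integral_norm_momentum_le hu

/-- The atom is spent on ‖u‖, which it bounds by the data norm; on the line both sides of that step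
are compatible because the atom is 0. -/
theorem norm_mean_momentum_le (hu : Z.Nice 2 u) :
    ‖Z.mean (momentum u)‖ ≤ Z.dataNorm u ^ 2 := by
  refine (norm_mean_le _).trans ?_
  calc Z.atom * ∫ x, ‖momentum u x‖ ∂Z.measure
      ≤ Z.atom * (Z.l2Norm u * Z.l2Norm (deriv u)) := by
        gcongr
        · exact atom_nonneg Z
        · exact integral_norm_momentum_le hu
    _ = (Z.atom * Z.l2Norm u) * Z.l2Norm (deriv u) := by ring
    _ ≤ Z.dataNorm u * Z.dataNorm u := by
        have := dataNorm_nonneg Z u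
        gcongr
        · exact l2Norm_nonneg _
        · exact atom_mul_le_dataNorm Z u
        · exact l2Norm_deriv_le_dataNorm Z u
    _ = _ := by ring

theorem norm_mean_density_le (hu : Z.Nice 2 u) :
    ‖Z.mean (density u)‖ ≤ Z.l2Norm u * Z.dataNorm u := by
  refine (norm_mean_le _).trans ?_
  rw [integral_norm_density hu]
  have := mul_le_mul_of_nonneg_left (atom_mul_le_dataNorm Z u) (l2Norm_nonneg (Z := Z) u)
  linarith

theorem norm_integral_momentum_mul_deriv_density_le (hu : Z.Nice 2 u) :
    ‖∫ x, momentum u x * deriv (density u) x ∂Z.measure‖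
      ≤ √(Z.hsq (momentum u)) * √(Z.hsq (density u)) := by
  have h := norm_integral_op_mul_op_deriv_le symbolBound_one symbolBound_one (fun ξ => by simp)
    (isReal_momentum u) (nice_momentum hu) (nice_density hu)
  rwa [op_one (nice_momentum hu), op_one (nice_density hu).deriv, one_mul, one_mul] at h

theorem norm_integral_hilbert_mul_sq_density_le (hu : Z.Nice 2 u) :
    ‖∫ x, Z.op hilbertSym (deriv (density u)) x * (density u x * density u x) ∂Z.measure‖
      ≤ 2 * (‖Z.mean (density u)‖ * Z.hsq (density u))
        + √(Z.l2Norm (Z.op oscSym (density u)) * Z.l2Norm (deriv (density u)))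
          * Z.l2Norm (deriv (density u)) * Z.l2Norm (Z.op oscSym (density u)) := by
  have hρ := nice_density hu
  have sB : √(Z.hsq (density u)) * √(Z.hsq (density u)) = Z.hsq (density u) :=
    Real.mul_self_sqrt (hsq_nonneg _)
  have p1 := norm_integral_op_mul_op_deriv_le symbolBound_one symbolBound_hilbert (fun ξ => by simp)
    (isReal_density u) hρ hρ
  have p2 := norm_integral_op_mul_op_deriv_le symbolBound_osc symbolBound_hilbert oscSym_neg
    (isReal_density u) hρ hρ
  have p3 := norm_integral_op_mul_op_deriv_mul_op_le symbolBound_osc symbolBound_hilbert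
    symbolBound_osc oscSym_zero oscSym_zero hρ hρ hρ
  rw [op_one hρ, sB] at p1
  rw [sB] at p2
  have nH := nice_op symbolBound_hilbert hρ.deriv
  have nO := nice_op symbolBound_osc hρ
  set ρ := density u
  set H := Z.op hilbertSym (deriv ρ)
  set ρ₀ := Z.op oscSym ρ
  have e : ∫ x, H x * (ρ x * ρ x) ∂Z.measure
      = Z.mean ρ * (∫ x, ρ x * H x ∂Z.measure) + (Z.mean ρ * (∫ x, ρ₀ x * H x ∂Z.measure)
        + ∫ x, ρ₀ x * (H x * ρ₀ x) ∂Z.measure) := by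
    rw [← integral_const_mul, ← integral_const_mul, ← integral_add_three
      ((hρ.two.mul nH).integrable.const_mul _) ((nO.mul nH).integrable.const_mul _)
      (nO.mul (nH.mul nO).two).integrable]
    congr 1
    ext x
    have e3 : ρ x = Z.mean ρ + ρ₀ x := eq_mean_add_osc hρ x
    rw [e3]; ring
  rw [e]
  refine (norm_add_three_le (norm_mul_le_of_le' le_rfl p1) (norm_mul_le_of_le' le_rfl p2) p3).trans
    (le_of_eq ?_)
  ring

/-- With r = ‖ρ - mean‖ and y = ‖ρₓ‖: B ≤ r y, r² ≤ 2‖u‖²√B and y² ≤ √B√A. Multiplying leaves a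
factor B on the right, which can be cancelled. -/
theorem hsq_density_sq_le (hu : Z.Nice 2 u) :
    Z.hsq (density u) ^ 2 ≤ 2 * Z.l2Norm u ^ 2 * Z.hsq (density u) * √(Z.hsq (deriv (density u))) := by
  have h1 := pow_le_pow_left₀ (hsq_nonneg _) (hsq_le (nice_density hu)) 2
  rw [mul_pow] at h1
  have h2 := sq_l2Norm_osc_density_le hu
  have h3 := sq_l2Norm_deriv_le (nice_density hu)
  have h4 := mul_le_mul h2 h3 (sq_nonneg _) (by positivity)
  have h5 : √(Z.hsq (density u)) * √(Z.hsq (density u)) = Z.hsq (density u) :=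
    Real.mul_self_sqrt (hsq_nonneg _)
  refine h1.trans (h4.trans (le_of_eq ?_))
  rw [← h5, Real.sqrt_mul_self (Real.sqrt_nonneg _)]
  ring

/-- The dissipation rate is controlled by the mass and the smoothing norm. -/
theorem hsq_density_le_mass_mul (hu : Z.Nice 2 u) :
    Z.hsq (density u) ≤ 2 * Z.l2Norm u ^ 2 * √(Z.hsq (deriv (density u))) := by
  rcases (hsq_nonneg (Z := Z) (density u)).eq_or_lt with h | h
  · rw [← h]; positivity
  · refine le_of_mul_le_mul_left ?_ h
    have := hsq_density_sq_le hu
    nlinarith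

theorem norm_integral_vel_mul_momentum_le (hu : Z.Nice 2 u) :
    ‖∫ x, Z.vel α β u x * momentum u x ∂Z.measure‖
      ≤ (|α| + |β|) * (Z.l2Norm (density u) * (√(supSq u) * Z.l2Norm (deriv u))) := by
  refine (norm_integral_mul_le (nice_vel hu).memLp_self (nice_momentum hu).two.memLp_self).trans ?_
  rw [← mul_assoc]
  have := l2Norm_nonneg (Z := Z) (density u)
  have hL := (symbolBound_vel α β).nonneg
  gcongr
  · exact l2Norm_nonneg _
  · exact l2Norm_op_le (symbolBound_vel α β) (nice_density hu)
  · exact l2Norm_momentum_le hu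

/-- Young's inequality for s ≤ A^{j/8}Y^{k/8}; the eighth power clears the fractional exponents of
all the remainders. If s exceeded w = εA + Y/ε², then A ≤ w/ε and Y ≤ ε²w would give s⁸ ≤ w⁸ε^{2k-j}
≤ w⁸. -/
theorem le_of_pow_eight_le {s A Y ε : ℝ} {j k : ℕ} (hA : 0 ≤ A) (hY : 0 ≤ Y)
    (hε : 0 < ε) (hε1 : ε ≤ 1) (hjk : j + k = 8) (hj : j ≤ 2 * k) (h : s ^ 8 ≤ A ^ j * Y ^ k) :
    s ≤ ε * A + Y / ε ^ 2 := by
  by_contra! hc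
  set w := ε * A + Y / ε ^ 2 with hw
  have hw0 : 0 ≤ w := by positivity
  have h1 : A ≤ w / ε := by
    rw [le_div_iff₀ hε, hw, mul_comm]; have : 0 ≤ Y / ε ^ 2 := by positivity
    linarith
  have h2 : Y ≤ ε ^ 2 * w := by
    have : Y / ε ^ 2 ≤ w := by rw [hw]; have : 0 ≤ ε * A := by positivity
                               linarith
    rw [div_le_iff₀ (by positivity)] at this; linarith
  have h3 : A ^ j * Y ^ k ≤ w ^ 8 := by
    calc A ^ j * Y ^ k ≤ (w / ε) ^ j * (ε ^ 2 * w) ^ k := by gcongr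
      _ = w ^ (j + k) * (ε ^ (2 * k) / ε ^ j) := by
          rw [div_pow, mul_pow, ← pow_mul, pow_add]; ring
      _ = w ^ 8 * ε ^ (2 * k - j) := by rw [hjk, pow_sub₀ ε hε.ne' hj, div_eq_mul_inv]
      _ ≤ w ^ 8 * 1 := by gcongr; exact pow_le_one₀ hε.le hε1
      _ = w ^ 8 := mul_one _
  have h4 : w ^ 8 < s ^ 8 := pow_lt_pow_left₀ hc hw0 (by norm_num)
  linarith

end

end KDNLS

/-! ### Young's inequalities for the remainders, and the energy. -/

namespace KDNLS

noncomputable section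

variable {Z : Domain} {f : ℝ → ℂ} {α β : ℝ} {u : ℝ → ℂ}

theorem le_one_add_cube {a : ℝ} (ha : 0 ≤ a) : a ≤ 1 + a ^ 3 := by
  nlinarith [mul_nonneg ha (sq_nonneg (a - 1))]

theorem sq_le_one_add_cube {a : ℝ} (ha : 0 ≤ a) : a ^ 2 ≤ 1 + a ^ 3 := by
  nlinarith [mul_nonneg ha (sq_nonneg (a - 1)), sq_nonneg (a - 1)]

section Real

-- In the application a, b, c are the Ḣ^{1/2} seminorms of ρₓ, ρ, J; r, p are the L² norms of the
-- oscillating parts of ρ, J; y = ‖ρₓ‖, s = √(ry), ν = ‖ρ‖, μ = ‖u‖, X is the data norm and M bounds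
-- the mass.
variable {a b c r s y ν μ X p M A ε : ℝ}

/-- Young's inequality for the trilinear remainder. -/
theorem trilinear_remainder_le (hA : a ^ 2 + c ^ 2 = A) (hM : μ ^ 2 ≤ M)
    (hs : s ^ 2 = r * y) (hr : r ^ 2 ≤ ν ^ 2) (hy : y ^ 2 ≤ b * a) (hp : p ^ 2 ≤ 2 * (μ * X) * c)
    (hε : 0 < ε) (hε1 : ε ≤ 1) :
    s * y * p ≤ ε * A + 16 * ((1 + M ^ 3) * (b ^ 2 * (X ^ 2 + M * ν ^ 4))) / ε ^ 2 := by
  have hM0 : 0 ≤ M := (sq_nonneg μ).trans hM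
  have hA0 : 0 ≤ A := by rw [← hA]; positivity
  have ha2 : a ^ 2 ≤ A := by rw [← hA]; nlinarith [sq_nonneg c]
  have hc2 : c ^ 2 ≤ A := by rw [← hA]; nlinarith [sq_nonneg a]
  set G := 1 + M ^ 3 with hG
  have hG1 : 1 ≤ G := by rw [hG]; have : 0 ≤ M ^ 3 := by positivity
                         linarith
  have hMG : M ≤ G := le_one_add_cube hM0
  set W := X ^ 2 + M * ν ^ 4 with hW
  have hW1 : X ^ 2 ≤ W := by rw [hW]; have : 0 ≤ M * ν ^ 4 := by positivity
                             linarith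
  have hW2 : M * ν ^ 4 ≤ W := by rw [hW]; nlinarith [sq_nonneg X]
  have hW0 : 0 ≤ W := (sq_nonneg X).trans hW1
  -- In the eighth power a⁶c⁴ supplies A⁵ and b⁶ supplies the three factors b² of Y³; r is bounded
  -- by ν only, without interpolation.
  refine le_of_pow_eight_le hA0 (by positivity) hε hε1 (show 5 + 3 = 8 by norm_num) (by norm_num) ?_
  calc (s * y * p) ^ 8 = (s ^ 2) ^ 4 * (y ^ 2) ^ 4 * (p ^ 2) ^ 4 := by ring
    _ = (r ^ 2) ^ 2 * (y ^ 2) ^ 6 * (p ^ 2) ^ 4 := by rw [hs]; ring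
    _ ≤ (ν ^ 2) ^ 2 * (b * a) ^ 6 * (2 * (μ * X) * c) ^ 4 := by gcongr
    _ = 16 * ((a ^ 2) ^ 3 * (c ^ 2) ^ 2) * b ^ 6 * ((μ ^ 2) ^ 2 * ν ^ 4 * (X ^ 2) ^ 2) := by ring
    _ ≤ 16 * (A ^ 3 * A ^ 2) * b ^ 6 * (M ^ 2 * ν ^ 4 * (X ^ 2) ^ 2) := by gcongr
    _ = 16 * A ^ 5 * b ^ 6 * (M * (M * ν ^ 4) * (X ^ 2) ^ 2) := by ring
    _ ≤ 16 * A ^ 5 * b ^ 6 * (G * W * W ^ 2) := by gcongr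
    _ ≤ 4096 * A ^ 5 * b ^ 6 * (G * G ^ 2 * W * W ^ 2) := by
        have h : 1 ≤ G ^ 2 := one_le_pow₀ hG1
        gcongr
        · norm_num
        · nlinarith
    _ = A ^ 5 * (16 * (G * (b ^ 2 * W))) ^ 3 := by ring

/-- Young's inequality for the quartic remainder. -/
theorem quartic_remainder_le (hA : a ^ 2 ≤ A) (hM : μ ^ 2 ≤ M)
    (hs : s ^ 2 = r * y) (hr : r ^ 2 ≤ ν ^ 2) (hr' : r ^ 2 ≤ 2 * μ ^ 2 * b) (hy : y ^ 2 ≤ b * a)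
    (hε : 0 < ε) (hε1 : ε ≤ 1) :
    M * ν ^ 2 * (s * y * r) ≤ ε * A + 16 * ((1 + M ^ 3) * (b ^ 2 * (X ^ 2 + M * ν ^ 4))) / ε ^ 2 := by
  have hM0 : 0 ≤ M := (sq_nonneg μ).trans hM
  have hA0 : 0 ≤ A := (sq_nonneg a).trans hA
  set G := 1 + M ^ 3 with hG
  have hG1 : 1 ≤ G := by rw [hG]; have : 0 ≤ M ^ 3 := by positivity
                         linarith
  have hMG : M ≤ G := le_one_add_cube hM0
  have hMG2 : M ^ 3 ≤ G := by rw [hG]; linarith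
  set W := X ^ 2 + M * ν ^ 4 with hW
  have hW2 : M * ν ^ 4 ≤ W := by rw [hW]; nlinarith [sq_nonneg X]
  have hW0 : 0 ≤ W := le_trans (by positivity) hW2
  -- Here a⁶ gives A³, so Y⁵ requires b¹⁰: b⁶ comes from y¹², and four more from interpolating r⁸;
  -- the remaining r⁴ is bounded by ν⁴.
  refine le_of_pow_eight_le hA0 (by positivity) hε hε1 (show 3 + 5 = 8 by norm_num) (by norm_num) ?_
  calc (M * ν ^ 2 * (s * y * r)) ^ 8
      = M ^ 8 * ν ^ 16 * (s ^ 2) ^ 4 * (y ^ 2) ^ 4 * (r ^ 2) ^ 4 := by ring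
    _ = M ^ 8 * ν ^ 16 * (y ^ 2) ^ 6 * (r ^ 2) ^ 4 * (r ^ 2) ^ 2 := by rw [hs]; ring
    _ ≤ M ^ 8 * ν ^ 16 * (b * a) ^ 6 * (2 * μ ^ 2 * b) ^ 4 * (ν ^ 2) ^ 2 := by gcongr
    _ = 16 * M ^ 8 * ν ^ 20 * (a ^ 2) ^ 3 * b ^ 10 * (μ ^ 2) ^ 4 := by ring
    _ ≤ 16 * M ^ 8 * ν ^ 20 * A ^ 3 * b ^ 10 * M ^ 4 := by gcongr
    _ = 16 * A ^ 3 * b ^ 10 * (M * M ^ 3 * M ^ 3 * (M * ν ^ 4) ^ 5) := by ring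
    _ ≤ 16 * A ^ 3 * b ^ 10 * (G * G * G * W ^ 5) := by gcongr
    _ = 16 * A ^ 3 * b ^ 10 * (G ^ 3 * W ^ 5) := by ring
    _ ≤ 16 ^ 5 * A ^ 3 * b ^ 10 * (G ^ 5 * W ^ 5) := by
        gcongr <;> norm_num
    _ = A ^ 3 * (16 * (G * (b ^ 2 * W))) ^ 5 := by ring

theorem le_of_sq_le {Y : ℝ} (hA : 0 ≤ A) (hY : 0 ≤ Y) (hε : 0 < ε) (hε1 : ε ≤ 1)
    (h : s ^ 2 ≤ A * Y) : s ≤ ε * A + Y / ε ^ 2 := by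
  refine le_of_pow_eight_le hA hY hε hε1 (show 4 + 4 = 8 by norm_num) (by norm_num) ?_
  calc s ^ 8 = (s ^ 2) ^ 4 := by ring
    _ ≤ (A * Y) ^ 4 := by gcongr
    _ = _ := by ring

/-- The lower order remainders involving the means. -/
theorem mean_remainder_le {m j : ℝ} (hM : μ ^ 2 ≤ M)
    (hm : m ≤ μ * X) (hm0 : 0 ≤ m) (hj : j ≤ X ^ 2) (hc : c ^ 2 ≤ A) (hε : 0 < ε) (hε1 : ε ≤ 1) :
    j * b ^ 2 ≤ ε * A + 16 * ((1 + M ^ 3) * (b ^ 2 * (X ^ 2 + M * ν ^ 4))) / ε ^ 2 ∧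
    m * (b * c) ≤ ε * A + 16 * ((1 + M ^ 3) * (b ^ 2 * (X ^ 2 + M * ν ^ 4))) / ε ^ 2 ∧
    M * ν ^ 2 * (c * b) ≤ ε * A + 16 * ((1 + M ^ 3) * (b ^ 2 * (X ^ 2 + M * ν ^ 4))) / ε ^ 2 ∧
    M * ν ^ 2 * (m * b ^ 2)
      ≤ ε * A + 16 * ((1 + M ^ 3) * (b ^ 2 * (X ^ 2 + M * ν ^ 4))) / ε ^ 2 := by
  have hM0 : 0 ≤ M := (sq_nonneg μ).trans hM
  have hA0 : 0 ≤ A := (sq_nonneg c).trans hc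
  have hG1 : 1 ≤ 1 + M ^ 3 := le_add_of_nonneg_right (by positivity)
  have hMG : M ≤ 1 + M ^ 3 := le_one_add_cube hM0
  have hMG2 : M ^ 2 ≤ 1 + M ^ 3 := sq_le_one_add_cube hM0
  have hW1 : X ^ 2 ≤ X ^ 2 + M * ν ^ 4 := le_add_of_nonneg_right (by positivity)
  have hW2 : M * ν ^ 4 ≤ X ^ 2 + M * ν ^ 4 := le_add_of_nonneg_left (sq_nonneg X)
  have hG0 : 0 ≤ 1 + M ^ 3 := zero_le_one.trans hG1
  have hW0 : 0 ≤ X ^ 2 + M * ν ^ 4 := (sq_nonneg X).trans hW1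
  have e : M * ν ^ 2 * (μ * X) ≤ M ^ 2 * (M * ν ^ 4) + X ^ 2 := by
    have e2 : (M * ν ^ 2 * μ) ^ 2 ≤ M ^ 2 * (M * ν ^ 4) := by
      calc (M * ν ^ 2 * μ) ^ 2 = M ^ 2 * (μ ^ 2 * ν ^ 4) := by ring
        _ ≤ _ := by gcongr
    linarith [sq_nonneg (M * ν ^ 2 * μ - X), sq_nonneg X, sq_nonneg (M * ν ^ 2 * μ),
      show (M * ν ^ 2 * μ - X) ^ 2 = (M * ν ^ 2 * μ) ^ 2 - 2 * (M * ν ^ 2 * (μ * X)) + X ^ 2 by ring]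
  generalize X ^ 2 + M * ν ^ 4 = W at *
  generalize 1 + M ^ 3 = G at *
  have hY0 : 0 ≤ G * (b ^ 2 * W) := by positivity
  have hYε : 16 * (G * (b ^ 2 * W)) ≤ 16 * (G * (b ^ 2 * W)) / ε ^ 2 := by
    rw [le_div_iff₀ (by positivity)]
    exact mul_le_of_le_one_right (by positivity) (pow_le_one₀ hε.le hε1)
  have hεA : 0 ≤ ε * A := by positivity
  refine ⟨?_, ?_, ?_, ?_⟩
  · have : j * b ^ 2 ≤ G * (b ^ 2 * W) := by
      calc j * b ^ 2 ≤ W * b ^ 2 := by gcongr; exact hj.trans hW1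
        _ = 1 * (b ^ 2 * W) := by ring
        _ ≤ G * (b ^ 2 * W) := by gcongr
    linarith
  · refine le_of_sq_le hA0 (by positivity) hε hε1 ?_
    calc (m * (b * c)) ^ 2 = m ^ 2 * b ^ 2 * c ^ 2 := by ring
      _ ≤ (μ * X) ^ 2 * b ^ 2 * A := by gcongr
      _ = A * (μ ^ 2 * (b ^ 2 * X ^ 2)) := by ring
      _ ≤ A * (G * (b ^ 2 * W)) := by gcongr; exact hM.trans hMG
      _ ≤ A * (16 * (G * (b ^ 2 * W))) := mul_le_mul_of_nonneg_left (by linarith) hA0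
  · refine le_of_sq_le hA0 (by positivity) hε hε1 ?_
    calc (M * ν ^ 2 * (c * b)) ^ 2 = M * (b ^ 2 * (M * ν ^ 4)) * c ^ 2 := by ring
      _ ≤ G * (b ^ 2 * W) * A := by gcongr
      _ = A * (G * (b ^ 2 * W)) := by ring
      _ ≤ A * (16 * (G * (b ^ 2 * W))) := mul_le_mul_of_nonneg_left (by linarith) hA0
  · have : M * ν ^ 2 * (m * b ^ 2) ≤ 2 * (G * (b ^ 2 * W)) := by
      calc M * ν ^ 2 * (m * b ^ 2) ≤ M * ν ^ 2 * ((μ * X) * b ^ 2) := by gcongr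
        _ = b ^ 2 * (M * ν ^ 2 * (μ * X)) := by ring
        _ ≤ b ^ 2 * (M ^ 2 * (M * ν ^ 4) + X ^ 2) := by gcongr
        _ ≤ b ^ 2 * (G * W + 1 * W) := by rw [one_mul]; gcongr
        _ ≤ b ^ 2 * (G * W + G * W) := by gcongr
        _ = 2 * (G * (b ^ 2 * W)) := by ring
    linarith

theorem remainder_total_le (hM : μ ^ 2 ≤ M) (hs : s ^ 2 = r * y) (hr : r ^ 2 ≤ ν ^ 2) (hr' : r ^ 2 ≤ 2 * μ ^ 2 * b)
    (hy : y ^ 2 ≤ b * a) (hp : p ^ 2 ≤ 2 * (μ * X) * c)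
    {m j : ℝ} (hm : m ≤ μ * X) (hm0 : 0 ≤ m) (hj : j ≤ X ^ 2)
    (hε : 0 < ε) (hε1 : ε ≤ 1) {k l : ℝ} (hk : 0 ≤ k) (hl : 0 ≤ l) :
    k * (s * y * p + j * b ^ 2 + m * (b * c))
      + l * (M * ν ^ 2 * (c * b + (2 * (m * b ^ 2) + s * y * r)))
      ≤ (3 * k + 4 * l) * (ε * (a ^ 2 + c ^ 2)
        + 16 * ((1 + M ^ 3) * (b ^ 2 * (X ^ 2 + M * ν ^ 4))) / ε ^ 2) := by
  have h1 := trilinear_remainder_le rfl hM hs hr hy hp hε hε1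
  have h6 := quartic_remainder_le (X := X) (A := a ^ 2 + c ^ 2)
    (le_add_of_nonneg_right (sq_nonneg c)) hM hs hr hr' hy hε hε1
  obtain ⟨h2, h3, h4, h5⟩ := mean_remainder_le (b := b) (ν := ν) hM hm hm0 hj
    (le_add_of_nonneg_left (sq_nonneg a) : c ^ 2 ≤ a ^ 2 + c ^ 2) hε hε1
  generalize ε * (a ^ 2 + c ^ 2)
        + 16 * ((1 + M ^ 3) * (b ^ 2 * (X ^ 2 + M * ν ^ 4))) / ε ^ 2 = w at *
  have e1 : s * y * p + j * b ^ 2 + m * (b * c) ≤ 3 * w := by linarith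
  have e2 : M * ν ^ 2 * (c * b + (2 * (m * b ^ 2) + s * y * r)) ≤ 4 * w := by
    have : M * ν ^ 2 * (c * b + (2 * (m * b ^ 2) + s * y * r)) = M * ν ^ 2 * (c * b)
      + 2 * (M * ν ^ 2 * (m * b ^ 2)) + M * ν ^ 2 * (s * y * r) := by ring
    rw [this]; linarith
  calc _ ≤ k * (3 * w) + l * (4 * w) := by gcongr
    _ = _ := by ring

end Real

/-- The energy, with the mass bound `M` as a parameter. -/
def Domain.energy (Z : Domain) (α β K M : ℝ) (u : ℝ → ℂ) : ℝ :=
  -- The weight 3/2 cancels ∫ Vₓ|uₓ|²; the last term restores coercivity.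
  Z.size u - 3 / 2 * (∫ x, Z.vel α β u x * momentum u x ∂Z.measure).re
    + K * M * Z.l2Norm (density u) ^ 4

/-- The formal time derivative of the energy. -/
def Domain.dtEnergy (Z : Domain) (α β K M : ℝ) (u : ℝ → ℂ) : ℝ :=
  -- β/4 = β - (3/2)(β/2), and 3β = -(3/2)(-2β).
  Z.massWeight * (β * Z.hsq (density u)) + β / 4 * Z.hsq (deriv (density u))
    + 3 * β * Z.hsq (momentum u) - 3 / 2 * (Z.remainder α β u).re
    + 2 * K * M * Z.l2Norm (density u) ^ 2
      * (4 * (∫ x, momentum u x * deriv (density u) x ∂Z.measure).re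
        + 3 * β * (∫ x, Z.op hilbertSym (deriv (density u)) x
            * (density u x * density u x) ∂Z.measure).re)

theorem const_mul_re_le {c d : ℝ} {z : ℂ} (h : ‖z‖ ≤ d) : c * z.re ≤ |c| * d := by
  refine (le_abs_self _).trans ?_
  rw [abs_mul]
  gcongr
  exact (Complex.abs_re_le_norm z).trans h

/-- Half of the dissipation β/4 absorbs the remainders and β/8 is kept for the smoothing estimate.
Everything else has the factor B of mass dissipation, as the Grönwall argument requires. -/
theorem exists_dtEnergy_le (α : ℝ) (hβ : β < 0) {K : ℝ} (hK : 0 ≤ K) :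
    ∃ κ : ℝ, 0 ≤ κ ∧ ∀ (Z : Domain) (u : ℝ → ℂ) (M : ℝ), Z.Nice 2 u → Z.l2Norm u ^ 2 ≤ M →
      Z.dtEnergy α β K M u ≤ β / 8 * Z.hsq (deriv (density u))
        + κ * ((1 + M ^ 3) * (Z.hsq (density u) * (Z.size u + M * Z.l2Norm (density u) ^ 4))) := by
  set k := 6 * (|α| + |β|) ^ 2 with hk
  set l := 2 * K * (4 + 3 * |β|) with hl
  have hk0 : 0 ≤ k := by positivity
  have hl0 : 0 ≤ l := by positivity
  set G := 3 * k + 4 * l + 1 with hG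
  have hG0 : 0 < G := by positivity
  have hb : |β| = -β := abs_of_neg hβ
  -- Chosen so that all remainders together cost at most |β|/8 of the two dissipative terms.
  set ε := min 1 (-β / (8 * G)) with hε
  have hε0 : 0 < ε := lt_min one_pos (div_pos (neg_pos.2 hβ) (by positivity))
  have hε1 : ε ≤ 1 := min_le_left _ _
  have hεG : G * ε ≤ -β / 8 := by
    calc G * ε ≤ G * (-β / (8 * G)) := by gcongr; exact min_le_right _ _
      _ = _ := by field_simp
  refine ⟨G * (16 / ε ^ 2), by positivity, fun Z u M hu hM => ?_⟩
  have hB := hsq_nonneg (Z := Z) (density u)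
  have hA := hsq_nonneg (Z := Z) (deriv (density u))
  have hJ := hsq_nonneg (Z := Z) (momentum u)
  have hry : 0 ≤ Z.l2Norm (Z.op oscSym (density u)) * Z.l2Norm (deriv (density u)) :=
    mul_nonneg (l2Norm_nonneg _) (l2Norm_nonneg _)
  have hμ := l2Norm_nonneg (Z := Z) u
  have hM0 : 0 ≤ M := (sq_nonneg _).trans hM
  have key := remainder_total_le (a := √(Z.hsq (deriv (density u)))) (c := √(Z.hsq (momentum u)))
    (b := √(Z.hsq (density u))) (μ := Z.l2Norm u) (X := Z.dataNorm u) (M := M)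
    (s := √(Z.l2Norm (Z.op oscSym (density u)) * Z.l2Norm (deriv (density u))))
    (r := Z.l2Norm (Z.op oscSym (density u))) (y := Z.l2Norm (deriv (density u)))
    (ν := Z.l2Norm (density u)) (p := Z.l2Norm (Z.op oscSym (momentum u)))
    (m := ‖Z.mean (density u)‖) (j := ‖Z.mean (momentum u)‖)
    hM
    (Real.sq_sqrt hry) (pow_le_pow_left₀ (l2Norm_nonneg _) (l2Norm_osc_density_le hu) 2)
    (sq_l2Norm_osc_density_le hu) (sq_l2Norm_deriv_le (nice_density hu))
    (by
      refine (sq_l2Norm_osc_momentum_le hu).trans ?_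
      gcongr
      exact l2Norm_deriv_le_dataNorm Z u)
    (norm_mean_density_le hu) (norm_nonneg _) (norm_mean_momentum_le hu) hε0 hε1 hk0 hl0
  rw [Real.sq_sqrt hB, Real.sq_sqrt hA, Real.sq_sqrt hJ, dataNorm_sq] at key
  have hR := const_mul_re_le (c := -(3 / 2)) (norm_remainder_le (α := α) (β := β) hu)
  have h1 := const_mul_re_le (c := 4) (norm_integral_momentum_mul_deriv_density_le hu)
  have h2 := const_mul_re_le (c := 3 * β) (norm_integral_hilbert_mul_sq_density_le hu)
  rw [abs_neg, abs_of_pos (by norm_num : (0 : ℝ) < 3 / 2)] at hR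
  rw [abs_of_pos (by norm_num : (0 : ℝ) < 4)] at h1
  rw [abs_mul, abs_of_pos (by norm_num : (0 : ℝ) < 3)] at h2
  have hW := massWeight_nonneg Z
  rw [Domain.dtEnergy]
  set B := Z.hsq (density u)
  set A := Z.hsq (deriv (density u))
  set D := Z.hsq (momentum u)
  set ν := Z.l2Norm (density u)
  set t1 := √(Z.l2Norm (Z.op oscSym (density u)) * Z.l2Norm (deriv (density u)))
    * Z.l2Norm (deriv (density u)) * Z.l2Norm (Z.op oscSym (momentum u))
  set t6 := √(Z.l2Norm (Z.op oscSym (density u)) * Z.l2Norm (deriv (density u)))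
    * Z.l2Norm (deriv (density u)) * Z.l2Norm (Z.op oscSym (density u))
  have ht6 : 0 ≤ 2 * (‖Z.mean (density u)‖ * B) + t6 := (norm_nonneg _).trans
    (norm_integral_hilbert_mul_sq_density_le hu)
  have ht4 : 0 ≤ √D * √B := by positivity
  have hQ : 2 * K * M * ν ^ 2 * (4 * (∫ x, momentum u x * deriv (density u) x ∂Z.measure).re
        + 3 * β * (∫ x, Z.op hilbertSym (deriv (density u)) x
            * (density u x * density u x) ∂Z.measure).re)
      ≤ l * (M * ν ^ 2 * (√D * √B + (2 * (‖Z.mean (density u)‖ * B) + t6))) := by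
    calc _ ≤ 2 * K * M * ν ^ 2 * ((4 + 3 * |β|) * (√D * √B + (2 * (‖Z.mean (density u)‖ * B) + t6))) := by
          gcongr
          linarith [mul_nonneg (abs_nonneg β) ht4]
      _ = _ := by rw [hl]; ring
  have hR' : -(3 / 2) * (Z.remainder α β u).re
      ≤ k * (t1 + ‖Z.mean (momentum u)‖ * B + ‖Z.mean (density u)‖ * (√B * √D)) := by
    refine hR.trans (le_of_eq ?_)
    rw [hk]; ring
  have hs : 0 ≤ Z.size u := by rw [← dataNorm_sq]; positivity
  set Y := (1 + M ^ 3) * (B * (Z.size u + M * ν ^ 4)) with hY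
  have hY0 : 0 ≤ Y := by positivity
  have hfin : (3 * k + 4 * l) * (ε * (A + D) + 16 * Y / ε ^ 2)
      ≤ -β / 8 * (A + D) + G * (16 / ε ^ 2) * Y := by
    calc (3 * k + 4 * l) * (ε * (A + D) + 16 * Y / ε ^ 2)
        ≤ G * (ε * (A + D) + 16 * Y / ε ^ 2) := by gcongr; linarith
      _ = (G * ε) * (A + D) + G * (16 / ε ^ 2) * Y := by ring
      _ ≤ _ := by gcongr
  have h3 : Z.massWeight * (β * B) ≤ 0 :=
    mul_nonpos_of_nonneg_of_nonpos hW (mul_nonpos_of_nonpos_of_nonneg hβ.le hB)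
  have h4 : 0 ≤ -β * D := mul_nonneg (neg_nonneg.2 hβ.le) hJ
  linarith

/-- The correction ∫ VJ is at most a constant times ‖ρ‖(sup|u|²)^{1/2}‖uₓ‖; its fourth power is
bounded by Mν⁴X⁶, so Young's inequality splits it between X² and Mν⁴. -/
theorem exists_energy_bounds (α β : ℝ) :
    ∃ K : ℝ, 0 ≤ K ∧ ∀ (Z : Domain) (u : ℝ → ℂ) (M : ℝ), Z.Nice 2 u → Z.l2Norm u ^ 2 ≤ M →
      Z.size u + M * Z.l2Norm (density u) ^ 4 ≤ 2 * Z.energy α β K M u ∧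
      Z.energy α β K M u ≤ (2 + 32 * K * M ^ 4) * Z.size u := by
  set L := 3 / 2 * (|α| + |β|) with hL
  have hL0 : 0 ≤ L := by positivity
  -- 1024 = 16·4³: the 16 comes from sup|u|² ≤ 4μX, and 4³ from allowing only a quarter of X². The 1
  -- makes the inequality strict in the contradiction.
  set K' := 1024 * L ^ 4 + 1 with hK'
  have hK0 : 0 < K' := by positivity
  refine ⟨K' + 1, by positivity, fun Z u M hu hM => ?_⟩
  have hX := dataNorm_nonneg Z u
  have hμ := l2Norm_nonneg (Z := Z) u
  have hS := supSq_nonneg u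
  have hM0 : 0 ≤ M := (sq_nonneg _).trans hM
  have hν := l2Norm_nonneg (Z := Z) (density u)
  have hx := l2Norm_nonneg (Z := Z) (deriv u)
  have h1 := const_mul_re_le (c := 3 / 2) (norm_integral_vel_mul_momentum_le (α := α) (β := β) hu)
  have h2 := const_mul_re_le (c := -(3 / 2)) (norm_integral_vel_mul_momentum_le (α := α) (β := β) hu)
  rw [abs_neg] at h2
  rw [abs_of_pos (by norm_num : (0 : ℝ) < 3 / 2)] at h1 h2
  set v := 3 / 2 * ((|α| + |β|) * (Z.l2Norm (density u) * (√(supSq u) * Z.l2Norm (deriv u)))) with hv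
  set Q := M * Z.l2Norm (density u) ^ 4 with hQ
  have hQ0 : 0 ≤ Q := by positivity
  have hv0 : 0 ≤ v := by positivity
  have hv4 : v ^ 4 ≤ 16 * L ^ 4 * (Q * (Z.dataNorm u ^ 2) ^ 3) := by
    have hS2 : √(supSq u) ^ 4 ≤ 16 * (M * Z.dataNorm u ^ 2) := by
      calc √(supSq u) ^ 4 = (√(supSq u) ^ 2) ^ 2 := by ring
        _ = supSq u ^ 2 := by rw [Real.sq_sqrt hS]
        _ ≤ (4 * (Z.l2Norm u * Z.dataNorm u)) ^ 2 := by gcongr; exact supSq_le_dataNorm hu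
        _ = 16 * (Z.l2Norm u ^ 2 * Z.dataNorm u ^ 2) := by ring
        _ ≤ _ := by gcongr
    calc v ^ 4 = L ^ 4 * (Z.l2Norm (density u) ^ 4 * (√(supSq u) ^ 4 * Z.l2Norm (deriv u) ^ 4)) := by
          rw [hv, hL]; ring
      _ ≤ L ^ 4 * (Z.l2Norm (density u) ^ 4 * (16 * (M * Z.dataNorm u ^ 2) * Z.dataNorm u ^ 4)) := by
          gcongr
          exact l2Norm_deriv_le_dataNorm Z u
      _ = _ := by rw [hQ]; ring
  have hvw : v ≤ 1 / 4 * Z.dataNorm u ^ 2 + K' * Q := by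
    by_contra! hc
    set w := 1 / 4 * Z.dataNorm u ^ 2 + K' * Q with hw
    have hw0 : 0 ≤ w := by positivity
    have e1 : Z.dataNorm u ^ 2 ≤ 4 * w := by
      have : 0 ≤ K' * Q := by positivity
      linarith
    have e2 : K' * Q ≤ w := by nlinarith [sq_nonneg (Z.dataNorm u)]
    have e3 : K' * v ^ 4 ≤ K' * w ^ 4 := by
      calc K' * v ^ 4 ≤ K' * (16 * L ^ 4 * (Q * (Z.dataNorm u ^ 2) ^ 3)) := by gcongr
        _ = 16 * L ^ 4 * ((K' * Q) * (Z.dataNorm u ^ 2) ^ 3) := by ring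
        _ ≤ 16 * L ^ 4 * (w * (4 * w) ^ 3) := by gcongr
        _ = (1024 * L ^ 4) * w ^ 4 := by ring
        _ ≤ K' * w ^ 4 := by gcongr; linarith
    have e4 : w ^ 4 < v ^ 4 := pow_lt_pow_left₀ hc hw0 (by norm_num)
    have e5 : K' * w ^ 4 < K' * v ^ 4 := mul_lt_mul_of_pos_left e4 hK0
    linarith
  have hs : Z.size u = Z.dataNorm u ^ 2 := (dataNorm_sq Z u).symm
  have hKQ : (K' + 1) * M * Z.l2Norm (density u) ^ 4 = (K' + 1) * Q := by rw [hQ]; ring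
  rw [Domain.energy, hKQ, hs]
  constructor
  · linarith [sq_nonneg (Z.dataNorm u)]
  · have hQM : Q ≤ 16 * M ^ 4 * Z.dataNorm u ^ 2 := by
      calc Q = M * (Z.l2Norm (density u) ^ 2) ^ 2 := by rw [hQ]; ring
        _ ≤ M * (4 * (Z.l2Norm u ^ 3 * Z.dataNorm u)) ^ 2 := by
            gcongr; exact sq_l2Norm_density_le_dataNorm hu
        _ = 16 * M * (Z.l2Norm u ^ 2) ^ 3 * Z.dataNorm u ^ 2 := by ring
        _ ≤ 16 * M * M ^ 3 * Z.dataNorm u ^ 2 := by gcongr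
        _ = _ := by ring
    have : (2 * K' + 1) * Q ≤ (2 * K' + 1) * (16 * M ^ 4 * Z.dataNorm u ^ 2) := by gcongr
    have e5 : 0 ≤ M ^ 4 * Z.dataNorm u ^ 2 := by positivity
    linarith [sq_nonneg (Z.dataNorm u)]

end

end KDNLS

/-! ### Differentiating mass, momentum and energy along a smooth solution. -/

namespace KDNLS

noncomputable section

section TwoVariables

variable {U : ℝ × ℝ → ℂ} {Ω : Set (ℝ × ℝ)} {t x : ℝ}

theorem hasDerivAt_fst (h : DifferentiableAt ℝ U (t, x)) :
    HasDerivAt (fun s => U (s, x)) (fderiv ℝ U (t, x) (1, 0)) t :=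
  h.hasFDerivAt.comp_hasDerivAt t ((hasDerivAt_id t).prodMk (hasDerivAt_const t x))

theorem hasDerivAt_snd (h : DifferentiableAt ℝ U (t, x)) :
    HasDerivAt (fun y => U (t, y)) (fderiv ℝ U (t, x) (0, 1)) x :=
  h.hasFDerivAt.comp_hasDerivAt x ((hasDerivAt_const x t).prodMk (hasDerivAt_id x))

theorem contDiffOn_fderiv_apply (hΩ : IsOpen Ω) (hU : ContDiffOn ℝ ∞ U Ω) (v : ℝ × ℝ) :
    ContDiffOn ℝ ∞ (fun p => fderiv ℝ U p v) Ω :=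
  (hU.fderiv_of_isOpen hΩ (by norm_num)).clm_apply contDiffOn_const

theorem differentiableAt_of_contDiffOn (hΩ : IsOpen Ω) (hU : ContDiffOn ℝ ∞ U Ω)
    {p : ℝ × ℝ} (hp : p ∈ Ω) : DifferentiableAt ℝ U p :=
  (hU.contDiffAt (hΩ.mem_nhds hp)).differentiableAt (by norm_num)

theorem fderiv_fderiv_apply_comm (hΩ : IsOpen Ω) (hU : ContDiffOn ℝ ∞ U Ω)
    {p : ℝ × ℝ} (hp : p ∈ Ω) (v w : ℝ × ℝ) :
    fderiv ℝ (fun q => fderiv ℝ U q v) p w = fderiv ℝ (fun q => fderiv ℝ U q w) p v := by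
  have hs : IsSymmSndFDerivAt ℝ U p :=
    (hU.contDiffAt (hΩ.mem_nhds hp)).isSymmSndFDerivAt (by simp; exact WithTop.coe_le_coe.2 le_top)
  have hd : DifferentiableAt ℝ (fderiv ℝ U) p :=
    ((hU.fderiv_of_isOpen (m := ∞) hΩ (by norm_num)).contDiffAt (hΩ.mem_nhds hp)).differentiableAt
      (by norm_num)
  have e : ∀ v : ℝ × ℝ, fderiv ℝ (fun q => fderiv ℝ U q v) p
      = (fderiv ℝ (fderiv ℝ U) p).flip v := fun v =>
    ((ContinuousLinearMap.apply ℝ ℂ v).hasFDerivAt.comp p hd.hasFDerivAt).fderiv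
  rw [e, e]
  exact hs w v

end TwoVariables

variable {Z : Domain} {α β T : ℝ} {φ : ℝ → ℂ} {u : ℝ → ℝ → ℂ}

theorem IsSmoothSolution.nice (h : IsSmoothSolution Z α β T φ u) {t : ℝ} (ht : t ∈ Set.Icc 0 T) :
    Z.Nice 2 (u t) := by
  refine ⟨?_, h.isFun t ht, fun k => h.memLp k t ht⟩
  rw [← contDiffOn_univ]
  exact h.smooth.comp (contDiff_const.prodMk contDiff_id).contDiffOn fun x _ => ⟨ht, trivial⟩

theorem IsSmoothSolution.fam (h : IsSmoothSolution Z α β T φ u) : Z.Fam (Set.Icc 0 T) u := by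
  refine ⟨fun t ht => h.nice ht, fun k t ht => ?_⟩
  refine tendsto_iff_dist_tendsto_zero.2 ?_
  have h1 := (ENNReal.tendsto_toReal ENNReal.zero_ne_top).comp (h.continuous k t ht)
  refine h1.congr' ?_
  filter_upwards [self_mem_nhdsWithin] with s hs
  exact (dist_toL2 (h.memLp k s hs) (h.memLp k t ht)).symm

theorem Domain.Fam.density {I : Set ℝ} (h : Z.Fam I u) : Z.Fam I (fun t => density (u t)) :=
  (h.conj.mul h).congr fun t _ => (density_eq (u t)).symm

theorem Domain.Fam.momentum {I : Set ℝ} (h : Z.Fam I u) : Z.Fam I (fun t => momentum (u t)) :=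
  ((h.conj.mul h.deriv).sub (h.mul h.deriv.conj)).const_mul _

theorem Domain.Fam.vel {I : Set ℝ} (h : Z.Fam I u) : Z.Fam I (fun t => Z.vel α β (u t)) :=
  Domain.Fam.op (symbolBound_vel α β) h.density fun t ht => nice_density (h.nice t ht)

theorem Domain.Fam.dtU {I : Set ℝ} (h : Z.Fam I u) : Z.Fam I (fun t => Z.dtU α β (u t)) :=
  (h.deriv.deriv.const_mul _).add ((h.vel.deriv.mul h).add (h.vel.mul h.deriv))

theorem Domain.Fam.dtDensity {I : Set ℝ} (h : Z.Fam I u) :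
    Z.Fam I (fun t => Z.dtDensity α β (u t)) :=
  (h.momentum.deriv.const_mul _).add (((h.vel.deriv.mul h.density).const_mul 2).add
    (h.vel.mul h.density.deriv))

theorem Domain.Fam.dtMomentum {I : Set ℝ} (h : Z.Fam I u) :
    Z.Fam I (fun t => Z.dtMomentum α β (u t)) :=
  ((h.density.deriv.deriv.deriv.const_mul _).add (h.deriv.density.deriv.const_mul _)).add
    (((h.vel.deriv.mul h.momentum).const_mul 3).add (h.vel.mul h.momentum.deriv))

theorem isOpen_strip (T : ℝ) : IsOpen (Set.Ioo 0 T ×ˢ (Set.univ : Set ℝ)) :=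
  isOpen_Ioo.prod isOpen_univ

theorem IsSmoothSolution.smooth_strip (h : IsSmoothSolution Z α β T φ u) :
    ContDiffOn ℝ ∞ (fun p : ℝ × ℝ => u p.1 p.2) (Set.Ioo 0 T ×ˢ Set.univ) :=
  h.smooth.mono (Set.prod_mono Set.Ioo_subset_Icc_self le_rfl)

/-- Identifies the nonlinearity of the statement with (Vu)ₓ. -/
theorem deriv_vel_mul {v : ℝ → ℂ} (hv : Z.Nice 2 v) (x : ℝ) :
    α * deriv (fun y => density v y * v y) x + β * deriv (fun y => Z.hilbert (density v) y * v y) x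
      = deriv (Z.vel α β v) x * v x + Z.vel α β v x * deriv v x := by
  have hρ := nice_density hv
  rw [hilbert_eq_op hρ]
  have hH := nice_op symbolBound_hilbert hρ
  have h1 := (hρ.hasDerivAt x).mul (hv.hasDerivAt x)
  have h2 := (hH.hasDerivAt x).mul (hv.hasDerivAt x)
  have e1 : deriv (fun y => density v y * v y) x = _ := h1.deriv
  have e2 : deriv (fun y => Z.op hilbertSym (density v) y * v y) x = _ := h2.deriv
  have e3 : deriv (Z.vel α β v) x
      = α * deriv (density v) x + β * deriv (Z.op hilbertSym (density v)) x := by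
    rw [deriv_vel hv, op_vel hρ.deriv, deriv_op symbolBound_hilbert hρ]
  rw [e1, e2, e3, Domain.vel, op_vel hρ]
  ring

theorem IsSmoothSolution.fderiv_fst (h : IsSmoothSolution Z α β T φ u) {t : ℝ}
    (ht : t ∈ Set.Ioo 0 T) (x : ℝ) :
    fderiv ℝ (fun p : ℝ × ℝ => u p.1 p.2) (t, x) (1, 0) = Z.dtU α β (u t) x := by
  have hu := h.nice (Set.Ioo_subset_Icc_self ht)
  have h1 := hasDerivAt_fst (differentiableAt_of_contDiffOn (isOpen_strip T) h.smooth_strip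
    (p := (t, x)) ⟨ht, trivial⟩)
  have h2 := h.equation t ⟨ht.1, ht.2.le⟩ x
  rw [derivWithin_of_mem_nhds (Icc_mem_nhds ht.1 ht.2), h1.deriv, deriv_vel_mul hu,
    iteratedDeriv_succ, iteratedDeriv_one] at h2
  rw [Domain.dtU, ← h2]
  ring

theorem IsSmoothSolution.hasDerivAt (h : IsSmoothSolution Z α β T φ u) {t : ℝ}
    (ht : t ∈ Set.Ioo 0 T) (x : ℝ) : HasDerivAt (fun s => u s x) (Z.dtU α β (u t) x) t := by
  rw [← h.fderiv_fst ht]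
  exact hasDerivAt_fst (differentiableAt_of_contDiffOn (isOpen_strip T) h.smooth_strip
    (p := (t, x)) ⟨ht, trivial⟩)

theorem IsSmoothSolution.fderiv_snd (h : IsSmoothSolution Z α β T φ u) {t : ℝ}
    (ht : t ∈ Set.Ioo 0 T) (x : ℝ) :
    fderiv ℝ (fun p : ℝ × ℝ => u p.1 p.2) (t, x) (0, 1) = deriv (u t) x :=
  (hasDerivAt_snd (differentiableAt_of_contDiffOn (isOpen_strip T) h.smooth_strip
    (p := (t, x)) ⟨ht, trivial⟩)).deriv.symm

theorem IsSmoothSolution.fderiv_snd_fst (h : IsSmoothSolution Z α β T φ u) {t : ℝ}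
    (ht : t ∈ Set.Ioo 0 T) (x : ℝ) :
    fderiv ℝ (fun q => fderiv ℝ (fun p : ℝ × ℝ => u p.1 p.2) q (1, 0)) (t, x) (0, 1)
      = deriv (Z.dtU α β (u t)) x := by
  have h1 := hasDerivAt_snd (differentiableAt_of_contDiffOn (isOpen_strip T)
    (contDiffOn_fderiv_apply (isOpen_strip T) h.smooth_strip (1, 0)) (p := (t, x)) ⟨ht, trivial⟩)
  simp only [h.fderiv_fst ht] at h1
  exact h1.deriv.symm

/-- Symmetry of the second derivative on the open strip exchanges ∂ₜ and ∂ₓ. -/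
theorem IsSmoothSolution.hasDerivAt_deriv (h : IsSmoothSolution Z α β T φ u) {t : ℝ}
    (ht : t ∈ Set.Ioo 0 T) (x : ℝ) :
    HasDerivAt (fun s => deriv (u s) x) (deriv (Z.dtU α β (u t)) x) t := by
  have h1 := hasDerivAt_fst (differentiableAt_of_contDiffOn (isOpen_strip T)
    (contDiffOn_fderiv_apply (isOpen_strip T) h.smooth_strip (0, 1)) (p := (t, x)) ⟨ht, trivial⟩)
  rw [fderiv_fderiv_apply_comm (isOpen_strip T) h.smooth_strip ⟨ht, trivial⟩,
    h.fderiv_snd_fst ht] at h1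
  refine h1.congr_of_eventuallyEq ?_
  filter_upwards [isOpen_Ioo.mem_nhds ht] with s hs
  exact (h.fderiv_snd hs x).symm

theorem IsSmoothSolution.continuousOn (h : IsSmoothSolution Z α β T φ u) :
    ContinuousOn (Function.uncurry u) (Set.Ioo 0 T ×ˢ Set.univ) := h.smooth_strip.continuousOn

theorem IsSmoothSolution.continuousOn_deriv (h : IsSmoothSolution Z α β T φ u) :
    ContinuousOn (Function.uncurry fun t => deriv (u t)) (Set.Ioo 0 T ×ˢ Set.univ) :=
  (contDiffOn_fderiv_apply (isOpen_strip T) h.smooth_strip (0, 1)).continuousOn.congr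
    fun p hp => (h.fderiv_snd hp.1 p.2).symm

theorem IsSmoothSolution.continuousOn_dtU (h : IsSmoothSolution Z α β T φ u) :
    ContinuousOn (Function.uncurry fun t => Z.dtU α β (u t)) (Set.Ioo 0 T ×ˢ Set.univ) :=
  (contDiffOn_fderiv_apply (isOpen_strip T) h.smooth_strip (1, 0)).continuousOn.congr
    fun p hp => (h.fderiv_fst hp.1 p.2).symm

theorem IsSmoothSolution.continuousOn_deriv_dtU (h : IsSmoothSolution Z α β T φ u) :
    ContinuousOn (Function.uncurry fun t => deriv (Z.dtU α β (u t))) (Set.Ioo 0 T ×ˢ Set.univ) :=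
  (contDiffOn_fderiv_apply (isOpen_strip T) (contDiffOn_fderiv_apply (isOpen_strip T)
    h.smooth_strip (1, 0)) (0, 1)).continuousOn.congr fun p hp => (h.fderiv_snd_fst hp.1 p.2).symm

variable {t : ℝ}

theorem Domain.Fam.hasDerivAt_toL2 {a b : ℝ} {F G : ℝ → ℝ → ℂ} (hF : Z.Fam (Set.Icc a b) F)
    (hG : Z.Fam (Set.Icc a b) G) (hd : ∀ t ∈ Set.Ioo a b, ∀ x, HasDerivAt (fun s => F s x) (G t x) t)
    (hj : ContinuousOn (Function.uncurry G) (Set.Ioo a b ×ˢ Set.univ)) (ht : t ∈ Set.Ioo a b) :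
    HasDerivAt (fun s => Z.toL2 (F s)) (Z.toL2 (G t)) t :=
  KDNLS.hasDerivAt_toL2 (fun s hs => (hF.nice s (Set.Ioo_subset_Icc_self hs)).memLp_self)
    (fun s hs => (hG.nice s (Set.Ioo_subset_Icc_self hs)).memLp_self) hd hj
    (hG.cont_zero.mono Set.Ioo_subset_Icc_self) ht

theorem IsSmoothSolution.hasDerivAt_toL2 (h : IsSmoothSolution Z α β T φ u) (ht : t ∈ Set.Ioo 0 T) :
    HasDerivAt (fun s => Z.toL2 (u s)) (Z.toL2 (Z.dtU α β (u t))) t :=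
  h.fam.hasDerivAt_toL2 h.fam.dtU (fun _ hs x => h.hasDerivAt hs x) h.continuousOn_dtU ht

theorem IsSmoothSolution.hasDerivAt_toL2_deriv (h : IsSmoothSolution Z α β T φ u)
    (ht : t ∈ Set.Ioo 0 T) :
    HasDerivAt (fun s => Z.toL2 (deriv (u s))) (Z.toL2 (deriv (Z.dtU α β (u t)))) t :=
  h.fam.deriv.hasDerivAt_toL2 h.fam.dtU.deriv (fun _ hs x => h.hasDerivAt_deriv hs x)
    h.continuousOn_deriv_dtU ht

theorem continuousOn_conj {I : Set ℝ} {F : ℝ → ℝ → ℂ}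
    (hF : ContinuousOn (Function.uncurry F) (I ×ˢ Set.univ)) :
    ContinuousOn (fun p : ℝ × ℝ => (starRingEnd ℂ) (F p.1 p.2)) (I ×ˢ Set.univ) :=
  Complex.continuous_conj.comp_continuousOn hF

theorem IsSmoothSolution.hasDerivAt_toL2_density (h : IsSmoothSolution Z α β T φ u)
    (ht : t ∈ Set.Ioo 0 T) :
    HasDerivAt (fun s => Z.toL2 (density (u s))) (Z.toL2 (Z.dtDensity α β (u t))) t := by
  refine h.fam.density.hasDerivAt_toL2 h.fam.dtDensity (fun s hs x => ?_) ?_ ht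
  · rw [← conj_mul_dtU (h.nice (Set.Ioo_subset_Icc_self hs))]
    simp only [density_apply]
    exact (h.hasDerivAt hs x).star.mul (h.hasDerivAt hs x)
  · refine (((continuousOn_conj h.continuousOn_dtU).mul h.continuousOn).add
      ((continuousOn_conj h.continuousOn).mul h.continuousOn_dtU)).congr fun p hp => ?_
    exact (conj_mul_dtU (h.nice (Set.Ioo_subset_Icc_self hp.1)) p.2).symm

theorem IsSmoothSolution.hasDerivAt_toL2_momentum (h : IsSmoothSolution Z α β T φ u)
    (ht : t ∈ Set.Ioo 0 T) :
    HasDerivAt (fun s => Z.toL2 (momentum (u s))) (Z.toL2 (Z.dtMomentum α β (u t))) t := by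
  refine h.fam.momentum.hasDerivAt_toL2 h.fam.dtMomentum (fun s hs x => ?_) ?_ ht
  · rw [← momentum_dtU (h.nice (Set.Ioo_subset_Icc_self hs))]
    exact (((h.hasDerivAt hs x).star.mul (h.hasDerivAt_deriv hs x)).sub
      ((h.hasDerivAt hs x).mul (h.hasDerivAt_deriv hs x).star)).const_mul _
  · refine ((continuousOn_const (c := -(Complex.I / 2))).mul ((((continuousOn_conj h.continuousOn_dtU).mul
      h.continuousOn_deriv).add ((continuousOn_conj h.continuousOn).mul
      h.continuousOn_deriv_dtU)).sub ((h.continuousOn_dtU.mul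
      (continuousOn_conj h.continuousOn_deriv)).add (h.continuousOn.mul
      (continuousOn_conj h.continuousOn_deriv_dtU))))).congr fun p hp => ?_
    exact (momentum_dtU (h.nice (Set.Ioo_subset_Icc_self hp.1)) p.2).symm

theorem IsSmoothSolution.hasDerivAt_toL2_vel (h : IsSmoothSolution Z α β T φ u)
    (ht : t ∈ Set.Ioo 0 T) : HasDerivAt (fun s => Z.toL2 (Z.vel α β (u s)))
      (Z.toL2 (Z.op (velSym α β) (Z.dtDensity α β (u t)))) t :=
  hasDerivAt_toL2_op (symbolBound_vel α β) (Icc_mem_nhds ht.1 ht.2)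
    (fun _ hs => nice_density (h.nice hs))
    (nice_dtDensity (h.nice (Set.Ioo_subset_Icc_self ht))) (h.hasDerivAt_toL2_density ht)

theorem hasDerivAt_re {f : ℝ → ℂ} {f' : ℂ} (h : HasDerivAt f f' t) :
    HasDerivAt (fun s => (f s).re) f'.re t :=
  Complex.reCLM.hasFDerivAt.comp_hasDerivAt t h

theorem sq_l2Norm_eq_re {f : ℝ → ℂ} (hf : MemLp f 2 Z.measure) :
    Z.l2Norm f ^ 2 = (∫ x, (starRingEnd ℂ) (f x) * f x ∂Z.measure).re := by
  rw [sq_l2Norm hf]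
  have e : ∀ x, (starRingEnd ℂ) (f x) * f x = ((‖f x‖ ^ 2 : ℝ) : ℂ) := fun x => by
    rw [Complex.conj_mul']; push_cast; rfl
  simp only [e]
  rw [integral_complex_ofReal, Complex.ofReal_re]

theorem hasDerivAt_sq_l2Norm {I : Set ℝ} {F : ℝ → ℝ → ℂ} {f' : ℝ → ℂ} (hI : I ∈ nhds t)
    (hF : ∀ s ∈ I, MemLp (F s) 2 Z.measure) (hf' : MemLp f' 2 Z.measure)
    (h : HasDerivAt (fun s => Z.toL2 (F s)) (Z.toL2 f') t) :
    HasDerivAt (fun s => Z.l2Norm (F s) ^ 2)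
      (∫ x, (starRingEnd ℂ) (F t x) * f' x ∂Z.measure
        + ∫ x, (starRingEnd ℂ) (f' x) * F t x ∂Z.measure).re t := by
  refine (hasDerivAt_re (hasDerivAt_integral_conj_mul hI hF hF hf' hf' h h)).congr_of_eventuallyEq ?_
  filter_upwards [hI] with s hs
  exact sq_l2Norm_eq_re (hF s hs)

/-- Mass dissipation. -/
theorem IsSmoothSolution.hasDerivAt_mass (h : IsSmoothSolution Z α β T φ u) (ht : t ∈ Set.Ioo 0 T) :
    HasDerivAt (fun s => Z.l2Norm (u s) ^ 2) (β * Z.hsq (density (u t))) t := by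
  have hu := h.nice (Set.Ioo_subset_Icc_self ht)
  have hd := nice_dtU (α := α) (β := β) hu
  have h1 := hasDerivAt_sq_l2Norm (Icc_mem_nhds ht.1 ht.2) (fun s hs => (h.nice hs).memLp_self)
    hd.memLp_self (h.hasDerivAt_toL2 ht)
  rw [add_comm, ← integral_add (hd.conj.mul hu).integrable (hu.conj.mul hd).integrable] at h1
  simp only [conj_mul_dtU hu] at h1
  rw [integral_dtDensity hu, ← Complex.ofReal_mul, Complex.ofReal_re] at h1
  exact h1

theorem IsSmoothSolution.hasDerivAt_sq_l2Norm_deriv (h : IsSmoothSolution Z α β T φ u)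
    (ht : t ∈ Set.Ioo 0 T) :
    HasDerivAt (fun s => Z.l2Norm (deriv (u s)) ^ 2) (β * Z.hsq (deriv (density (u t)))
      + 3 * (∫ x, deriv (Z.vel α β (u t)) x * density (deriv (u t)) x ∂Z.measure).re) t := by
  have hu := h.nice (Set.Ioo_subset_Icc_self ht)
  have hd := nice_dtU (α := α) (β := β) hu
  have h1 := hasDerivAt_sq_l2Norm (Icc_mem_nhds ht.1 ht.2)
    (fun s hs => (h.nice hs).deriv.memLp_self) hd.deriv.memLp_self (h.hasDerivAt_toL2_deriv ht)
  rw [add_comm, ← integral_add (hd.deriv.conj.mul hu.deriv).integrable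
    (hu.deriv.conj.mul hd.deriv).integrable, integral_conj_mul_deriv_dtU hu] at h1
  convert h1 using 1
  simp [← Complex.ofReal_mul]

theorem IsSmoothSolution.hasDerivAt_sq_l2Norm_density (h : IsSmoothSolution Z α β T φ u)
    (ht : t ∈ Set.Ioo 0 T) :
    HasDerivAt (fun s => Z.l2Norm (density (u s)) ^ 2)
      (4 * (∫ x, momentum (u t) x * deriv (density (u t)) x ∂Z.measure).re
        + 3 * β * (∫ x, Z.op hilbertSym (deriv (density (u t))) x
            * (density (u t) x * density (u t) x) ∂Z.measure).re) t := by
  have hu := h.nice (Set.Ioo_subset_Icc_self ht)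
  have h1 := hasDerivAt_sq_l2Norm (Icc_mem_nhds ht.1 ht.2)
    (fun s hs => (nice_density (h.nice hs)).two.memLp_self) (nice_dtDensity hu).two.memLp_self
    (h.hasDerivAt_toL2_density ht)
  rw [integral_conj_mul_of_isReal (isReal_density _),
    integral_conj_mul_of_isReal (isReal_dtDensity hu)] at h1
  have e : ∫ x, Z.dtDensity α β (u t) x * density (u t) x ∂Z.measure
      = ∫ x, density (u t) x * Z.dtDensity α β (u t) x ∂Z.measure := by simp only [mul_comm]
  rw [e, integral_density_mul_dtDensity hu] at h1
  convert h1 using 1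
  have e2 : (3 / 2 : ℂ) * (β * ∫ x, Z.op hilbertSym (deriv (density (u t))) x
            * (density (u t) x * density (u t) x) ∂Z.measure)
      = ((3 / 2 * β : ℝ) : ℂ) * ∫ x, Z.op hilbertSym (deriv (density (u t))) x
            * (density (u t) x * density (u t) x) ∂Z.measure := by push_cast; ring
  have e3 : (2 : ℂ) * (∫ x, momentum (u t) x * deriv (density (u t)) x ∂Z.measure)
      = ((2 : ℝ) : ℂ) * (∫ x, momentum (u t) x * deriv (density (u t)) x ∂Z.measure) := by
    push_cast; ring
  rw [e2, e3, Complex.add_re, Complex.add_re, Complex.re_ofReal_mul, Complex.re_ofReal_mul]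
  ring

theorem IsSmoothSolution.hasDerivAt_integral_vel_mul_momentum (h : IsSmoothSolution Z α β T φ u)
    (ht : t ∈ Set.Ioo 0 T) :
    HasDerivAt (fun s => (∫ x, Z.vel α β (u s) x * momentum (u s) x ∂Z.measure).re)
      (-2 * β * Z.hsq (momentum (u t)) + β / 2 * Z.hsq (deriv (density (u t)))
        + 2 * (∫ x, deriv (Z.vel α β (u t)) x * density (deriv (u t)) x ∂Z.measure).re
        + (Z.remainder α β (u t)).re) t := by
  have hu := h.nice (Set.Ioo_subset_Icc_self ht)
  have hr : IsReal (Z.op (velSym α β) (Z.dtDensity α β (u t))) :=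
    isReal_op (fun ξ => velSym_neg ξ) (isReal_dtDensity hu)
  have h1 := hasDerivAt_re (hasDerivAt_integral_conj_mul (Icc_mem_nhds ht.1 ht.2)
    (fun s hs => (nice_vel (α := α) (β := β) (h.nice hs)).memLp_self)
    (fun s hs => (nice_momentum (h.nice hs)).two.memLp_self)
    (nice_op (symbolBound_vel α β) (nice_dtDensity (α := α) (β := β) hu)).memLp_self
    (nice_dtMomentum (α := α) (β := β) hu).two.memLp_self
    (h.hasDerivAt_toL2_vel ht) (h.hasDerivAt_toL2_momentum ht))
  rw [integral_conj_mul_of_isReal (isReal_vel Z α β (u t)), integral_conj_mul_of_isReal hr, add_comm,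
    integral_dt_vel_mul_momentum hu] at h1
  simp only [integral_conj_mul_of_isReal (isReal_vel Z α β _)] at h1
  convert h1 using 1
  have e2 : (-2 * ((β : ℂ) * (Z.hsq (momentum (u t)) : ℂ))
      + 1 / 2 * ((β : ℂ) * (Z.hsq (deriv (density (u t))) : ℂ)) : ℂ)
      = ((-2 * β * Z.hsq (momentum (u t)) + β / 2 * Z.hsq (deriv (density (u t))) : ℝ) : ℂ) := by
    push_cast; ring
  have e3 : (2 : ℂ) * (∫ x, deriv (Z.vel α β (u t)) x * density (deriv (u t)) x ∂Z.measure)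
      = ((2 : ℝ) : ℂ) * ∫ x, deriv (Z.vel α β (u t)) x * density (deriv (u t)) x ∂Z.measure := by
    push_cast; ring
  rw [e2, e3, Complex.add_re, Complex.add_re, Complex.re_ofReal_mul, Complex.ofReal_re]

/-- The two multiples of ∫ Vₓ|uₓ|² cancel here, as 3 - (3/2)·2 = 0. M is a constant, so it is not
differentiated. -/
theorem IsSmoothSolution.hasDerivAt_energy (h : IsSmoothSolution Z α β T φ u) (K M : ℝ)
    (ht : t ∈ Set.Ioo 0 T) :
    HasDerivAt (fun s => Z.energy α β K M (u s)) (Z.dtEnergy α β K M (u t)) t := by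
  have h1 := ((((h.hasDerivAt_mass ht).const_mul Z.massWeight).add
    (h.hasDerivAt_sq_l2Norm_deriv ht)).sub
    ((h.hasDerivAt_integral_vel_mul_momentum ht).const_mul (3 / 2))).add
    (((h.hasDerivAt_sq_l2Norm_density ht).pow 2).const_mul (K * M))
  refine (h1.congr_deriv ?_).congr_of_eventuallyEq (Filter.Eventually.of_forall fun s => ?_)
  · rw [Domain.dtEnergy]
    push_cast
    ring
  · simp only [Domain.energy, Domain.size, Pi.add_apply, Pi.sub_apply, Pi.pow_apply]
    ring

theorem continuousOn_re {I : Set ℝ} {f : ℝ → ℂ} (h : ContinuousOn f I) :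
    ContinuousOn (fun s => (f s).re) I := Complex.continuous_re.comp_continuousOn h

theorem IsSmoothSolution.continuousOn_mass (h : IsSmoothSolution Z α β T φ u) :
    ContinuousOn (fun s => Z.l2Norm (u s) ^ 2) (Set.Icc 0 T) := h.fam.continuousOn_l2Norm.pow 2

theorem IsSmoothSolution.continuousOn_energy (h : IsSmoothSolution Z α β T φ u) (K M : ℝ) :
    ContinuousOn (fun s => Z.energy α β K M (u s)) (Set.Icc 0 T) := by
  have h1 := continuousOn_re ((h.fam.vel (α := α) (β := β)).continuousOn_integral h.fam.momentum)
  simp only [integral_conj_mul_of_isReal (isReal_vel Z α β _)] at h1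
  exact (((continuousOn_const.mul h.continuousOn_mass).add
    (h.fam.deriv.continuousOn_l2Norm.pow 2)).sub (continuousOn_const.mul h1)).add
    (continuousOn_const.mul (h.fam.density.continuousOn_l2Norm.pow 4))

/-- The seminorm is written as the L² pairing of ρₓ with 𝓗ρₓₓ, both continuous in time. -/
theorem IsSmoothSolution.continuousOn_hsq (h : IsSmoothSolution Z α β T φ u) :
    ContinuousOn (fun s => Z.hsq (deriv (density (u s)))) (Set.Icc 0 T) := by
  have h1 := Domain.Fam.op symbolBound_hilbert h.fam.density.deriv.deriv
    fun s hs => (nice_density (h.nice hs)).deriv.deriv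
  refine (continuousOn_re (h.fam.density.deriv.continuousOn_integral h1)).congr fun s hs => ?_
  simp only
  rw [integral_conj_mul_hilbert_deriv (nice_density (h.nice hs)).deriv, Complex.ofReal_re]

end

end KDNLS

/-! ### Grönwall arguments in time. -/

namespace KDNLS

noncomputable section

section Primitive

variable {T t : ℝ} {f : ℝ → ℝ}

theorem intervalIntegrable_of_continuousOn_Icc (hf : ContinuousOn f (Set.Icc 0 T))
    (ht : t ∈ Set.Icc 0 T) : IntervalIntegrable f volume 0 t :=
  (hf.mono (by rw [Set.uIcc_of_le ht.1]; exact Set.Icc_subset_Icc_right ht.2)).intervalIntegrable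

theorem continuousOn_integral_zero (hT : 0 ≤ T) (hf : ContinuousOn f (Set.Icc 0 T)) :
    ContinuousOn (fun t => ∫ s in 0..t, f s) (Set.Icc 0 T) := by
  have h := intervalIntegral.continuousOn_primitive_interval (μ := volume) (a := 0) (b := T) (f := f)
    (by rw [Set.uIcc_of_le hT]; exact hf.integrableOn_Icc)
  rwa [Set.uIcc_of_le hT] at h

theorem hasDerivAt_integral_zero (hf : ContinuousOn f (Set.Icc 0 T)) (ht : t ∈ Set.Ioo 0 T) :
    HasDerivAt (fun t => ∫ s in 0..t, f s) (f t) t :=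
  intervalIntegral.integral_hasDerivAt_right
    (intervalIntegrable_of_continuousOn_Icc hf (Set.Ioo_subset_Icc_self ht))
    ((hf.mono Set.Ioo_subset_Icc_self).stronglyMeasurableAtFilter isOpen_Ioo t ht)
    (hf.continuousAt (Icc_mem_nhds ht.1 ht.2))

theorem antitoneOn_of_hasDerivAt {f' : ℝ → ℝ} (hf : ContinuousOn f (Set.Icc 0 T))
    (hd : ∀ t ∈ Set.Ioo 0 T, HasDerivAt f (f' t) t) (h : ∀ t ∈ Set.Ioo 0 T, f' t ≤ 0) :
    AntitoneOn f (Set.Icc 0 T) := by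
  refine antitoneOn_of_deriv_nonpos (convex_Icc 0 T) hf ?_ ?_ <;> rw [interior_Icc]
  · exact fun t ht => (hd t ht).differentiableAt.differentiableWithinAt
  · exact fun t ht => by rw [(hd t ht).deriv]; exact h t ht

theorem integral_sqrt_le (hf : ContinuousOn f (Set.Icc 0 T)) (h0 : ∀ s, 0 ≤ f s)
    (ht : t ∈ Set.Icc 0 T) : ∫ s in 0..t, √(f s) ≤ √t * √(∫ s in 0..t, f s) := by
  have hf' : ContinuousOn f (Set.Icc 0 t) := hf.mono (Set.Icc_subset_Icc_right ht.2)
  rw [intervalIntegral.integral_of_le ht.1, intervalIntegral.integral_of_le ht.1]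
  have h := integral_mul_le_sqrt_mul_sqrt (μ := volume.restrict (Set.Ioc 0 t)) (p := fun _ => 1)
    (q := fun s => √(f s)) aestronglyMeasurable_const
    ((hf'.sqrt.mono Set.Ioc_subset_Icc_self).aestronglyMeasurable measurableSet_Ioc)
    (fun _ => zero_le_one) (fun s => Real.sqrt_nonneg _) (by simp)
    (by
      simp only [Real.sq_sqrt (h0 _)]
      exact hf'.integrableOn_Icc.mono_set Set.Ioc_subset_Icc_self)
  simp only [one_mul, one_pow, Real.sq_sqrt (h0 _)] at h
  refine h.trans (le_of_eq ?_)
  congr 2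
  simp [ht.1]

end Primitive

variable {Z : Domain} {α β T t : ℝ} {φ : ℝ → ℂ} {u : ℝ → ℝ → ℂ}

theorem IsSmoothSolution.antitoneOn_mass (h : IsSmoothSolution Z α β T φ u) (hβ : β < 0) :
    AntitoneOn (fun s => Z.l2Norm (u s) ^ 2) (Set.Icc 0 T) :=
  antitoneOn_of_hasDerivAt h.continuousOn_mass (fun _ hs => h.hasDerivAt_mass hs)
    fun _ _ => mul_nonpos_of_nonpos_of_nonneg hβ.le (hsq_nonneg _)

/-- The energy inequality with the mass dissipation as an integrating factor. -/
theorem IsSmoothSolution.energy_inequality (h : IsSmoothSolution Z α β T φ u) (hβ : β < 0)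
    (hT : 0 < T) {K M κ : ℝ} (hκ : 0 ≤ κ) (hM : M = Z.l2Norm (u 0) ^ 2)
    (hE : ∀ s ∈ Set.Icc 0 T,
      Z.size (u s) + M * Z.l2Norm (density (u s)) ^ 4 ≤ 2 * Z.energy α β K M (u s))
    (hE' : ∀ s ∈ Set.Icc 0 T, Z.dtEnergy α β K M (u s)
      ≤ β / 8 * Z.hsq (deriv (density (u s))) + κ * ((1 + M ^ 3) * (Z.hsq (density (u s))
        * (Z.size (u s) + M * Z.l2Norm (density (u s)) ^ 4))))
    (ht : t ∈ Set.Icc 0 T) :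
    Z.energy α β K M (u t) + -β / 8 * ∫ s in 0..t, Z.hsq (deriv (density (u s)))
      ≤ Z.energy α β K M (u 0) * Real.exp (2 * κ / -β * ((1 + M ^ 3) * M)) := by
  have hM0 : 0 ≤ M := by rw [hM]; positivity
  have hb : 0 < -β := neg_pos.2 hβ
  -- Since the mass has derivative βB, the factor exp(k(‖u‖² - M)) contributes -k|β|B times the
  -- energy, which cancels the growth term exactly.
  set k := 2 * κ * (1 + M ^ 3) / -β with hk
  have hk0 : 0 ≤ k := by positivity
  set q := Real.exp (-(k * M)) with hq
  have hcA := h.continuousOn_hsq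
  -- The dissipated quantity is weighted by the constant q = exp(-kM), a lower bound of the
  -- integrating factor, so the remaining β/8 term controls it.
  have hanti : AntitoneOn (fun s => Z.energy α β K M (u s) * Real.exp (k * (Z.l2Norm (u s) ^ 2 - M))
      + -β / 8 * q * ∫ s in 0..s, Z.hsq (deriv (density (u s)))) (Set.Icc 0 T) := by
    refine antitoneOn_of_hasDerivAt
      (((h.continuousOn_energy K M).mul (Real.continuous_exp.comp_continuousOn
        (continuousOn_const.mul (h.continuousOn_mass.sub continuousOn_const)))).add
        (continuousOn_const.mul (continuousOn_integral_zero hT.le hcA)))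
      (fun s hs => ((h.hasDerivAt_energy K M hs).mul
        (((h.hasDerivAt_mass hs).sub_const M).const_mul k).exp).add
        ((hasDerivAt_integral_zero hcA hs).const_mul (-β / 8 * q))) fun s hs => ?_
    have hs' := Set.Ioo_subset_Icc_self hs
    have hA := hsq_nonneg (Z := Z) (deriv (density (u s)))
    have hB := hsq_nonneg (Z := Z) (density (u s))
    have h1 := hE s hs'
    have h2 := hE' s hs'
    have hqe : q ≤ Real.exp (k * (Z.l2Norm (u s) ^ 2 - M)) := by
      rw [hq]
      refine Real.exp_le_exp.2 ?_
      have : 0 ≤ k * Z.l2Norm (u s) ^ 2 := by positivity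
      linarith
    set e := Real.exp (k * (Z.l2Norm (u s) ^ 2 - M))
    have he : 0 ≤ e := (Real.exp_pos _).le
    have h3 : Z.dtEnergy α β K M (u s) ≤ β / 8 * Z.hsq (deriv (density (u s)))
        + 2 * κ * (1 + M ^ 3) * (Z.hsq (density (u s)) * Z.energy α β K M (u s)) := by
      refine h2.trans ?_
      have : κ * ((1 + M ^ 3) * (Z.hsq (density (u s))
          * (Z.size (u s) + M * Z.l2Norm (density (u s)) ^ 4)))
          ≤ κ * ((1 + M ^ 3) * (Z.hsq (density (u s)) * (2 * Z.energy α β K M (u s)))) := by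
        gcongr
      linarith
    have hkb : k * -β = 2 * κ * (1 + M ^ 3) := div_mul_cancel₀ _ hb.ne'
    have h4 := mul_le_mul_of_nonneg_right h3 he
    have h5 : -β / 8 * q * Z.hsq (deriv (density (u s)))
        ≤ -β / 8 * e * Z.hsq (deriv (density (u s))) := by gcongr
    calc _ = Z.dtEnergy α β K M (u s) * e - k * -β * Z.hsq (density (u s))
            * Z.energy α β K M (u s) * e + -β / 8 * q * Z.hsq (deriv (density (u s))) := by ring
      _ ≤ 0 := by rw [hkb]; linarith
  have h1 := hanti (Set.left_mem_Icc.2 hT.le) ht ht.1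
  simp only [intervalIntegral.integral_same, mul_zero, add_zero] at h1
  rw [← hM, sub_self, mul_zero, Real.exp_zero, mul_one] at h1
  have hs0 : 0 ≤ Z.size (u t) := by rw [← dataNorm_sq]; positivity
  have hEt : 0 ≤ Z.energy α β K M (u t) := by
    have := hE t ht
    have h2 : 0 ≤ M * Z.l2Norm (density (u t)) ^ 4 := by positivity
    linarith
  have hqe : q ≤ Real.exp (k * (Z.l2Norm (u t) ^ 2 - M)) := by
    rw [hq]
    refine Real.exp_le_exp.2 ?_
    have : 0 ≤ k * Z.l2Norm (u t) ^ 2 := by positivity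
    linarith
  have h2 : (Z.energy α β K M (u t) + -β / 8 * ∫ s in 0..t, Z.hsq (deriv (density (u s)))) * q
      ≤ Z.energy α β K M (u 0) := by
    have := mul_le_mul_of_nonneg_left hqe hEt
    linarith
  have hexp : 2 * κ / -β * ((1 + M ^ 3) * M) = k * M := by rw [hk]; ring
  rw [hexp, ← div_le_iff₀ (Real.exp_pos _), div_eq_mul_inv, ← Real.exp_neg]
  exact h2

/-- Lower bound for the mass in terms of the smoothing norm. -/
theorem IsSmoothSolution.mass_ge (h : IsSmoothSolution Z α β T φ u) (hβ : β < 0)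
    (hT : 0 < T) (ht : t ∈ Set.Icc 0 T) :
    Z.l2Norm (u 0) ^ 2 * Real.exp (-(2 * -β * ∫ s in 0..t, √(Z.hsq (deriv (density (u s))))))
      ≤ Z.l2Norm (u t) ^ 2 := by
  have hcA := h.continuousOn_hsq.sqrt
  -- The sign makes this the monotone growth of mass · exp(2|β|∫√A), which follows from B ≤ 2‖u‖²√A.
  have hanti : AntitoneOn (fun s => -(Z.l2Norm (u s) ^ 2
      * Real.exp (2 * -β * ∫ s in 0..s, √(Z.hsq (deriv (density (u s))))))) (Set.Icc 0 T) := by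
    refine antitoneOn_of_hasDerivAt
      ((h.continuousOn_mass.mul (Real.continuous_exp.comp_continuousOn
        (continuousOn_const.mul (continuousOn_integral_zero hT.le hcA)))).neg)
      (fun s hs => ((h.hasDerivAt_mass hs).mul
        ((hasDerivAt_integral_zero hcA hs).const_mul (2 * -β)).exp).neg) fun s hs => ?_
    have h1 := hsq_density_le_mass_mul (h.nice (Set.Ioo_subset_Icc_self hs))
    set e := Real.exp (2 * -β * ∫ s in 0..s, √(Z.hsq (deriv (density (u s)))))
    have he : 0 ≤ -β * e := mul_nonneg (neg_nonneg.2 hβ.le) (Real.exp_pos _).le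
    have := mul_le_mul_of_nonneg_left h1 he
    linarith
  have h1 := hanti (Set.left_mem_Icc.2 hT.le) ht ht.1
  simp only [intervalIntegral.integral_same, mul_zero, Real.exp_zero, mul_one] at h1
  rw [Real.exp_neg, ← div_eq_mul_inv, div_le_iff₀ (Real.exp_pos _)]
  linarith

theorem IsSmoothSolution.lintegral_halfD (h : IsSmoothSolution Z α β T φ u) (ht : t ∈ Set.Icc 0 T) :
    ∫⁻ s in Set.Ioc 0 t, eLpNorm (Z.halfD (deriv (density (u s)))) 2 Z.measure ^ 2
      = ENNReal.ofReal (∫ s in 0..t, Z.hsq (deriv (density (u s)))) := by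
  have hc : ContinuousOn (fun s => Z.hsq (deriv (density (u s)))) (Set.Icc 0 t) :=
    h.continuousOn_hsq.mono (Set.Icc_subset_Icc_right ht.2)
  rw [intervalIntegral.integral_of_le ht.1, ofReal_integral_eq_lintegral_ofReal
    (hc.integrableOn_Icc.mono_set Set.Ioc_subset_Icc_self) (ae_of_all _ fun s => hsq_nonneg _)]
  refine setLIntegral_congr_fun measurableSet_Ioc fun s hs => ?_
  exact eLpNorm_halfD_sq (nice_density (h.nice ⟨hs.1.le, hs.2.trans ht.2⟩)).deriv

end

end KDNLS

/-! ### Conclusion: choice of constants and the three estimates. -/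

open KDNLS

theorem proposition4p2 (α β : ℝ) (hβ : β < 0) :
    ∃ C : ℝ, 0 < C ∧
      ∀ (Z : KDNLS.Domain) (T : ℝ) (φ : ℝ → ℂ) (u : ℝ → ℝ → ℂ), 0 < T →
        KDNLS.IsSmoothSolution Z α β T φ u →
        ∀ t ∈ Set.Icc 0 T,
          (∫⁻ s in Set.Ioc 0 t,
              MeasureTheory.eLpNorm (Z.halfD (deriv (KDNLS.density (u s)))) 2 Z.measure ^ 2
            ≤ ENNReal.ofReal (C * (1 + Z.l2Norm φ ^ 4) * Z.dataNorm φ ^ 2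
                * Real.exp (C * (1 + Z.l2Norm φ ^ 6) * Z.l2Norm φ ^ 2))) ∧
          Z.l2Norm (deriv (u t)) ^ 2
            ≤ C * (1 + Z.l2Norm φ ^ 8) * Z.dataNorm φ ^ 2
                * Real.exp (C * (1 + Z.l2Norm φ ^ 6) * Z.l2Norm φ ^ 2) ∧
          Z.l2Norm φ ^ 2
              * Real.exp (-(C * Real.sqrt t * (1 + Z.l2Norm φ ^ 2) * Z.dataNorm φ
                  * Real.exp (C * (1 + Z.l2Norm φ ^ 6) * Z.l2Norm φ ^ 2)))
            ≤ Z.l2Norm (u t) ^ 2 := by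
  obtain ⟨K, hK, hE⟩ := exists_energy_bounds α β
  obtain ⟨κ, hκ, hE'⟩ := exists_dtEnergy_le α hβ hK
  have hb : 0 < -β := neg_pos.2 hβ
  -- c₁ and c₂ are the prefactors of the first two estimates and 2|β|√c₁ that of the third; c₃ is
  -- the Grönwall exponent, and c₃ + 1 leaves room to absorb a polynomial in ‖φ‖. Their sum serves
  -- for all three.
  set c₁ := 8 / -β * (2 + 32 * K) with hc₁
  set c₂ := 2 * (2 + 32 * K) with hc₂
  set c₃ := 2 * κ / -β with hc₃
  have hc₁0 : 0 < c₁ := by positivity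
  have hc₂0 : 0 < c₂ := by positivity
  have hc₃0 : 0 ≤ c₃ := by positivity
  have hc₄0 : 0 ≤ 2 * -β * √c₁ := by positivity
  set C := c₁ + c₂ + (c₃ + 1) + 2 * -β * √c₁ with hC
  have hC0 : 0 < C := by positivity
  refine ⟨C, hC0, fun Z T φ u hT h t ht => ?_⟩
  obtain rfl : u 0 = φ := funext h.initial
  have h0 : (0 : ℝ) ∈ Set.Icc 0 T := Set.left_mem_Icc.2 hT.le
  have hmass : ∀ s ∈ Set.Icc 0 T, Z.l2Norm (u s) ^ 2 ≤ Z.l2Norm (u 0) ^ 2 := fun s hs =>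
    h.antitoneOn_mass hβ h0 hs hs.1
  have hen := h.energy_inequality hβ hT hκ rfl
    (fun s hs => (hE Z (u s) _ (h.nice hs) (hmass s hs)).1)
    (fun s hs => hE' Z (u s) _ (h.nice hs) (hmass s hs)) ht
  have hEt := (hE Z (u t) _ (h.nice ht) (hmass t ht)).1
  have hE0 := (hE Z (u 0) _ (h.nice h0) le_rfl).2
  have hx : Z.l2Norm (deriv (u t)) ^ 2 ≤ Z.size (u t) := by
    rw [← dataNorm_sq]
    exact pow_le_pow_left₀ (l2Norm_nonneg _) (l2Norm_deriv_le_dataNorm Z (u t)) 2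
  have hI0 : 0 ≤ ∫ s in 0..t, Z.hsq (deriv (density (u s))) :=
    intervalIntegral.integral_nonneg ht.1 fun s _ => hsq_nonneg _
  have hQ0 : 0 ≤ Z.l2Norm (u 0) ^ 2 * Z.l2Norm (density (u t)) ^ 4 := by positivity
  have hmassge := h.mass_ge hβ hT ht
  have hcs := integral_sqrt_le h.continuousOn_hsq (fun s => hsq_nonneg _) ht
  rw [h.lintegral_halfD ht]
  rw [← dataNorm_sq] at hE0
  rw [← hc₃] at hen
  have hX := dataNorm_nonneg Z (u 0)
  have hμ := l2Norm_nonneg (Z := Z) (u 0)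
  set μ := Z.l2Norm (u 0)
  set X := Z.dataNorm (u 0)
  set I := ∫ s in 0..t, Z.hsq (deriv (density (u s)))
  have hθ : (1 + (μ ^ 2) ^ 3) * μ ^ 2 = (1 + μ ^ 6) * μ ^ 2 := by ring
  rw [hθ] at hen
  rw [mul_assoc C (1 + μ ^ 6)]
  set θ := (1 + μ ^ 6) * μ ^ 2 with hθdef
  have hθ0 : 0 ≤ θ := by positivity
  -- The initial energy costs 1 + μ⁸, more than the 1 + μ⁴ allowed in the smoothing estimate; since
  -- θ = μ² + μ⁸, the exponential absorbs it.
  have hpoly : 1 + μ ^ 8 ≤ Real.exp θ := by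
    refine (add_comm (1 : ℝ) _ ▸ Real.add_one_le_exp (μ ^ 8)).trans (Real.exp_le_exp.2 ?_)
    rw [hθdef]
    have := sq_nonneg μ
    linarith [show (1 + μ ^ 6) * μ ^ 2 = μ ^ 2 + μ ^ 8 by ring]
  have hE0' : Z.energy α β K (μ ^ 2) (u 0) ≤ (2 + 32 * K) * ((1 + μ ^ 8) * X ^ 2) := by
    refine hE0.trans ?_
    have h1 : 0 ≤ K * X ^ 2 := by positivity
    have h2 : 0 ≤ μ ^ 8 * X ^ 2 := by positivity
    calc (2 + 32 * K * (μ ^ 2) ^ 4) * X ^ 2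
        = 2 * X ^ 2 + 32 * K * (μ ^ 8 * X ^ 2) := by ring
      _ ≤ _ := by linarith
  have hen2 : Z.energy α β K (μ ^ 2) (u t) + -β / 8 * I
      ≤ (2 + 32 * K) * ((1 + μ ^ 8) * X ^ 2) * Real.exp (c₃ * θ) :=
    hen.trans (mul_le_mul_of_nonneg_right hE0' (Real.exp_pos _).le)
  have hsize0 : 0 ≤ Z.size (u t) := (sq_nonneg _).trans hx
  have hI : I ≤ c₁ * X ^ 2 * Real.exp ((c₃ + 1) * θ) := by
    have h1 : -β / 8 * I ≤ (2 + 32 * K) * ((1 + μ ^ 8) * X ^ 2) * Real.exp (c₃ * θ) := by linarith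
    have h2 : (2 + 32 * K) * ((1 + μ ^ 8) * X ^ 2) * Real.exp (c₃ * θ)
        ≤ (2 + 32 * K) * (Real.exp θ * X ^ 2) * Real.exp (c₃ * θ) := by gcongr
    have h3 : Real.exp ((c₃ + 1) * θ) = Real.exp (c₃ * θ) * Real.exp θ := by
      rw [← Real.exp_add]; ring_nf
    rw [h3, hc₁]
    calc I = 8 / -β * (-β / 8 * I) := by
          rw [← mul_assoc, div_mul_div_cancel₀' (by norm_num), div_self hb.ne', one_mul]
      _ ≤ 8 / -β * ((2 + 32 * K) * (Real.exp θ * X ^ 2) * Real.exp (c₃ * θ)) := by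
          exact mul_le_mul_of_nonneg_left (h1.trans h2) (by positivity)
      _ = _ := by ring
  have hCθ : ∀ {c : ℝ}, c ≤ C → Real.exp (c * θ) ≤ Real.exp (C * θ) := fun hc =>
    Real.exp_le_exp.2 (mul_le_mul_of_nonneg_right hc hθ0)
  refine ⟨?_, ?_, ?_⟩
  · refine ENNReal.ofReal_le_ofReal (hI.trans ?_)
    calc c₁ * X ^ 2 * Real.exp ((c₃ + 1) * θ) = c₁ * 1 * X ^ 2 * Real.exp ((c₃ + 1) * θ) := by ring
      _ ≤ C * (1 + μ ^ 4) * X ^ 2 * Real.exp (C * θ) := by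
          gcongr
          · linarith
          · linarith [show 0 ≤ μ ^ 4 by positivity]
          · linarith
  · have h1 : 0 ≤ -β / 8 * I := by positivity
    calc Z.l2Norm (deriv (u t)) ^ 2
        ≤ 2 * ((2 + 32 * K) * ((1 + μ ^ 8) * X ^ 2) * Real.exp (c₃ * θ)) := by linarith
      _ = c₂ * (1 + μ ^ 8) * X ^ 2 * Real.exp (c₃ * θ) := by rw [hc₂]; ring
      _ ≤ C * (1 + μ ^ 8) * X ^ 2 * Real.exp (C * θ) := by
          gcongr
          · linarith
          · linarith
  · refine le_trans (mul_le_mul_of_nonneg_left (Real.exp_le_exp.2 (neg_le_neg ?_))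
      (sq_nonneg μ)) hmassge
    have h1 : √I ≤ √c₁ * X * Real.exp ((c₃ + 1) * θ) := by
      -- The square of the claimed bound contains the square of the exponential, while ∫ A dt is
      -- bounded with its first power.
      have he : 1 ≤ Real.exp ((c₃ + 1) * θ) := Real.one_le_exp (by positivity)
      rw [← Real.sqrt_sq (by positivity : 0 ≤ √c₁ * X * Real.exp ((c₃ + 1) * θ))]
      refine Real.sqrt_le_sqrt (hI.trans ?_)
      rw [mul_pow, mul_pow, Real.sq_sqrt hc₁0.le]
      gcongr
      nlinarith
    calc 2 * -β * ∫ s in 0..t, √(Z.hsq (deriv (density (u s))))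
        ≤ 2 * -β * (√t * (√c₁ * X * Real.exp ((c₃ + 1) * θ))) := by
          gcongr
          exact hcs.trans (by gcongr)
      _ = (2 * -β * √c₁) * √t * 1 * X * Real.exp ((c₃ + 1) * θ) := by ring
      _ ≤ C * √t * (1 + μ ^ 2) * X * Real.exp (C * θ) := by
          gcongr
          · linarith
          · linarith [sq_nonneg μ]
          · linarith
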